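/- Let $\mathbb K$ be $\mathbb R$ or $\mathbb C$, $X$ a topological space with an open covering $X=\bigcup_{\lambda\in\Lambda}U_\lambda$, and $A$ a small filtered category. **Definitions.** An *ind-object* on an open set $U$ is (given by) a functor $\mathcal F=(\mathcal F_\alpha)_{\alpha\in A}$ from a small filtered category to presheaves of super vector spaces on $U$ (with even restriction maps; morphisms are all linear morphisms). Morphisms $\mathcal F\to\mathcal G$ are the elements $([F_\alpha^{j(\alpha)}])_\alpha$ of $\varprojlim_\alpha\varinjlim_\beta\mathrm{Hom}(\mathcal F_\alpha,\mathcal G_\beta)$, and bilinear morphisms $\mathcal F\times\mathcal G\to\mathcal H$ are the elements of $\varprojlim_{(\alpha,\beta)}\varinjlim_\gamma\mathrm{Bilin}(\mathcal F_\alpha,\mathcal G_\beta;\mathcal H_\gamma)$; such a morphism is *even* if its components have even representatives. For $\mathcal F,\mathcal G$ indexed by the same category $A$, a morphism is *strict* if it has the form $([F_\alpha^\alpha])_\alpha$ with $F_\alpha^\alpha:\mathcal F_\alpha\to\mathcal G_\alpha$. A *VSA-inductive sheaf* on $U$ indexed by $A$ is an ind-object $\mathcal F$ of sheaves on $U$,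 indexed by $A$, with even injective transition maps, together with an even morphism $\underline{\mathbf 1}:\mathbb K_U\to\mathcal F$ from the presheaf of constant functions (indexed by one point), an even morphism $\underline T:\mathcal F\to\mathcal F$ and even bilinear morphisms $\underline{(n)}:\mathcal F\times\mathcal F\to\mathcal F$, $n\in\mathbb Z$, such that the induced maps make $\varinjlim_\alpha\mathcal F_\alpha(V)$ a vertex superalgebra for every open $V\subset U$. It is *degree-weight-graded* if it is given morphisms $\underline H=([H_\alpha])_\alpha$ and $\underline J=([J_\alpha])_\alpha$ of ind-objects $\mathcal F\to\mathcal F$, with $H_\alpha,J_\alpha:\mathcal F_\alpha\to\mathcal F_\alpha$ even and diagonalizable on sections over every open set, such that for all $n$ $$\underline{(n)}\circ(\mathrm{id}\times\underline H+\underline H\times\mathrm{id})=(\underline H+n+1)\circ\underline{(n)},\qquad \underline{(n)}\circ(\mathrm{id}\times\underline J+\underline J\times\mathrm{id})=\underline J\circ\underline{(n)},$$ and $\mathcal F_\alpha=\bigoplus_{n,l\in\mathbb Z}\mathcal F_\alpha^l[n]$, where $\mathcal F_\alpha^l[n]=\mathrm{Ker}(H_\alpha-n)\cap\mathrm{Ker}(J_\alpha-l)$.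 A *morphism of VSA-inductive sheaves* is an even morphism of ind-objects commuting with $\underline{\mathbf 1},\underline T$ and all $\underline{(n)}$; a *strict morphism* of degree-weight-graded VSA-inductive sheaves is one that is moreover strict and commutes with $\underline H$ and $\underline J$. A *strict isomorphism* is a strict morphism with a strict inverse. **Assumptions.** For all $\alpha,\alpha'\in A$, $\mathrm{Hom}_A(\alpha,\alpha')\ne\emptyset$ or $\mathrm{Hom}_A(\alpha',\alpha)\neq\emptyset$. A *gluing datum* consists of degree-weight-graded VSA-inductive sheaves $\mathcal V^\lambda=(\mathcal F^\lambda,\underline{\mathbf 1}^\lambda,\underline T^\lambda,\underline{(n)}^\lambda)$ on $U_\lambda$ indexed by $A$ and strict isomorphisms $\vartheta_{\lambda\mu}:\mathcal V^\mu|_{U_\lambda\cap U_\mu}\to\mathcal V^\lambda|_{U_\lambda\cap U_\mu}$ with $\vartheta_{\lambda\lambda}=\mathrm{id}$ and $\vartheta_{\lambda\mu}\circ\vartheta_{\mu\nu}=\vartheta_{\lambda\nu}$ on $U_\lambda\cap U_\mu\cap U_\nu$. It is *uniform* if 1. there is $\alpha_0\in A$ such that every $\underline{\mathbf 1}^\lambda$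 is the class of some $\mathbb K_{U_\lambda}\to\mathcal F^\lambda_{\alpha_0}$; 2. there is $j_T:\mathrm{Ob}(A)\to\mathrm{Ob}(A)$ such that for every $\lambda$, $\underline T^\lambda=([\underline T^\lambda_\alpha])_\alpha$ for some $\underline T^\lambda_\alpha:\mathcal F^\lambda_\alpha\to\mathcal F^\lambda_{j_T(\alpha)}$; 3. for each $n$ there is $j_{(n)}:\mathrm{Ob}(A)^2\to\mathrm{Ob}(A)$ such that for every $\lambda$, $\underline{(n)}^\lambda$ is given by classes of bilinear morphisms $\mathcal F^\lambda_\alpha\times\mathcal F^\lambda_{\alpha'}\to\mathcal F^\lambda_{j_{(n)}(\alpha,\alpha')}$; 4. there are $N\in\mathbb Z$ and $N_\alpha,L_\alpha\in\mathbb N$ with $\mathcal F^\lambda_\alpha=\bigoplus_{N\le n\le N_\alpha}\bigoplus_{|l|\le L_\alpha}(\mathcal F^\lambda_\alpha)^l[n]$ for all $\lambda$ and $\alpha$. **Gluing of objects.** For every uniform gluing datum there are a degree-weight-graded VSA-inductive sheaf $\mathcal V$ on $X$ indexed by $A$ and strict isomorphisms $\Phi^\lambda:\mathcal V|_{U_\lambda}\to\mathcal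 V^\lambda$ such that $\Phi^\lambda\circ(\Phi^\mu)^{-1}=\vartheta_{\lambda\mu}$ on $U_\lambda\cap U_\mu$ for all $\lambda,\mu$. If $(\mathcal V',(\Phi'^\lambda))$ is another such pair, there is a strict isomorphism $F:\mathcal V\to\mathcal V'$ with $\Phi'^\lambda\circ F|_{U_\lambda}=\Phi^\lambda$ for all $\lambda$. **Gluing of morphisms.** Let $(\mathcal V^\lambda,\vartheta_{\lambda\mu})$ and $(\mathcal V'^\lambda,\vartheta'_{\lambda\mu})$ be uniform gluing data with glued objects $(\mathcal V,\Phi^\lambda)$ and $(\mathcal V',\Phi'^\lambda)$ as above. Let $F^\lambda:\mathcal V^\lambda\to\mathcal V'^\lambda$ be morphisms of ind-objects with $\vartheta'_{\lambda\mu}\circ F^\mu=F^\lambda\circ\vartheta_{\lambda\mu}$ on $U_\lambda\cap U_\mu$ for all $\lambda,\mu$, and suppose there is $j_F:\mathrm{Ob}(A)\to\mathrm{Ob}(A)$ such that every $F^\lambda$ is of the form $([F^{\lambda}_\alpha])_\alpha$ with $F^{\lambda}_\alpha:\mathcal F^\lambda_\alpha\to\mathcal F'^\lambda_{j_F(\alpha)}$.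 Then there is exactly one morphism of ind-objects $F:\mathcal V\to\mathcal V'$ with $\Phi'^\lambda\circ F|_{U_\lambda}=F^\lambda\circ\Phi^\lambda$ for all $\lambda$. It has the form $([F_\alpha])_\alpha$ with $F_\alpha:\mathcal F_\alpha\to\mathcal F'_{j_F(\alpha)}$. If all $F^\lambda$ are strict (as morphisms of ind-objects), so is $F$; if all $F^\lambda$ are even, so is $F$; if all $F^\lambda$ commute with $\underline{\mathbf 1}$, $\underline T$ and the $\underline{(n)}$, so does $F$. In particular, if all $F^\lambda$ are morphisms of VSA-inductive sheaves (resp. strict morphisms of degree-weight-graded VSA-inductive sheaves), so is $F$. -/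

import Mathlib

open CategoryTheory CategoryTheory.Limits Opposite TopologicalSpace

universe u

namespace VSAInd

/-! ### Presheaves and sheaves of super vector spaces on an open subset -/

section Presheaves

variable {K : Type} [Field K] {X : Type u} [TopologicalSpace X]

/-- A presheaf of super vector spaces over `K` on the open subset `U` of `X`.  The open subsets of
the space `U` are the open subsets of `X` contained in `U`, that is, the elements of `Set.Iic U`;
in particular `U = ⊤` gives the presheaves on `X`.  The restriction maps are even. -/
structure SuperPresheaf (K : Type) [Field K] {X : Type u} [TopologicalSpace X]
    (U : Opens X) : Type (u + 1) where
  carrier : (Set.Iic U)ᵒᵖ ⥤ ModuleCat.{u} K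
  parity : ∀ V : Set.Iic U, ZMod 2 → Submodule K (carrier.obj (op V))
  isInternal : ∀ V, DirectSum.IsInternal (parity V)
  map_mem : ∀ {V W : Set.Iic U} (f : V ⟶ W) (p : ZMod 2) (x : carrier.obj (op W)),
    x ∈ parity W p → carrier.map f.op x ∈ parity V p

/-- Morphisms are all linear morphisms of presheaves, not only the even ones. -/
instance (U : Opens X) : Category (SuperPresheaf K U) where
  Hom P Q := P.carrier ⟶ Q.carrier
  id P := 𝟙 P.carrier
  comp f g := NatTrans.vcomp f g

/-- The component of a morphism of presheaves on an open subset, as a linear map. -/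
def SuperPresheaf.onOpen {U : Opens X} {P Q : SuperPresheaf K U} (f : P ⟶ Q) (V : Set.Iic U) :
    P.carrier.obj (op V) →ₗ[K] Q.carrier.obj (op V) :=
  (NatTrans.app f (op V)).hom

/-- The restriction map of a presheaf from `W` to `V ≤ W`. -/
def SuperPresheaf.res {U : Opens X} (P : SuperPresheaf K U) {V W : Set.Iic U} (h : V ≤ W) :
    P.carrier.obj (op W) →ₗ[K] P.carrier.obj (op V) :=
  (P.carrier.map (homOfLE h).op).hom

/-- A morphism of presheaves of super vector spaces is even if it preserves the parity. -/
def SuperPresheaf.IsEven {U : Opens X} {P Q : SuperPresheaf K U} (f : P ⟶ Q) : Prop :=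
  ∀ (V : Set.Iic U) (p : ZMod 2) (x : P.carrier.obj (op V)),
    x ∈ P.parity V p → SuperPresheaf.onOpen f V x ∈ Q.parity V p

/-- The sheaf condition: sections over the members of an open covering `S` of `W` which agree on
the overlaps come from exactly one section over `W`.  (In `Set.Iic U` the least upper bound of `S`
is the union of its members.) -/
def SuperPresheaf.IsSheaf {U : Opens X} (P : SuperPresheaf K U) : Prop :=
  ∀ (W : Set.Iic U) (S : Set (Set.Iic U)) (hS : IsLUB S W)
    (s : ∀ V : S, P.carrier.obj (op V.1)),
    (∀ V V' : S, P.res (inf_le_left : V.1 ⊓ V'.1 ≤ V.1) (s V) =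
      P.res (inf_le_right : V.1 ⊓ V'.1 ≤ V'.1) (s V')) →
    ∃! t : P.carrier.obj (op W), ∀ V : S, P.res (hS.1 V.2) t = s V

/-- The inclusion of the poset of open subsets of `W` in that of `U`, for `W ≤ U`. -/
def opensIncl {W U : Opens X} (h : W ≤ U) : Set.Iic W ⥤ Set.Iic U :=
  Monotone.functor (f := fun V => (⟨V.1, V.2.trans h⟩ : Set.Iic U)) (fun _ _ hV => hV)

/-- The restriction of a presheaf to a smaller open subset. -/
def SuperPresheaf.restrict {W U : Opens X} (P : SuperPresheaf K U) (h : W ≤ U) :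
    SuperPresheaf K W where
  carrier := (opensIncl h).op ⋙ P.carrier
  parity V := P.parity ((opensIncl h).obj V)
  isInternal V := P.isInternal ((opensIncl h).obj V)
  map_mem f p x hx := P.map_mem ((opensIncl h).map f) p x hx

/-- The restriction of presheaves to a smaller open subset, as a functor. -/
def restrictFunctor (K : Type) [Field K] {W U : Opens X} (h : W ≤ U) :
    SuperPresheaf K U ⥤ SuperPresheaf K W where
  obj P := P.restrict h
  map {P Q} f := Functor.whiskerLeft (opensIncl h).op (show P.carrier ⟶ Q.carrier from f)
  map_id _ := rfl
  map_comp _ _ := rfl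

/-- The functor of sections over a fixed open subset. -/
def sectionsAt (K : Type) [Field K] {U : Opens X} (V : Set.Iic U) :
    SuperPresheaf K U ⥤ ModuleCat.{u} K where
  obj P := P.carrier.obj (op V)
  map f := NatTrans.app f (op V)
  map_id _ := rfl
  map_comp _ _ := rfl

/-- A bilinear morphism `P × Q → R` of presheaves of super vector spaces. -/
@[ext]
structure Bilin {U : Opens X} (P Q R : SuperPresheaf K U) : Type u where
  app : ∀ V : Set.Iic U,
    P.carrier.obj (op V) →ₗ[K] Q.carrier.obj (op V) →ₗ[K] R.carrier.obj (op V)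
  naturality : ∀ {V W : Set.Iic U} (h : V ≤ W) (x : P.carrier.obj (op W))
    (y : Q.carrier.obj (op W)), app V (P.res h x) (Q.res h y) = R.res h (app W x y)

/-- Composition of a bilinear morphism with morphisms into its two arguments: `b ∘ (f × g)`. -/
def Bilin.precomp {U : Opens X} {P P' Q Q' R : SuperPresheaf K U} (b : Bilin P Q R)
    (f : P' ⟶ P) (g : Q' ⟶ Q) : Bilin P' Q' R where
  app V := (b.app V).compl₁₂ (SuperPresheaf.onOpen f V) (SuperPresheaf.onOpen g V)
  naturality {V W} h x y := by
    have hf : SuperPresheaf.onOpen f V (P'.res h x) = P.res h (SuperPresheaf.onOpen f W x) :=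
      NatTrans.naturality_apply (F := P'.carrier) (G := P.carrier) f (homOfLE h).op x
    have hg : SuperPresheaf.onOpen g V (Q'.res h y) = Q.res h (SuperPresheaf.onOpen g W y) :=
      NatTrans.naturality_apply (F := Q'.carrier) (G := Q.carrier) g (homOfLE h).op y
    simp only [LinearMap.compl₁₂_apply, hf, hg, b.naturality]

/-- Composition of a bilinear morphism with a morphism out of its target: `g ∘ b`. -/
def Bilin.postcomp {U : Opens X} {P Q R R' : SuperPresheaf K U} (b : Bilin P Q R)
    (g : R ⟶ R') : Bilin P Q R' where
  app V := (b.app V).compr₂ (SuperPresheaf.onOpen g V)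
  naturality {V W} h x y := by
    have hg : ∀ z, SuperPresheaf.onOpen g V (R.res h z) = R'.res h (SuperPresheaf.onOpen g W z) :=
      fun z => NatTrans.naturality_apply (F := R.carrier) (G := R'.carrier) g (homOfLE h).op z
    simp only [LinearMap.compr₂_apply, b.naturality, hg]

instance {U : Opens X} (P Q R : SuperPresheaf K U) : Add (Bilin P Q R) where
  add b c :=
    { app := fun V => b.app V + c.app V
      naturality := fun h x y => by
        simp only [LinearMap.add_apply, b.naturality, c.naturality, map_add] }

instance {U : Opens X} (P Q R : SuperPresheaf K U) : SMul ℤ (Bilin P Q R) where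
  smul n b :=
    { app := fun V => n • b.app V
      naturality := fun h x y => by
        simp only [LinearMap.smul_apply, b.naturality, map_zsmul] }

/-- A bilinear morphism is even if it is compatible with the parities. -/
def Bilin.IsEven {U : Opens X} {P Q R : SuperPresheaf K U} (b : Bilin P Q R) : Prop :=
  ∀ (V : Set.Iic U) (p q : ZMod 2) (x : P.carrier.obj (op V)) (y : Q.carrier.obj (op V)),
    x ∈ P.parity V p → y ∈ Q.parity V q → b.app V x y ∈ R.parity V (p + q)

/-- The restriction of a bilinear morphism to a smaller open subset. -/
def Bilin.restrict {W U : Opens X} {P Q R : SuperPresheaf K U} (b : Bilin P Q R) (h : W ≤ U) :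
    Bilin (P.restrict h) (Q.restrict h) (R.restrict h) where
  app V := b.app ((opensIncl h).obj V)
  naturality hV x y := b.naturality ((opensIncl h).map (homOfLE hV)).le x y

/-- The presheaf `R ↦ Bilin (P, Q; R)` on the category of presheaves of super vector spaces,
covariant in `R`. -/
def bilinFunctor {U : Opens X} (P Q : SuperPresheaf K U) : SuperPresheaf K U ⥤ Type u where
  obj R := Bilin P Q R
  map g := ↾(fun b => Bilin.postcomp b g)
  map_id _ := rfl
  map_comp _ _ := rfl

/-- The presheaf of constant `K`-valued functions, purely even. -/
def constPresheaf (K : Type) [Field K] {X : Type u} [TopologicalSpace X] (U : Opens X) :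
    SuperPresheaf K U where
  carrier := (Functor.const _).obj (ModuleCat.of K (ULift.{u} K))
  parity _ p := if p = 0 then ⊤ else ⊥
  isInternal _ := by
    rw [DirectSum.isInternal_submodule_iff_isCompl _ (i := 0) (j := 1) (by decide)
      (Set.ext fun p =>
        ⟨fun _ => by fin_cases p; exacts [Or.inl rfl, Or.inr rfl], fun _ => trivial⟩)]
    simpa using isCompl_top_bot
  map_mem _ _ _ hx := hx

end Presheaves

/-! ### Ind-objects and their morphisms

An ind-object of presheaves of super vector spaces is given by its inductive system, a functor
from a small filtered category. -/

section Ind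

variable {K : Type} [Field K] {X : Type u} [TopologicalSpace X] {U W : Opens X}
  {A B C : Type u} [SmallCategory A] [SmallCategory B] [SmallCategory C]

/-- The restriction of an inductive system to a smaller open subset. -/
abbrev resSys (F : A ⥤ SuperPresheaf K U) (h : W ≤ U) : A ⥤ SuperPresheaf K W :=
  F ⋙ restrictFunctor K h

/-- The set `colim_β Hom (P, G_β)`. -/
def HomGerm (P : SuperPresheaf K U) (G : B ⥤ SuperPresheaf K U) : Type u :=
  (G ⋙ coyoneda.obj (op P)).ColimitType

/-- The class `[f]` of a morphism `f : P ⟶ G_β`. -/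
def HomGerm.mk {P : SuperPresheaf K U} (G : B ⥤ SuperPresheaf K U) (β : B) (f : P ⟶ G.obj β) :
    HomGerm P G :=
  (G ⋙ coyoneda.obj (op P)).ιColimitType β f

/-- The map `[f] ↦ [f ∘ g]`. -/
def HomGerm.precomp {P P' : SuperPresheaf K U} {G : B ⥤ SuperPresheaf K U} (x : HomGerm P G)
    (g : P' ⟶ P) : HomGerm P' G :=
  Quot.lift (fun y : Σ β, (P ⟶ G.obj β) => HomGerm.mk G y.1 (g ≫ y.2))
    (by
      rintro ⟨β, f⟩ ⟨β', f'⟩ ⟨k, hk⟩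
      refine Quot.sound ⟨k, ?_⟩
      change f' = f ≫ G.map k at hk
      change g ≫ f' = (g ≫ f) ≫ G.map k
      rw [hk, Category.assoc]) x

/-- The set of morphisms of ind-objects, `lim_α colim_β Hom (F_α, G_β)`. -/
@[ext]
structure IndHom (F : A ⥤ SuperPresheaf K U) (G : B ⥤ SuperPresheaf K U) : Type u where
  app : ∀ α, HomGerm (F.obj α) G
  compat : ∀ {α α' : A} (f : α ⟶ α'), (app α').precomp (F.map f) = app α

/-- The map `[f : P ⟶ G_β] ↦ Φ_β ∘ f` for a morphism `Φ` of ind-objects. -/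
def HomGerm.bind {P : SuperPresheaf K U} {G : B ⥤ SuperPresheaf K U}
    {H : C ⥤ SuperPresheaf K U} (x : HomGerm P G) (Φ : IndHom G H) : HomGerm P H :=
  Quot.lift (fun y : Σ β, (P ⟶ G.obj β) => (Φ.app y.1).precomp y.2)
    (by
      rintro ⟨β, f⟩ ⟨β', f'⟩ ⟨k, hk⟩
      change f' = f ≫ G.map k at hk
      change (Φ.app β).precomp f = (Φ.app β').precomp f'
      rw [hk, ← Φ.compat k]
      generalize Φ.app β' = z
      induction z using Quot.ind with
      | _ z =>
        change HomGerm.mk _ _ _ = HomGerm.mk _ _ _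
        rw [Category.assoc]) x

theorem HomGerm.precomp_bind {P P' : SuperPresheaf K U} {G : B ⥤ SuperPresheaf K U}
    {H : C ⥤ SuperPresheaf K U} (x : HomGerm P G) (g : P' ⟶ P) (Φ : IndHom G H) :
    (x.precomp g).bind Φ = (x.bind Φ).precomp g := by
  induction x using Quot.ind with
  | _ x =>
    change (Φ.app x.1).precomp (g ≫ x.2) = ((Φ.app x.1).precomp x.2).precomp g
    generalize Φ.app x.1 = z
    induction z using Quot.ind with
    | _ z =>
      change HomGerm.mk _ _ _ = HomGerm.mk _ _ _
      rw [Category.assoc]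

/-- The identity morphism of an ind-object. -/
def IndHom.id (F : A ⥤ SuperPresheaf K U) : IndHom F F where
  app α := HomGerm.mk F α (𝟙 (F.obj α))
  compat {α α'} f := by
    refine (Quot.sound ⟨f, ?_⟩ : HomGerm.mk F α (𝟙 (F.obj α)) = _).symm
    change F.map f ≫ 𝟙 _ = 𝟙 _ ≫ F.map f
    rw [Category.comp_id, Category.id_comp]

/-- The composite `Ψ ∘ Φ` of morphisms of ind-objects. -/
def IndHom.comp {F : A ⥤ SuperPresheaf K U} {G : B ⥤ SuperPresheaf K U}
    {H : C ⥤ SuperPresheaf K U} (Ψ : IndHom G H) (Φ : IndHom F G) : IndHom F H where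
  app α := (Φ.app α).bind Ψ
  compat f := by rw [← HomGerm.precomp_bind, Φ.compat f]

/-- A morphism of ind-objects is even if its components are classes of even morphisms. -/
def IndHom.IsEven {F : A ⥤ SuperPresheaf K U} {G : B ⥤ SuperPresheaf K U}
    (Φ : IndHom F G) : Prop :=
  ∀ α, ∃ (β : B) (f : F.obj α ⟶ G.obj β), SuperPresheaf.IsEven f ∧ Φ.app α = HomGerm.mk G β f

/-- A morphism of ind-objects indexed by the same category is strict if it is of the form
`([Φ_α : F_α → G_α])_α`. -/
def IndHom.IsStrict {F G : A ⥤ SuperPresheaf K U} (Φ : IndHom F G) : Prop :=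
  ∃ φ : ∀ α, F.obj α ⟶ G.obj α, ∀ α, Φ.app α = HomGerm.mk G α (φ α)

/-- The map `[f] ↦ [f|_W]`. -/
def HomGerm.restrict {P : SuperPresheaf K U} {G : B ⥤ SuperPresheaf K U} (x : HomGerm P G)
    (h : W ≤ U) : HomGerm (P.restrict h) (resSys G h) :=
  Quot.lift (fun y : Σ β, (P ⟶ G.obj β) =>
      HomGerm.mk (resSys G h) y.1 ((restrictFunctor K h).map y.2))
    (by
      rintro ⟨β, f⟩ ⟨β', f'⟩ ⟨k, hk⟩
      refine Quot.sound ⟨k, ?_⟩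
      change f' = f ≫ G.map k at hk
      rw [hk, Functor.map_comp]
      rfl) x

/-- The restriction of a morphism of ind-objects to a smaller open subset. -/
def IndHom.restrict {F : A ⥤ SuperPresheaf K U} {G : B ⥤ SuperPresheaf K U}
    (Φ : IndHom F G) (h : W ≤ U) : IndHom (resSys F h) (resSys G h) where
  app α := (Φ.app α).restrict h
  compat {α α'} f := by
    rw [← Φ.compat f]
    generalize Φ.app α' = z
    induction z using Quot.ind with
    | _ z => rfl

/-- The set `colim_γ Bilin (P, Q; H_γ)`. -/
def BilinGerm (P Q : SuperPresheaf K U) (H : C ⥤ SuperPresheaf K U) : Type u :=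
  (H ⋙ bilinFunctor P Q).ColimitType

/-- The class `[b]` of a bilinear morphism `b : P × Q → H_γ`. -/
def BilinGerm.mk {P Q : SuperPresheaf K U} (H : C ⥤ SuperPresheaf K U) (γ : C)
    (b : Bilin P Q (H.obj γ)) : BilinGerm P Q H :=
  (H ⋙ bilinFunctor P Q).ιColimitType γ b

/-- The map `[b] ↦ [b ∘ (f × g)]`. -/
def BilinGerm.precomp {P P' Q Q' : SuperPresheaf K U} {H : C ⥤ SuperPresheaf K U}
    (x : BilinGerm P Q H) (f : P' ⟶ P) (g : Q' ⟶ Q) : BilinGerm P' Q' H :=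
  Quot.lift (fun y : Σ γ, Bilin P Q (H.obj γ) => BilinGerm.mk H y.1 (y.2.precomp f g))
    (by
      rintro ⟨γ, b⟩ ⟨γ', b'⟩ ⟨k, hk⟩
      refine Quot.sound ⟨k, ?_⟩
      change b' = b.postcomp (H.map k) at hk
      rw [hk]
      rfl) x

/-- The set of bilinear morphisms of ind-objects `F × G → H`,
`lim_(α, β) colim_γ Bilin (F_α, G_β; H_γ)`. -/
@[ext]
structure IndBilin (F : A ⥤ SuperPresheaf K U) (G : B ⥤ SuperPresheaf K U)
    (H : C ⥤ SuperPresheaf K U) : Type u where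
  app : ∀ α β, BilinGerm (F.obj α) (G.obj β) H
  compat : ∀ {α α' : A} {β β' : B} (f : α ⟶ α') (g : β ⟶ β'),
    (app α' β').precomp (F.map f) (G.map g) = app α β

/-- A bilinear morphism of ind-objects is even if its components are classes of even bilinear
morphisms. -/
def IndBilin.IsEven {F : A ⥤ SuperPresheaf K U} {G : B ⥤ SuperPresheaf K U}
    {H : C ⥤ SuperPresheaf K U} (b : IndBilin F G H) : Prop :=
  ∀ α β, ∃ (γ : C) (c : Bilin (F.obj α) (G.obj β) (H.obj γ)),
    c.IsEven ∧ b.app α β = BilinGerm.mk H γ c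

/-- The map `[f] ↦ [f ∘ b]` for a bilinear morphism `b`. -/
def HomGerm.compBilin {P Q R : SuperPresheaf K U} {H : C ⥤ SuperPresheaf K U} (x : HomGerm R H)
    (b : Bilin P Q R) : BilinGerm P Q H :=
  Quot.lift (fun y : Σ γ, (R ⟶ H.obj γ) => BilinGerm.mk H y.1 (b.postcomp y.2))
    (by
      rintro ⟨γ, f⟩ ⟨γ', f'⟩ ⟨k, hk⟩
      refine Quot.sound ⟨k, ?_⟩
      change f' = f ≫ H.map k at hk
      rw [hk]
      rfl) x

/-- The map `[b : P × Q → G_γ] ↦ Φ_γ ∘ b` for a morphism `Φ` of ind-objects. -/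
def BilinGerm.bind {P Q : SuperPresheaf K U} {G : B ⥤ SuperPresheaf K U}
    {H : C ⥤ SuperPresheaf K U} (x : BilinGerm P Q G) (Φ : IndHom G H) : BilinGerm P Q H :=
  Quot.lift (fun y : Σ γ, Bilin P Q (G.obj γ) => (Φ.app y.1).compBilin y.2)
    (by
      rintro ⟨γ, b⟩ ⟨γ', b'⟩ ⟨k, hk⟩
      change b' = b.postcomp (G.map k) at hk
      change (Φ.app γ).compBilin b = (Φ.app γ').compBilin b'
      rw [hk, ← Φ.compat k]
      generalize Φ.app γ' = z
      induction z using Quot.ind with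
      | _ z => rfl) x

theorem BilinGerm.precomp_bind {P P' Q Q' : SuperPresheaf K U} {G : B ⥤ SuperPresheaf K U}
    {H : C ⥤ SuperPresheaf K U} (x : BilinGerm P Q G) (f : P' ⟶ P) (g : Q' ⟶ Q)
    (Φ : IndHom G H) : (x.precomp f g).bind Φ = (x.bind Φ).precomp f g := by
  induction x using Quot.ind with
  | _ x =>
    change (Φ.app x.1).compBilin (x.2.precomp f g) = ((Φ.app x.1).compBilin x.2).precomp f g
    generalize Φ.app x.1 = z
    induction z using Quot.ind with
    | _ z => rfl

/-- The composite `Φ ∘ b` of a bilinear morphism and a morphism of ind-objects. -/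
def IndHom.compBilin {A' : Type u} [SmallCategory A'] {F : A ⥤ SuperPresheaf K U}
    {F' : A' ⥤ SuperPresheaf K U} {G : B ⥤ SuperPresheaf K U} {H : C ⥤ SuperPresheaf K U}
    (Φ : IndHom G H) (b : IndBilin F F' G) : IndBilin F F' H where
  app α α' := (b.app α α').bind Φ
  compat f g := by rw [← BilinGerm.precomp_bind, b.compat f g]

/-- The map `([f], [g]) ↦ b ∘ (f × g)` for a bilinear morphism `b` of ind-objects. -/
def IndBilin.pull {A' : Type u} [SmallCategory A'] {P Q : SuperPresheaf K U}
    {G : A ⥤ SuperPresheaf K U} {G' : A' ⥤ SuperPresheaf K U} {H : C ⥤ SuperPresheaf K U}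
    (b : IndBilin G G' H) (x : HomGerm P G) (x' : HomGerm Q G') : BilinGerm P Q H :=
  Quot.lift₂ (fun (y : Σ β, (P ⟶ G.obj β)) (y' : Σ β, (Q ⟶ G'.obj β)) =>
      (b.app y.1 y'.1).precomp y.2 y'.2)
    (by
      rintro ⟨β, f⟩ ⟨γ, g⟩ ⟨γ', g'⟩ ⟨k, hk⟩
      change g' = g ≫ G'.map k at hk
      change (b.app β γ).precomp f g = (b.app β γ').precomp f g'
      have e : b.app β γ = (b.app β γ').precomp (𝟙 (G.obj β)) (G'.map k) := by
        rw [← G.map_id, b.compat (𝟙 β) k]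
      rw [hk, e]
      generalize b.app β γ' = z
      induction z using Quot.ind with
      | _ z => rfl)
    (by
      rintro ⟨γ, g⟩ ⟨γ', g'⟩ ⟨β, f⟩ ⟨k, hk⟩
      change g' = g ≫ G.map k at hk
      change (b.app γ β).precomp g f = (b.app γ' β).precomp g' f
      have e : b.app γ β = (b.app γ' β).precomp (G.map k) (𝟙 (G'.obj β)) := by
        rw [← G'.map_id, b.compat k (𝟙 β)]
      rw [hk, e]
      generalize b.app γ' β = z
      induction z using Quot.ind with
      | _ z => rfl) x x'

theorem IndBilin.precomp_pull {A' : Type u} [SmallCategory A'] {P P' Q Q' : SuperPresheaf K U}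
    {G : A ⥤ SuperPresheaf K U} {G' : A' ⥤ SuperPresheaf K U} {H : C ⥤ SuperPresheaf K U}
    (b : IndBilin G G' H) (x : HomGerm P G) (x' : HomGerm Q G') (f : P' ⟶ P) (g : Q' ⟶ Q) :
    (b.pull x x').precomp f g = b.pull (x.precomp f) (x'.precomp g) := by
  induction x using Quot.ind with
  | _ x =>
    induction x' using Quot.ind with
    | _ x' =>
      change ((b.app x.1 x'.1).precomp x.2 x'.2).precomp f g =
        (b.app x.1 x'.1).precomp (f ≫ x.2) (g ≫ x'.2)
      generalize b.app x.1 x'.1 = z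
      induction z using Quot.ind with
      | _ z => rfl

/-- The composite `b ∘ (Φ × Ψ)` of a bilinear morphism and two morphisms of ind-objects. -/
def IndBilin.compProd {A' B' : Type u} [SmallCategory A'] [SmallCategory B']
    {F : A ⥤ SuperPresheaf K U} {F' : A' ⥤ SuperPresheaf K U} {G : B ⥤ SuperPresheaf K U}
    {G' : B' ⥤ SuperPresheaf K U} {H : C ⥤ SuperPresheaf K U}
    (b : IndBilin G G' H) (Φ : IndHom F G) (Ψ : IndHom F' G') : IndBilin F F' H where
  app α α' := b.pull (Φ.app α) (Ψ.app α')
  compat f g := by rw [IndBilin.precomp_pull, Φ.compat f, Ψ.compat g]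

/-- The map `[b] ↦ [b|_W]`. -/
def BilinGerm.restrict {P Q : SuperPresheaf K U} {H : C ⥤ SuperPresheaf K U}
    (x : BilinGerm P Q H) (h : W ≤ U) : BilinGerm (P.restrict h) (Q.restrict h) (resSys H h) :=
  Quot.lift (fun y : Σ γ, Bilin P Q (H.obj γ) => BilinGerm.mk (resSys H h) y.1 (y.2.restrict h))
    (by
      rintro ⟨γ, b⟩ ⟨γ', b'⟩ ⟨k, hk⟩
      refine Quot.sound ⟨k, ?_⟩
      change b' = b.postcomp (H.map k) at hk
      rw [hk]
      rfl) x

/-- The restriction of a bilinear morphism of ind-objects to a smaller open subset. -/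
def IndBilin.restrict {F : A ⥤ SuperPresheaf K U} {G : B ⥤ SuperPresheaf K U}
    {H : C ⥤ SuperPresheaf K U} (b : IndBilin F G H) (h : W ≤ U) :
    IndBilin (resSys F h) (resSys G h) (resSys H h) where
  app α β := (b.app α β).restrict h
  compat {α α' β β'} f g := by
    rw [← b.compat f g]
    generalize b.app α' β' = z
    induction z using Quot.ind with
    | _ z => rfl

/-! ### The inductive limit presheaf -/

/-- The sections over `V` of the inductive limit presheaf: the vector space `colim_α F_α(V)`. -/
noncomputable abbrev Lim (F : A ⥤ SuperPresheaf K U) (V : Set.Iic U) : ModuleCat.{u} K :=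
  colimit (F ⋙ sectionsAt K V)

/-- The canonical map `F_α(V) → colim_α F_α(V)`. -/
noncomputable def Lim.ι (F : A ⥤ SuperPresheaf K U) (V : Set.Iic U) (α : A) :
    (F.obj α).carrier.obj (op V) →ₗ[K] Lim F V :=
  (colimit.ι (F ⋙ sectionsAt K V) α).hom

theorem Lim.ι_map (F : A ⥤ SuperPresheaf K U) (V : Set.Iic U) {α α' : A} (f : α ⟶ α')
    (x : (F.obj α).carrier.obj (op V)) :
    Lim.ι F V α' (SuperPresheaf.onOpen (F.map f) V x) = Lim.ι F V α x :=
  ConcreteCategory.congr_hom (colimit.w (F ⋙ sectionsAt K V) f) x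

/-- The parity on `colim_α F_α(V)`: the vectors of parity `p` are the images of the vectors of
parity `p` in the `F_α(V)`. -/
noncomputable def Lim.parity (F : A ⥤ SuperPresheaf K U) (V : Set.Iic U) (p : ZMod 2) :
    Submodule K (Lim F V) :=
  ⨆ α, ((F.obj α).parity V p).map (Lim.ι F V α)

/-- A family of linear maps from the `F_α(V)` which is compatible with the inductive system induces
a linear map from the limit. -/
noncomputable def Lim.desc (F : A ⥤ SuperPresheaf K U) (V : Set.Iic U) {M : Type u}
    [AddCommGroup M] [Module K M] (φ : ∀ α, (F.obj α).carrier.obj (op V) →ₗ[K] M)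
    (hφ : ∀ (α α' : A) (f : α ⟶ α') (x : (F.obj α).carrier.obj (op V)),
      φ α' (SuperPresheaf.onOpen (F.map f) V x) = φ α x) : Lim F V →ₗ[K] M :=
  (colimit.desc (F ⋙ sectionsAt K V)
    { pt := ModuleCat.of K M
      ι :=
        { app := fun α => ModuleCat.ofHom (φ α)
          naturality := fun α α' f => by
            ext x
            exact hφ α α' f x } }).hom

theorem Lim.desc_ι (F : A ⥤ SuperPresheaf K U) (V : Set.Iic U) {M : Type u}
    [AddCommGroup M] [Module K M] (φ : ∀ α, (F.obj α).carrier.obj (op V) →ₗ[K] M)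
    (hφ : ∀ (α α' : A) (f : α ⟶ α') (x : (F.obj α).carrier.obj (op V)),
      φ α' (SuperPresheaf.onOpen (F.map f) V x) = φ α x)
    (α : A) (x : (F.obj α).carrier.obj (op V)) :
    Lim.desc F V φ hφ (Lim.ι F V α x) = φ α x :=
  ConcreteCategory.congr_hom (colimit.ι_desc (F := F ⋙ sectionsAt K V) _ α) x

theorem Lim.hom_ext {F : A ⥤ SuperPresheaf K U} {V : Set.Iic U} {M : Type u}
    [AddCommGroup M] [Module K M] {f g : Lim F V →ₗ[K] M}
    (h : ∀ α x, f (Lim.ι F V α x) = g (Lim.ι F V α x)) : f = g := by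
  have : ModuleCat.ofHom f = ModuleCat.ofHom g := by
    refine colimit.hom_ext fun α => ?_
    ext x
    exact h α x
  exact congrArg ModuleCat.Hom.hom this

/-- The map `P(V) → colim_β G_β(V)`, `x ↦ [f x]`, attached to a class `[f]`. -/
noncomputable def HomGerm.lim {P : SuperPresheaf K U} {G : B ⥤ SuperPresheaf K U}
    (x : HomGerm P G) (V : Set.Iic U) : P.carrier.obj (op V) →ₗ[K] Lim G V :=
  Quot.lift (fun y : Σ β, (P ⟶ G.obj β) => Lim.ι G V y.1 ∘ₗ SuperPresheaf.onOpen y.2 V)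
    (by
      rintro ⟨β, f⟩ ⟨β', f'⟩ ⟨k, hk⟩
      change f' = f ≫ G.map k at hk
      rw [hk]
      ext x
      exact (Lim.ι_map G V k _).symm) x

theorem HomGerm.lim_precomp {P P' : SuperPresheaf K U} {G : B ⥤ SuperPresheaf K U}
    (x : HomGerm P G) (g : P' ⟶ P) (V : Set.Iic U) :
    (x.precomp g).lim V = x.lim V ∘ₗ SuperPresheaf.onOpen g V := by
  induction x using Quot.ind with
  | _ x => rfl

/-- The linear map `colim_α F_α(V) → colim_β G_β(V)`, `[x_α] ↦ [Φ_α x_α]`, induced by a morphism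
of ind-objects. -/
noncomputable def IndHom.lim {F : A ⥤ SuperPresheaf K U} {G : B ⥤ SuperPresheaf K U}
    (Φ : IndHom F G) (V : Set.Iic U) : Lim F V →ₗ[K] Lim G V :=
  Lim.desc F V (fun α => (Φ.app α).lim V) (fun _ _ f x => by
    rw [← Φ.compat f, HomGerm.lim_precomp]
    rfl)

/-- The bilinear map `P(V) × Q(V) → colim_γ H_γ(V)`, `(x, y) ↦ [b(x, y)]`, attached to a
class `[b]`. -/
noncomputable def BilinGerm.lim {P Q : SuperPresheaf K U} {H : C ⥤ SuperPresheaf K U}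
    (x : BilinGerm P Q H) (V : Set.Iic U) :
    P.carrier.obj (op V) →ₗ[K] Q.carrier.obj (op V) →ₗ[K] Lim H V :=
  Quot.lift (fun y : Σ γ, Bilin P Q (H.obj γ) => (y.2.app V).compr₂ (Lim.ι H V y.1))
    (by
      rintro ⟨γ, b⟩ ⟨γ', b'⟩ ⟨k, hk⟩
      change b' = b.postcomp (H.map k) at hk
      rw [hk]
      ext x y
      exact (Lim.ι_map H V k _).symm) x

theorem BilinGerm.lim_precomp {P P' Q Q' : SuperPresheaf K U} {H : C ⥤ SuperPresheaf K U}
    (x : BilinGerm P Q H) (f : P' ⟶ P) (g : Q' ⟶ Q) (V : Set.Iic U)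
    (a : P'.carrier.obj (op V)) (b : Q'.carrier.obj (op V)) :
    (x.precomp f g).lim V a b =
      x.lim V (SuperPresheaf.onOpen f V a) (SuperPresheaf.onOpen g V b) := by
  induction x using Quot.ind with
  | _ x => rfl

theorem IndBilin.lim_map {F : A ⥤ SuperPresheaf K U} {G : B ⥤ SuperPresheaf K U}
    {H : C ⥤ SuperPresheaf K U} (b : IndBilin F G H) (V : Set.Iic U) {α α' : A} {β β' : B}
    (f : α ⟶ α') (g : β ⟶ β') (x : (F.obj α).carrier.obj (op V))
    (y : (G.obj β).carrier.obj (op V)) :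
    (b.app α' β').lim V (SuperPresheaf.onOpen (F.map f) V x) (SuperPresheaf.onOpen (G.map g) V y) =
      (b.app α β).lim V x y := by
  rw [← b.compat f g, BilinGerm.lim_precomp]

/-- The linear map `colim_β G_β(V) → colim_γ H_γ(V)`, `[y_β] ↦ [b_(α, β)(x, y_β)]`, for a fixed
`x ∈ F_α(V)`. -/
noncomputable def IndBilin.limLeft {F : A ⥤ SuperPresheaf K U} {G : B ⥤ SuperPresheaf K U}
    {H : C ⥤ SuperPresheaf K U} (b : IndBilin F G H) (V : Set.Iic U) (α : A)
    (x : (F.obj α).carrier.obj (op V)) : Lim G V →ₗ[K] Lim H V :=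
  Lim.desc G V (fun β => (b.app α β).lim V x) (fun β β' g y => by
    have h := b.lim_map V (𝟙 α) g x y
    rw [F.map_id] at h
    exact h)

theorem IndBilin.limLeft_ι {F : A ⥤ SuperPresheaf K U} {G : B ⥤ SuperPresheaf K U}
    {H : C ⥤ SuperPresheaf K U} (b : IndBilin F G H) (V : Set.Iic U) (α : A) (β : B)
    (x : (F.obj α).carrier.obj (op V)) (y : (G.obj β).carrier.obj (op V)) :
    b.limLeft V α x (Lim.ι G V β y) = (b.app α β).lim V x y :=
  Lim.desc_ι G V _ _ β y

/-- The bilinear map `colim_α F_α(V) × colim_β G_β(V) → colim_γ H_γ(V)`,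
`([x_α], [y_β]) ↦ [b_(α, β)(x_α, y_β)]`, induced by a bilinear morphism of ind-objects. -/
noncomputable def IndBilin.lim {F : A ⥤ SuperPresheaf K U} {G : B ⥤ SuperPresheaf K U}
    {H : C ⥤ SuperPresheaf K U} (b : IndBilin F G H) (V : Set.Iic U) :
    Lim F V →ₗ[K] Lim G V →ₗ[K] Lim H V :=
  Lim.desc F V
    (fun α =>
      { toFun := b.limLeft V α
        map_add' := fun x x' => Lim.hom_ext fun β y => by
          simp only [LinearMap.add_apply, IndBilin.limLeft_ι, map_add]
        map_smul' := fun c x => Lim.hom_ext fun β y => by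
          simp only [LinearMap.smul_apply, IndBilin.limLeft_ι, map_smul, RingHom.id_apply] })
    (fun α α' f x => Lim.hom_ext fun β y => by
      have h := b.lim_map V f (𝟙 β) x y
      rw [G.map_id] at h
      simp only [LinearMap.coe_mk, AddHom.coe_mk, IndBilin.limLeft_ι]
      exact h)

theorem IndHom.lim_ι {F : A ⥤ SuperPresheaf K U} {G : B ⥤ SuperPresheaf K U} (Φ : IndHom F G)
    (V : Set.Iic U) (α : A) (x : (F.obj α).carrier.obj (op V)) :
    Φ.lim V (Lim.ι F V α x) = (Φ.app α).lim V x :=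
  Lim.desc_ι F V _ _ α x

theorem IndBilin.lim_ι {F : A ⥤ SuperPresheaf K U} {G : B ⥤ SuperPresheaf K U}
    {H : C ⥤ SuperPresheaf K U} (b : IndBilin F G H) (V : Set.Iic U) (α : A) (β : B)
    (x : (F.obj α).carrier.obj (op V)) (y : (G.obj β).carrier.obj (op V)) :
    b.lim V (Lim.ι F V α x) (Lim.ι G V β y) = (b.app α β).lim V x y := by
  unfold IndBilin.lim
  rw [Lim.desc_ι]
  exact b.limLeft_ι V α β x y

theorem IndHom.lim_restrict {F : A ⥤ SuperPresheaf K U} {G : B ⥤ SuperPresheaf K U}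
    (Φ : IndHom F G) (h : W ≤ U) (V : Set.Iic W) :
    (Φ.restrict h).lim V = Φ.lim ((opensIncl h).obj V) := by
  refine Lim.hom_ext (F := F) (V := (opensIncl h).obj V) fun α x => ?_
  refine ((Φ.restrict h).lim_ι V α x).trans (Eq.trans ?_ (Φ.lim_ι ((opensIncl h).obj V) α x).symm)
  change ((Φ.app α).restrict h).lim V x = _
  generalize Φ.app α = z
  induction z using Quot.ind with
  | _ z => rfl

theorem IndBilin.lim_restrict {F : A ⥤ SuperPresheaf K U} {G : B ⥤ SuperPresheaf K U}
    {H : C ⥤ SuperPresheaf K U} (b : IndBilin F G H) (h : W ≤ U) (V : Set.Iic W) :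
    (b.restrict h).lim V = b.lim ((opensIncl h).obj V) := by
  refine Lim.hom_ext (F := F) (V := (opensIncl h).obj V) fun α x => ?_
  refine Lim.hom_ext (F := G) (V := (opensIncl h).obj V) fun β y => ?_
  refine ((b.restrict h).lim_ι V α β x y).trans
    (Eq.trans ?_ (b.lim_ι ((opensIncl h).obj V) α β x y).symm)
  change ((b.app α β).restrict h).lim V x y = _
  generalize b.app α β = z
  induction z using Quot.ind with
  | _ z => rfl

theorem SuperPresheaf.IsSheaf.restrict {P : SuperPresheaf K U} (hP : P.IsSheaf) (h : W ≤ U) :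
    (P.restrict h).IsSheaf := by
  intro O S hS s hs
  have hlub : IsLUB ((opensIncl h).obj '' S) ((opensIncl h).obj O) := by
    refine ⟨?_, fun Z hZ => ?_⟩
    · rintro _ ⟨V, hV, rfl⟩
      exact hS.1 hV
    · have h1 : O ≤ (⟨O.1 ⊓ Z.1,
          show O.1 ⊓ Z.1 ≤ W from (inf_le_left : O.1 ⊓ Z.1 ≤ O.1).trans O.2⟩ : Set.Iic W) :=
        hS.2 fun V hV => (le_inf (hS.1 hV) (hZ ⟨V, hV, rfl⟩) : V.1 ≤ O.1 ⊓ Z.1)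
      have h2 : O.1 ≤ O.1 ⊓ Z.1 := h1
      exact (h2.trans inf_le_right : O.1 ≤ Z.1)
  let e : ∀ V : ((opensIncl h).obj '' S : Set (Set.Iic U)),
      {V' : S // (opensIncl h).obj V'.1 = V.1} := fun V =>
    ⟨⟨⟨V.1.1, by obtain ⟨_, V', _, rfl⟩ := V; exact V'.2⟩, by
      obtain ⟨_, V', hV', rfl⟩ := V; exact hV'⟩, rfl⟩
  obtain ⟨t, ht, htu⟩ := hP ((opensIncl h).obj O) _ hlub (fun V => s (e V).1)
    (fun V V' => hs (e V).1 (e V').1)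
  refine ⟨t, fun V => ht ⟨_, V.1, V.2, rfl⟩, fun t' ht' => htu t' fun V => ht' (e V).1⟩

end Ind

/-! ### Vertex superalgebras -/

/-- `(M, 1, T, (n); n ∈ ℤ)` is a vertex superalgebra over `K`, where the super vector space
structure of `M` is given by the subspaces `par 0` and `par 1`, and where `Y n a b = a_(n) b` are
the coefficients of the vertex operators `Y(a, z) = ∑ a_(n) z^(-n-1)`.
The locality axiom says that `(z - w)^N [Y(a, z), Y(b, w)] = 0` for some `N`, the bracket being the
super commutator. -/
structure IsVertexSuperalgebra {K : Type} [Field K] {M : Type u} [AddCommGroup M] [Module K M]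
    (par : ZMod 2 → Submodule K M) (vac : M) (T : M →ₗ[K] M) (Y : ℤ → M →ₗ[K] M →ₗ[K] M) :
    Prop where
  par_isInternal : DirectSum.IsInternal par
  vac_even : vac ∈ par 0
  T_even : ∀ p, ∀ a ∈ par p, T a ∈ par p
  Y_even : ∀ n p q, ∀ a ∈ par p, ∀ b ∈ par q, Y n a b ∈ par (p + q)
  field : ∀ a b, ∃ N : ℤ, ∀ n, N ≤ n → Y n a b = 0
  vac_left : ∀ a n, Y n vac a = if n = -1 then a else 0
  vac_right_nonneg : ∀ a n, 0 ≤ n → Y n a vac = 0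
  vac_right : ∀ a, Y (-1) a vac = a
  T_vac : T vac = 0
  translation : ∀ a b n, T (Y n a b) - Y n a (T b) = -n • Y (n - 1) a b
  locality : ∀ p q, ∀ a ∈ par p, ∀ b ∈ par q, ∃ N : ℕ, ∀ (m n : ℤ) (c : M),
    ∑ k ∈ Finset.range (N + 1), ((-1) ^ k * (N.choose k : ℤ)) •
      (Y (m + N - k) a (Y (n + k) b c) -
        (if p = 1 ∧ q = 1 then (-1 : ℤ) else 1) • Y (n + k) b (Y (m + N - k) a c)) = 0

/-! ### VSA-inductive sheaves -/

section VSAIndSheaf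

variable {K : Type} [Field K] {X : Type u} [TopologicalSpace X] {U W : Opens X}
  {A : Type u} [SmallCategory A]

/-- The presheaf of constant functions, as an inductive system indexed by a set with one
element. -/
abbrev constSystem (K : Type) [Field K] {X : Type u} [TopologicalSpace X] (U : Opens X) :
    Discrete PUnit.{u + 1} ⥤ SuperPresheaf K U :=
  (Functor.const _).obj (constPresheaf K U)

/-- The constant section `1` of the limit of `constSystem K U`. -/
noncomputable def constOne (K : Type) [Field K] {X : Type u} [TopologicalSpace X] {U : Opens X}
    (V : Set.Iic U) : Lim (constSystem K U) V :=
  Lim.ι (constSystem K U) V ⟨PUnit.unit⟩ (ULift.up (1 : K) : ULift.{u} K)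

/-- A vertex superalgebra inductive sheaf over `K` on the open subset `U`, whose underlying
ind-object is indexed by the category `A`. -/
structure VSAIndSheaf (K : Type) [Field K] {X : Type u} [TopologicalSpace X]
    (A : Type u) [SmallCategory A] (U : Opens X) : Type (u + 1) where
  sys : A ⥤ SuperPresheaf K U
  isSheaf : ∀ α, (sys.obj α).IsSheaf
  map_even : ∀ {α α' : A} (f : α ⟶ α'), SuperPresheaf.IsEven (sys.map f)
  map_injective : ∀ {α α' : A} (f : α ⟶ α') (V : Set.Iic U),
    Function.Injective (SuperPresheaf.onOpen (sys.map f) V)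
  vac : IndHom (constSystem K U) sys
  vac_even : vac.IsEven
  T : IndHom sys sys
  T_even : T.IsEven
  prod : ℤ → IndBilin sys sys sys
  prod_even : ∀ n, (prod n).IsEven
  isVSA : ∀ V : Set.Iic U, IsVertexSuperalgebra (Lim.parity sys V) (vac.lim V (constOne K V))
    (T.lim V) (fun n => (prod n).lim V)

theorem HomGerm.exists_even_restrict {P : SuperPresheaf K U} {G : A ⥤ SuperPresheaf K U}
    {x : HomGerm P G} (h : W ≤ U)
    (hx : ∃ (β : A) (f : P ⟶ G.obj β), SuperPresheaf.IsEven f ∧ x = HomGerm.mk G β f) :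
    ∃ (β : A) (f : P.restrict h ⟶ (resSys G h).obj β), SuperPresheaf.IsEven f ∧
      x.restrict h = HomGerm.mk (resSys G h) β f := by
  obtain ⟨β, f, hf, rfl⟩ := hx
  exact ⟨β, (restrictFunctor K h).map f, fun V p y hy => hf ((opensIncl h).obj V) p y hy, rfl⟩

/-- The restriction of a VSA-inductive sheaf to a smaller open subset. -/
def VSAIndSheaf.restrict (𝒱 : VSAIndSheaf K A U) (h : W ≤ U) : VSAIndSheaf K A W where
  sys := resSys 𝒱.sys h
  isSheaf α := (𝒱.isSheaf α).restrict h
  map_even f V p x hx := 𝒱.map_even f ((opensIncl h).obj V) p x hx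
  map_injective f V := 𝒱.map_injective f ((opensIncl h).obj V)
  vac := 𝒱.vac.restrict h
  vac_even α := HomGerm.exists_even_restrict h (𝒱.vac_even α)
  T := 𝒱.T.restrict h
  T_even α := HomGerm.exists_even_restrict h (𝒱.T_even α)
  prod n := (𝒱.prod n).restrict h
  prod_even n α β := by
    obtain ⟨γ, c, hc, e⟩ := 𝒱.prod_even n α β
    refine ⟨γ, c.restrict h, fun V p q x y hx hy => hc ((opensIncl h).obj V) p q x y hx hy, ?_⟩
    change ((𝒱.prod n).app α β).restrict h = _
    rw [e]
    rfl
  isVSA V := by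
    have h1 := 𝒱.isVSA ((opensIncl h).obj V)
    rw [← IndHom.lim_restrict, ← IndHom.lim_restrict] at h1
    simp only [← IndBilin.lim_restrict] at h1
    exact h1

/-- `H` is a Hamiltonian on `𝒱`, and `H = ([h_α])_α`: each `h_α` is even and diagonalizable on the
sections over every open subset, and
`(n) ∘ (id × H + H × id) = (H - (-n - 1)) ∘ (n)` for all `n`.  The last equation is one between
bilinear morphisms of ind-objects; it is expressed for each pair of indices through a representative
`b` of the component of `(n)`. -/
structure IsHamiltonian (𝒱 : VSAIndSheaf K A U) (H : IndHom 𝒱.sys 𝒱.sys)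
    (h : ∀ α, 𝒱.sys.obj α ⟶ 𝒱.sys.obj α) : Prop where
  app_eq : ∀ α, H.app α = HomGerm.mk 𝒱.sys α (h α)
  even : ∀ α, SuperPresheaf.IsEven (h α)
  diagonalizable : ∀ α (V : Set.Iic U),
    ⨆ c : K, Module.End.eigenspace (SuperPresheaf.onOpen (h α) V) c = ⊤
  prod : ∀ (n : ℤ) (α α' : A), ∃ (γ : A) (b : Bilin (𝒱.sys.obj α) (𝒱.sys.obj α') (𝒱.sys.obj γ)),
    (𝒱.prod n).app α α' = BilinGerm.mk 𝒱.sys γ b ∧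
    BilinGerm.mk 𝒱.sys γ (b.precomp (𝟙 _) (h α') + b.precomp (h α) (𝟙 _)) =
      BilinGerm.mk 𝒱.sys γ (b.postcomp (h γ) + (n + 1) • b)

/-- `J` is a degree-grading operator on `𝒱`, and `J = ([j_α])_α`: each `j_α` is even and
diagonalizable on the sections over every open subset, and
`(n) ∘ (id × J + J × id) = J ∘ (n)` for all `n`. -/
structure IsDegreeOperator (𝒱 : VSAIndSheaf K A U) (J : IndHom 𝒱.sys 𝒱.sys)
    (j : ∀ α, 𝒱.sys.obj α ⟶ 𝒱.sys.obj α) : Prop where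
  app_eq : ∀ α, J.app α = HomGerm.mk 𝒱.sys α (j α)
  even : ∀ α, SuperPresheaf.IsEven (j α)
  diagonalizable : ∀ α (V : Set.Iic U),
    ⨆ c : K, Module.End.eigenspace (SuperPresheaf.onOpen (j α) V) c = ⊤
  prod : ∀ (n : ℤ) (α α' : A), ∃ (γ : A) (b : Bilin (𝒱.sys.obj α) (𝒱.sys.obj α') (𝒱.sys.obj γ)),
    (𝒱.prod n).app α α' = BilinGerm.mk 𝒱.sys γ b ∧
    BilinGerm.mk 𝒱.sys γ (b.precomp (𝟙 _) (j α') + b.precomp (j α) (𝟙 _)) =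
      BilinGerm.mk 𝒱.sys γ (b.postcomp (j γ))

/-- The sections of weight `n` and degree `l` over `V`, for the operators `h` and `j`. -/
def bigraded {P : SuperPresheaf K U} (h j : P ⟶ P) (V : Set.Iic U) (n l : ℤ) :
    Submodule K (P.carrier.obj (op V)) :=
  Module.End.eigenspace (SuperPresheaf.onOpen h V) (n : K) ⊓
    Module.End.eigenspace (SuperPresheaf.onOpen j V) (l : K)

/-- A degree-weight-graded VSA-inductive sheaf on the open subset `U`, indexed by `A`: a
VSA-inductive sheaf with a Hamiltonian `H = ([h_α])_α` and a degree-grading operator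
`J = ([j_α])_α` such that each `F_α` is the direct sum of its subsheaves of weight `n` and
degree `l`, where `n` and `l` are integers.  (The families `h`, `j` are determined by `H`, `J`.) -/
structure DegWtVSAIndSheaf (K : Type) [Field K] {X : Type u} [TopologicalSpace X]
    (A : Type u) [SmallCategory A] (U : Opens X) : Type (u + 1) extends VSAIndSheaf K A U where
  H : IndHom sys sys
  J : IndHom sys sys
  h : ∀ α, sys.obj α ⟶ sys.obj α
  j : ∀ α, sys.obj α ⟶ sys.obj α
  isHamiltonian : IsHamiltonian toVSAIndSheaf H h
  isDegreeOperator : IsDegreeOperator toVSAIndSheaf J j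
  isInternal : ∀ α (V : Set.Iic U),
    DirectSum.IsInternal (fun p : ℤ × ℤ => bigraded (h α) (j α) V p.1 p.2)

/-- The restriction of a degree-weight-graded VSA-inductive sheaf to a smaller open subset. -/
def DegWtVSAIndSheaf.restrict (𝒱 : DegWtVSAIndSheaf K A U) (hW : W ≤ U) :
    DegWtVSAIndSheaf K A W where
  toVSAIndSheaf := 𝒱.toVSAIndSheaf.restrict hW
  H := 𝒱.H.restrict hW
  J := 𝒱.J.restrict hW
  h α := (restrictFunctor K hW).map (𝒱.h α)
  j α := (restrictFunctor K hW).map (𝒱.j α)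
  isHamiltonian :=
    { app_eq := fun α => congrArg (HomGerm.restrict · hW) (𝒱.isHamiltonian.app_eq α)
      even := fun α V p x hx => 𝒱.isHamiltonian.even α ((opensIncl hW).obj V) p x hx
      diagonalizable := fun α V => 𝒱.isHamiltonian.diagonalizable α ((opensIncl hW).obj V)
      prod := fun n α α' => by
        obtain ⟨γ, b, hb, e⟩ := 𝒱.isHamiltonian.prod n α α'
        exact ⟨γ, b.restrict hW, congrArg (BilinGerm.restrict · hW) hb,
          congrArg (BilinGerm.restrict · hW) e⟩ }
  isDegreeOperator :=
    { app_eq := fun α => congrArg (HomGerm.restrict · hW) (𝒱.isDegreeOperator.app_eq α)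
      even := fun α V p x hx => 𝒱.isDegreeOperator.even α ((opensIncl hW).obj V) p x hx
      diagonalizable := fun α V => 𝒱.isDegreeOperator.diagonalizable α ((opensIncl hW).obj V)
      prod := fun n α α' => by
        obtain ⟨γ, b, hb, e⟩ := 𝒱.isDegreeOperator.prod n α α'
        exact ⟨γ, b.restrict hW, congrArg (BilinGerm.restrict · hW) hb,
          congrArg (BilinGerm.restrict · hW) e⟩ }
  isInternal α V := 𝒱.isInternal α ((opensIncl hW).obj V)

/-! ### Morphisms -/

/-- A morphism of ind-objects is compatible with the structure maps `1`, `T`, `(n)`. -/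
structure PreservesVSA (𝒱 𝒱' : VSAIndSheaf K A U) (Φ : IndHom 𝒱.sys 𝒱'.sys) : Prop where
  vac : Φ.comp 𝒱.vac = 𝒱'.vac
  T : Φ.comp 𝒱.T = 𝒱'.T.comp Φ
  prod : ∀ n, Φ.compBilin (𝒱.prod n) = (𝒱'.prod n).compProd Φ Φ

/-- A (base-preserving) morphism of VSA-inductive sheaves: an even morphism of ind-objects
compatible with `1`, `T`, `(n)`. -/
structure IsVSAMorphism (𝒱 𝒱' : VSAIndSheaf K A U) (Φ : IndHom 𝒱.sys 𝒱'.sys) : Prop extends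
    PreservesVSA 𝒱 𝒱' Φ where
  even : Φ.IsEven

/-- A morphism of ind-objects commutes with the Hamiltonians and the degree-grading operators. -/
structure PreservesGrading (𝒱 𝒱' : DegWtVSAIndSheaf K A U) (Φ : IndHom 𝒱.sys 𝒱'.sys) :
    Prop where
  comm_H : Φ.comp 𝒱.H = 𝒱'.H.comp Φ
  comm_J : Φ.comp 𝒱.J = 𝒱'.J.comp Φ

/-- A strict morphism of degree-weight-graded VSA-inductive sheaves. -/
structure IsStrictMorphism (𝒱 𝒱' : DegWtVSAIndSheaf K A U) (Φ : IndHom 𝒱.sys 𝒱'.sys) :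
    Prop where
  isVSAMorphism : IsVSAMorphism 𝒱.toVSAIndSheaf 𝒱'.toVSAIndSheaf Φ
  preservesGrading : PreservesGrading 𝒱 𝒱' Φ
  isStrict : Φ.IsStrict

/-- A strict isomorphism of degree-weight-graded VSA-inductive sheaves, with its inverse. -/
structure StrictIso (𝒱 𝒱' : DegWtVSAIndSheaf K A U) : Type u where
  hom : IndHom 𝒱.sys 𝒱'.sys
  inv : IndHom 𝒱'.sys 𝒱.sys
  hom_isStrictMorphism : IsStrictMorphism 𝒱 𝒱' hom
  inv_isStrictMorphism : IsStrictMorphism 𝒱' 𝒱 inv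
  inv_comp_hom : inv.comp hom = IndHom.id 𝒱.sys
  hom_comp_inv : hom.comp inv = IndHom.id 𝒱'.sys

/-- The restriction to `W'` of a morphism between the restrictions to `W` of ind-objects on
`U` and `U'`, regarded as a morphism between their restrictions to `W'`. -/
def IndHom.restrictTo {U U' W W' : Opens X} {F : A ⥤ SuperPresheaf K U}
    {G : A ⥤ SuperPresheaf K U'} {hU : W ≤ U} {hU' : W ≤ U'}
    (Φ : IndHom (resSys F hU) (resSys G hU')) (h : W' ≤ W) :
    IndHom (resSys F (h.trans hU)) (resSys G (h.trans hU')) :=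
  Φ.restrict h

/-! ### Gluing -/

/-- A family of degree-weight-graded VSA-inductive sheaves on the members of a family of open
subsets, with strict isomorphisms `θ i k : 𝒱_k → 𝒱_i` on `U_i ∩ U_k` satisfying the cocycle
condition. -/
structure GluingDatum (K : Type) [Field K] {X : Type u} [TopologicalSpace X]
    (A : Type u) [SmallCategory A] {Λ : Type u} (U : Λ → Opens X) : Type (u + 1) where
  𝒱 : ∀ i, DegWtVSAIndSheaf K A (U i)
  θ : ∀ i k, StrictIso ((𝒱 k).restrict (inf_le_right : U i ⊓ U k ≤ U k))
    ((𝒱 i).restrict (inf_le_left : U i ⊓ U k ≤ U i))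
  θ_self : ∀ i, (θ i i).hom = IndHom.id _
  θ_comp : ∀ i k m,
    (((θ i k).hom.restrictTo (F := (𝒱 k).sys) (G := (𝒱 i).sys)
        (inf_le_left : U i ⊓ U k ⊓ U m ≤ U i ⊓ U k)).comp
      ((θ k m).hom.restrictTo (F := (𝒱 m).sys) (G := (𝒱 k).sys)
        (le_inf (inf_le_left.trans inf_le_right) inf_le_right : U i ⊓ U k ⊓ U m ≤ U k ⊓ U m))) =
      (θ i m).hom.restrictTo (F := (𝒱 m).sys) (G := (𝒱 i).sys)
        (le_inf (inf_le_left.trans inf_le_left) inf_le_right : U i ⊓ U k ⊓ U m ≤ U i ⊓ U m)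

variable {Λ : Type u} {U : Λ → Opens X}

/-- The structure maps of the members of the family are uniformly indexed: `1`, `T` and the `(n)`
have representatives with target indices that do not depend on the member; and the gradings are
uniformly bounded: `F_α = ⨁_{N ≤ n ≤ Nw α} ⨁_{|l| ≤ L α} F_α^l[n]` for every member. -/
structure GluingDatum.IsUniform (D : GluingDatum K A U) : Prop where
  vac : ∃ (α₀ : A) (v : ∀ i, constPresheaf K (U i) ⟶ (D.𝒱 i).sys.obj α₀),
    ∀ i, (D.𝒱 i).vac.app ⟨PUnit.unit⟩ = HomGerm.mk (D.𝒱 i).sys α₀ (v i)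
  T : ∃ (jT : A → A) (t : ∀ i α, (D.𝒱 i).sys.obj α ⟶ (D.𝒱 i).sys.obj (jT α)),
    ∀ i α, (D.𝒱 i).T.app α = HomGerm.mk (D.𝒱 i).sys (jT α) (t i α)
  prod : ∀ n : ℤ, ∃ (jn : A → A → A)
    (b : ∀ i α α', Bilin ((D.𝒱 i).sys.obj α) ((D.𝒱 i).sys.obj α')
      ((D.𝒱 i).sys.obj (jn α α'))),
    ∀ i α α', ((D.𝒱 i).prod n).app α α' = BilinGerm.mk (D.𝒱 i).sys (jn α α') (b i α α')
  bounded : ∃ (N : ℤ) (Nw L : A → ℕ), ∀ i α (V : Set.Iic (U i)),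
    DirectSum.IsInternal (fun p : {p : ℤ × ℤ // N ≤ p.1 ∧ p.1 ≤ Nw α ∧ |p.2| ≤ L α} =>
      bigraded ((D.𝒱 i).h α) ((D.𝒱 i).j α) V p.1.1 p.1.2)

/-- A glued object: a degree-weight-graded VSA-inductive sheaf `𝒱` on `X` with strict isomorphisms
`Φ_i : 𝒱|_{U_i} → 𝒱_i` such that `Φ_i ∘ Φ_k⁻¹ = θ_ik` on `U_i ∩ U_k`. -/
structure Gluing (D : GluingDatum K A U) : Type (u + 1) where
  𝒱 : DegWtVSAIndSheaf K A (⊤ : Opens X)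
  Φ : ∀ i, StrictIso (𝒱.restrict (le_top : U i ≤ ⊤)) (D.𝒱 i)
  Φ_comp : ∀ i k,
    ((Φ i).hom.restrict (inf_le_left : U i ⊓ U k ≤ U i)).comp
      ((Φ k).inv.restrict (inf_le_right : U i ⊓ U k ≤ U k)) = (D.θ i k).hom

/-- A family of morphisms of ind-objects `G_i : 𝒱_i → 𝒱'_i` is compatible with the isomorphisms
`θ`, `θ'`: `θ'_ik ∘ G_k = G_i ∘ θ_ik` on `U_i ∩ U_k`. -/
def GluingDatum.Compatible (D D' : GluingDatum K A U)
    (G : ∀ i, IndHom (D.𝒱 i).sys (D'.𝒱 i).sys) : Prop :=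
  ∀ i k, (D'.θ i k).hom.comp ((G k).restrict (inf_le_right : U i ⊓ U k ≤ U k)) =
    ((G i).restrict (inf_le_left : U i ⊓ U k ≤ U i)).comp (D.θ i k).hom

/-- A morphism of ind-objects between glued objects restricts to the `G_i`:
`Φ'_i ∘ F|_{U_i} = G_i ∘ Φ_i` for all `i`. -/
def Gluing.Restricts {D D' : GluingDatum K A U} (E : Gluing D) (E' : Gluing D')
    (F : IndHom E.𝒱.sys E'.𝒱.sys) (G : ∀ i, IndHom (D.𝒱 i).sys (D'.𝒱 i).sys) : Prop :=
  ∀ i, (E'.Φ i).hom.comp (F.restrict (le_top : U i ≤ ⊤)) = (G i).comp (E.Φ i).hom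

end VSAIndSheaf

end VSAInd

/-!
VSA-inductive sheaves are glued one index at a time.  Transition maps are injective, so sections and
representatives of morphisms are determined by their images in the inductive limits
(`Lim.ι_injective`, `HomGerm.ext_lim`, `IndHom.ext_lim`).  Hence the strict isomorphisms `θ` have
unique index-preserving representatives, these satisfy the cocycle condition, and for each `α` the
sheaves with index `α` glue to a sheaf of compatible families of sections (`SheafDatum.glued`).  The
vacuum, the translation operator, the products and the grading operators have representatives whose
target index does not depend on the chart; by the same uniqueness these representatives agree on the
overlaps and glue as well (`GluingDatum.gluedVac`, `gluedHom`, `gluedProd`).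

The components `GluingDatum.evalLim` of an element of the inductive limit are jointly injective, so
identities are inherited from the local sheaves.  The existential axioms are not, since a section
may have infinitely many components, and here uniformity enters a second time.

* In the field axiom: `a_(n) b` has weight `p + q - n - 1` if `a` and `b` have weights `p` and `q`,
  so the weight bounds give a bound for the poles which does not depend on the chart
  (`DegWtVSAIndSheaf.prod_lim_eq_zero`).
* In locality: the exponent for `a` and `b` can be taken to be the order of the pole of `Y(a, z) b`,
  in any vertex superalgebra (`IsVertexSuperalgebra.locality_of_forall_eq_zero`).  So the bound for
  the poles is enough for the axioms to pass to a jointly injective family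
  (`IsVertexSuperalgebra.of_jointly_injective`).
* In the grading: the homogeneous components of a section glue, and the bounds make all but finitely
  many of them zero (`SheafDatum.bigraded_isInternal`).

For morphisms, the composites `(Φ' i)⁻¹ ∘ G i ∘ Φ i` have representatives with the common target
index `j α`.  They agree on the overlaps and glue by the sheaf property
(`SuperPresheaf.IsSheaf.exists_hom`, `Gluing.exists_restricts`).  Uniqueness and the inheritance of
all properties follow from the joint injectivity of the maps `Gluing.ev` to the local sheaves.  The
strict isomorphism between two glued objects arises by gluing identities
(`Gluing.exists_strictIso`).
-/

namespace VSAInd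

/-! ### Internal direct sums -/

section Internal

variable {K : Type*} [Field K] {ι : Type*} [DecidableEq ι] {M M' : Type*} [AddCommGroup M]
  [Module K M] [AddCommGroup M'] [Module K M'] {S : ι → Submodule K M} {S' : ι → Submodule K M'}

/-- The projection onto a summand of an internal direct sum. -/
noncomputable def internalProj (hS : DirectSum.IsInternal S) (p : ι) : M →ₗ[K] M :=
  (S p).subtype ∘ₗ DirectSum.component K ι (fun p => S p) p ∘ₗ
    (LinearEquiv.ofBijective (DirectSum.coeLinearMap S) hS).symm.toLinearMap

theorem internalProj_mem (hS : DirectSum.IsInternal S) (p : ι) (x : M) :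
    internalProj hS p x ∈ S p :=
  Submodule.coe_mem _

theorem internalProj_of_mem (hS : DirectSum.IsInternal S) {p : ι} {x : M} (hx : x ∈ S p) :
    internalProj hS p x = x :=
  congrArg Subtype.val (hS.ofBijective_coeLinearMap_of_mem hx)

theorem internalProj_of_mem_ne (hS : DirectSum.IsInternal S) {p q : ι} (hpq : p ≠ q) {x : M}
    (hx : x ∈ S p) : internalProj hS q x = 0 :=
  congrArg Subtype.val (hS.ofBijective_coeLinearMap_of_mem_ne hpq hx)

theorem internalProj_map (hS : DirectSum.IsInternal S) (hS' : DirectSum.IsInternal S')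
    (f : M →ₗ[K] M') (hf : ∀ p, ∀ x ∈ S p, f x ∈ S' p) (p : ι) (x : M) :
    internalProj hS' p (f x) = f (internalProj hS p x) := by
  have hx : x ∈ ⨆ q, S q := hS.submodule_iSup_eq_top ▸ Submodule.mem_top
  induction hx using Submodule.iSup_induction' with
  | mem q x hx =>
    rcases eq_or_ne q p with rfl | h
    · rw [internalProj_of_mem hS hx, internalProj_of_mem hS' (hf q x hx)]
    · rw [internalProj_of_mem_ne hS h hx, internalProj_of_mem_ne hS' h (hf q x hx), map_zero]
  | zero => simp only [map_zero]
  | add x y _ _ hx hy => simp only [map_add, hx, hy]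

theorem internalProj_ext (hS : DirectSum.IsInternal S) {x y : M}
    (h : ∀ p, internalProj hS p x = internalProj hS p y) : x = y := by
  refine (LinearEquiv.ofBijective (DirectSum.coeLinearMap S) hS).symm.injective ?_
  exact DFinsupp.ext fun p => Subtype.ext (h p)

theorem internalProj_sum (hS : DirectSum.IsInternal S) {s : Finset ι} {x : M}
    (h : ∀ p ∉ s, internalProj hS p x = 0) : ∑ p ∈ s, internalProj hS p x = x := by
  refine internalProj_ext hS fun q => ?_
  rw [map_sum]
  by_cases hq : q ∈ s
  · rw [Finset.sum_eq_single_of_mem q hq fun p _ hp =>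
      internalProj_of_mem_ne hS hp (internalProj_mem hS p x)]
    exact internalProj_of_mem hS (internalProj_mem hS q x)
  · rw [h q hq]
    exact Finset.sum_eq_zero fun p hp => internalProj_of_mem_ne hS
      (ne_of_mem_of_not_mem hp hq) (internalProj_mem hS p x)

theorem mem_of_internalProj_eq_zero (hS : DirectSum.IsInternal S) {p : ι} {x : M}
    (h : ∀ q ≠ p, internalProj hS q x = 0) : x ∈ S p := by
  rw [← internalProj_sum hS (s := {p}) (x := x) fun q hq => h q (by simpa using hq),
    Finset.sum_singleton]
  exact internalProj_mem hS p x

/-- An injective map of graded vector spaces which preserves the grading also reflects it. -/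
theorem mem_of_isInternal_of_injective (hS : DirectSum.IsInternal S)
    (hS' : DirectSum.IsInternal S') {f : M →ₗ[K] M'} (hf : Function.Injective f)
    (hmem : ∀ p, ∀ x ∈ S p, f x ∈ S' p) {p : ι} {x : M} (hx : f x ∈ S' p) : x ∈ S p := by
  refine mem_of_internalProj_eq_zero hS fun q hq => hf ?_
  rw [← internalProj_map hS hS' f hmem, internalProj_of_mem_ne hS' hq.symm hx, map_zero]

variable {I : Type*} {N : I → Type*} [∀ i, AddCommGroup (N i)] [∀ i, Module K (N i)]
  {R : ∀ i, ι → Submodule K (N i)} {r : ∀ i, M →ₗ[K] N i}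

/-- Subspaces which a jointly injective family of maps sends into the summands of internal direct
sums are independent. -/
theorem iSupIndep_of_jointly_injective (hR : ∀ i, DirectSum.IsInternal (R i))
    (hr : ∀ x, (∀ i, r i x = 0) → x = 0) (hmem : ∀ i p, ∀ x ∈ S p, r i x ∈ R i p) :
    iSupIndep S := by
  rw [iSupIndep_def]
  refine fun p => Submodule.disjoint_def.2 fun x hx hx' => hr x fun i => ?_
  have h : ∀ y ∈ ⨆ q, ⨆ (_ : q ≠ p), S q, internalProj (hR i) p (r i y) = 0 := by
    intro y hy
    have : ⨆ q, ⨆ (_ : q ≠ p), S q ≤ LinearMap.ker (internalProj (hR i) p ∘ₗ r i) :=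
      iSup₂_le fun q hq y hy => internalProj_of_mem_ne (hR i) hq (hmem i q y hy)
    exact this hy
  rw [← internalProj_of_mem (hR i) (hmem i p x hx), h x hx']

/-- A grading can be checked through a jointly injective family of maps `r i` to graded spaces, as
soon as the homogeneous components of the images of a vector come from vectors and all but finitely
many of them vanish. -/
theorem isInternal_of_jointly_injective (hR : ∀ i, DirectSum.IsInternal (R i))
    (hr : ∀ x, (∀ i, r i x = 0) → x = 0) (hS : ∀ p x, x ∈ S p ↔ ∀ i, r i x ∈ R i p)
    (hlift : ∀ p x, ∃ y, ∀ i, r i y = internalProj (hR i) p (r i x))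
    (hfin : ∀ x, ∃ s : Finset ι, ∀ i, ∀ p ∉ s, internalProj (hR i) p (r i x) = 0) :
    DirectSum.IsInternal S := by
  refine DirectSum.isInternal_submodule_of_iSupIndep_of_iSup_eq_top
    (iSupIndep_of_jointly_injective hR hr fun i p x hx => (hS p x).1 hx i) ?_
  refine (Submodule.eq_top_iff').2 fun x => ?_
  choose e he using hlift
  obtain ⟨s, hs⟩ := hfin x
  have hx : x = ∑ p ∈ s, e p x := by
    refine sub_eq_zero.1 (hr _ fun i => ?_)
    rw [map_sub, map_sum, Finset.sum_congr rfl fun p _ => he p x i,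
      internalProj_sum (hR i) (hs i), sub_self]
  rw [hx]
  refine Submodule.sum_mem _ fun p _ => Submodule.mem_iSup_of_mem p ((hS p _).2 fun i => ?_)
  rw [he]
  exact internalProj_mem _ _ _

/-- If a smaller family of the summands still spans, then the components in the other summands
vanish. -/
theorem internalProj_eq_zero_of_not (hS : DirectSum.IsInternal S) {c : ι → Prop}
    (h : ⨆ p : {p // c p}, S p.1 = ⊤) {p : ι} (hp : ¬ c p) (x : M) :
    internalProj hS p x = 0 := by
  have : ⨆ q : {q // c q}, S q.1 ≤ LinearMap.ker (internalProj hS p) :=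
    iSup_le fun q y hy => internalProj_of_mem_ne hS (fun e : q.1 = p => hp (e ▸ q.2)) hy
  exact this (h ▸ Submodule.mem_top)

end Internal

/-! ### Presheaves of super vector spaces and their morphisms -/

section Basic

variable {K : Type} [Field K] {X : Type u} [TopologicalSpace X] {U W : Opens X}
  {A B C : Type u} [SmallCategory A] [SmallCategory B] [SmallCategory C]

theorem SuperPresheaf.hom_ext {P Q : SuperPresheaf K U} {f g : P ⟶ Q}
    (h : ∀ V x, onOpen f V x = onOpen g V x) : f = g := by
  refine NatTrans.ext (funext fun V => ?_)
  ext x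
  exact h V.unop x

theorem SuperPresheaf.onOpen_res {P Q : SuperPresheaf K U} (f : P ⟶ Q) {V W : Set.Iic U}
    (h : V ≤ W) (x : P.carrier.obj (op W)) :
    onOpen f V (P.res h x) = Q.res h (onOpen f W x) :=
  NatTrans.naturality_apply (F := P.carrier) (G := Q.carrier) f (homOfLE h).op x

theorem SuperPresheaf.res_res (P : SuperPresheaf K U) {V V' W : Set.Iic U} (h : V ≤ V')
    (h' : V' ≤ W) (x : P.carrier.obj (op W)) :
    P.res h (P.res h' x) = P.res (h.trans h') x := by
  have : P.carrier.map (homOfLE (h.trans h')).op =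
      P.carrier.map (homOfLE h').op ≫ P.carrier.map (homOfLE h).op := by
    rw [← P.carrier.map_comp]; rfl
  exact (ConcreteCategory.congr_hom this x).symm

theorem SuperPresheaf.res_self (P : SuperPresheaf K U) {V : Set.Iic U} (h : V ≤ V)
    (x : P.carrier.obj (op V)) : P.res h x = x :=
  ConcreteCategory.congr_hom (P.carrier.map_id (op V)) x

theorem SuperPresheaf.res_mem (P : SuperPresheaf K U) {V W : Set.Iic U} (h : V ≤ W) {p : ZMod 2}
    {x : P.carrier.obj (op W)} (hx : x ∈ P.parity W p) : P.res h x ∈ P.parity V p :=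
  P.map_mem (homOfLE h) p x hx

/-- A morphism of presheaves from a family of linear maps commuting with the restrictions. -/
def SuperPresheaf.mkHom {P Q : SuperPresheaf K U}
    (f : ∀ V : Set.Iic U, P.carrier.obj (op V) →ₗ[K] Q.carrier.obj (op V))
    (hf : ∀ {V W : Set.Iic U} (h : V ≤ W) (x : P.carrier.obj (op W)),
      f V (P.res h x) = Q.res h (f W x)) : P ⟶ Q :=
  show P.carrier ⟶ Q.carrier from
  { app := fun V => ModuleCat.ofHom (f V.unop)
    naturality := fun V W k => by
      ext x
      exact hf k.unop.le x }

/-! ### The inductive limit of a system with injective transition maps -/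

/-- All transition maps of the inductive system are injective on sections. -/
def InjectiveSystem (F : A ⥤ SuperPresheaf K U) : Prop :=
  ∀ ⦃α α' : A⦄ (f : α ⟶ α') (V : Set.Iic U),
    Function.Injective (SuperPresheaf.onOpen (F.map f) V)

theorem InjectiveSystem.restrict {F : A ⥤ SuperPresheaf K U} (hF : InjectiveSystem F)
    (h : W ≤ U) : InjectiveSystem (resSys F h) :=
  fun _ _ f V => hF f ((opensIncl h).obj V)

instance forget_preservesFilteredColimits :
    PreservesFilteredColimits (forget (ModuleCat.{u} K)) :=
  Limits.comp_preservesFilteredColimits (forget₂ (ModuleCat.{u} K) AddCommGrpCat.{u})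
    (forget AddCommGrpCat.{u})

theorem Lim.exists_rep [IsFiltered A] (F : A ⥤ SuperPresheaf K U) (V : Set.Iic U)
    (x : Lim F V) : ∃ α s, Lim.ι F V α s = x :=
  Concrete.colimit_exists_rep (F ⋙ sectionsAt K V) x

/-- With injective transition maps, two sections become equal in the inductive limit only if they
are equal.  All comparisons of representatives rest on this. -/
theorem Lim.ι_injective [IsFiltered A] {F : A ⥤ SuperPresheaf K U} (hF : InjectiveSystem F)
    (V : Set.Iic U) (α : A) : Function.Injective (Lim.ι F V α) := by
  intro s t hst
  obtain ⟨γ, f, g, hfg⟩ := Concrete.colimit_exists_of_rep_eq (F ⋙ sectionsAt K V) s t hst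
  have e : SuperPresheaf.onOpen (F.map f) V s = SuperPresheaf.onOpen (F.map g) V t := hfg
  apply hF (f ≫ IsFiltered.coeqHom f g) V
  have h1 : SuperPresheaf.onOpen (F.map (f ≫ IsFiltered.coeqHom f g)) V s =
      SuperPresheaf.onOpen (F.map (IsFiltered.coeqHom f g)) V
        (SuperPresheaf.onOpen (F.map f) V s) := by rw [F.map_comp]; rfl
  have h2 : SuperPresheaf.onOpen (F.map (g ≫ IsFiltered.coeqHom f g)) V t =
      SuperPresheaf.onOpen (F.map (IsFiltered.coeqHom f g)) V
        (SuperPresheaf.onOpen (F.map g) V t) := by rw [F.map_comp]; rfl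
  rw [h1, e, ← h2, IsFiltered.coeq_condition]

theorem Lim.ι_mem_parity (F : A ⥤ SuperPresheaf K U) (V : Set.Iic U) {α : A} {p : ZMod 2}
    {s : (F.obj α).carrier.obj (op V)} (hs : s ∈ (F.obj α).parity V p) :
    Lim.ι F V α s ∈ Lim.parity F V p :=
  (le_iSup (fun α => ((F.obj α).parity V p).map (Lim.ι F V α)) α)
    (Submodule.mem_map_of_mem hs)

/-- The restriction maps of the inductive limit presheaf. -/
noncomputable def Lim.res (F : A ⥤ SuperPresheaf K U) {V W : Set.Iic U} (h : V ≤ W) :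
    Lim F W →ₗ[K] Lim F V :=
  Lim.desc F W (fun α => Lim.ι F V α ∘ₗ (F.obj α).res h) (fun α α' f x => by
    simp only [LinearMap.comp_apply, ← SuperPresheaf.onOpen_res, Lim.ι_map])

theorem Lim.res_ι (F : A ⥤ SuperPresheaf K U) {V W : Set.Iic U} (h : V ≤ W) (α : A)
    (x : (F.obj α).carrier.obj (op W)) :
    Lim.res F h (Lim.ι F W α x) = Lim.ι F V α ((F.obj α).res h x) :=
  Lim.desc_ι F W _ _ α x

theorem HomGerm.ind {P : SuperPresheaf K U} {G : B ⥤ SuperPresheaf K U}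
    {p : HomGerm P G → Prop} (h : ∀ β f, p (HomGerm.mk G β f)) (x : HomGerm P G) : p x :=
  Quot.ind (fun y => h y.1 y.2) x

theorem BilinGerm.ind {P Q : SuperPresheaf K U} {G : B ⥤ SuperPresheaf K U}
    {p : BilinGerm P Q G → Prop} (h : ∀ β b, p (BilinGerm.mk G β b)) (x : BilinGerm P Q G) :
    p x :=
  Quot.ind (fun y => h y.1 y.2) x

theorem HomGerm.lim_mk {P : SuperPresheaf K U} {G : B ⥤ SuperPresheaf K U} (β : B)
    (f : P ⟶ G.obj β) (V : Set.Iic U) (x : P.carrier.obj (op V)) :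
    (HomGerm.mk G β f).lim V x = Lim.ι G V β (SuperPresheaf.onOpen f V x) := rfl

theorem BilinGerm.lim_mk {P Q : SuperPresheaf K U} {G : B ⥤ SuperPresheaf K U} (β : B)
    (b : Bilin P Q (G.obj β)) (V : Set.Iic U) (x : P.carrier.obj (op V))
    (y : Q.carrier.obj (op V)) :
    (BilinGerm.mk G β b).lim V x y = Lim.ι G V β (b.app V x y) := rfl

theorem HomGerm.mk_map {P : SuperPresheaf K U} (G : B ⥤ SuperPresheaf K U) {β β' : B}
    (k : β ⟶ β') (f : P ⟶ G.obj β) : HomGerm.mk G β' (f ≫ G.map k) = HomGerm.mk G β f :=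
  (Quot.sound ⟨k, rfl⟩ : HomGerm.mk G β f = _).symm

theorem BilinGerm.mk_map {P Q : SuperPresheaf K U} (G : B ⥤ SuperPresheaf K U) {β β' : B}
    (k : β ⟶ β') (b : Bilin P Q (G.obj β)) :
    BilinGerm.mk G β' (b.postcomp (G.map k)) = BilinGerm.mk G β b :=
  (Quot.sound ⟨k, rfl⟩ : BilinGerm.mk G β b = _).symm

/-- When the transition maps are injective, a class of morphisms into the members of the system is
determined by the induced maps into the inductive limit. -/
theorem HomGerm.ext_lim [IsFiltered B] {P : SuperPresheaf K U} {G : B ⥤ SuperPresheaf K U}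
    (hG : InjectiveSystem G) {x y : HomGerm P G} (h : ∀ V s, x.lim V s = y.lim V s) :
    x = y := by
  induction x using HomGerm.ind with | _ β f
  induction y using HomGerm.ind with | _ β' f'
  rw [← HomGerm.mk_map G (IsFiltered.leftToMax β β') f,
    ← HomGerm.mk_map G (IsFiltered.rightToMax β β') f'] at h ⊢
  congr 1
  exact SuperPresheaf.hom_ext fun V s => Lim.ι_injective hG V _ (h V s)

theorem BilinGerm.ext_lim [IsFiltered B] {P Q : SuperPresheaf K U} {G : B ⥤ SuperPresheaf K U}
    (hG : InjectiveSystem G) {x y : BilinGerm P Q G}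
    (h : ∀ V s t, x.lim V s t = y.lim V s t) : x = y := by
  induction x using BilinGerm.ind with | _ β b
  induction y using BilinGerm.ind with | _ β' b'
  rw [← BilinGerm.mk_map G (IsFiltered.leftToMax β β') b,
    ← BilinGerm.mk_map G (IsFiltered.rightToMax β β') b'] at h ⊢
  congr 1
  refine Bilin.ext (funext fun V => ?_)
  exact LinearMap.ext₂ fun s t => Lim.ι_injective hG V _ (h V s t)

/-- When the transition maps of the target are injective, a morphism of ind-objects is determined by
the induced maps of inductive limits. -/
theorem IndHom.ext_lim [IsFiltered B] {F : A ⥤ SuperPresheaf K U} {G : B ⥤ SuperPresheaf K U}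
    (hG : InjectiveSystem G) {Φ Ψ : IndHom F G} (h : ∀ V x, Φ.lim V x = Ψ.lim V x) : Φ = Ψ := by
  refine IndHom.ext (funext fun α => HomGerm.ext_lim hG fun V s => ?_)
  rw [← IndHom.lim_ι, ← IndHom.lim_ι, h]

theorem IndBilin.ext_lim [IsFiltered C] {F : A ⥤ SuperPresheaf K U} {G : B ⥤ SuperPresheaf K U}
    {H : C ⥤ SuperPresheaf K U} (hH : InjectiveSystem H) {b c : IndBilin F G H}
    (h : ∀ V x y, b.lim V x y = c.lim V x y) : b = c := by
  refine IndBilin.ext (funext fun α => funext fun β => BilinGerm.ext_lim hH fun V s t => ?_)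
  rw [← IndBilin.lim_ι, ← IndBilin.lim_ι, h]

/-! ### Maps induced on inductive limits -/

theorem IndHom.lim_ι_of_eq {F : A ⥤ SuperPresheaf K U} {G : B ⥤ SuperPresheaf K U}
    {Φ : IndHom F G} {α : A} {β : B} {f : F.obj α ⟶ G.obj β} (h : Φ.app α = HomGerm.mk G β f)
    (V : Set.Iic U) (x : (F.obj α).carrier.obj (op V)) :
    Φ.lim V (Lim.ι F V α x) = Lim.ι G V β (SuperPresheaf.onOpen f V x) := by
  rw [IndHom.lim_ι, h, HomGerm.lim_mk]

theorem IndBilin.lim_ι_of_eq {F : A ⥤ SuperPresheaf K U} {G : B ⥤ SuperPresheaf K U}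
    {H : C ⥤ SuperPresheaf K U} {b : IndBilin F G H} {α : A} {β : B} {γ : C}
    {c : Bilin (F.obj α) (G.obj β) (H.obj γ)} (h : b.app α β = BilinGerm.mk H γ c)
    (V : Set.Iic U) (x : (F.obj α).carrier.obj (op V)) (y : (G.obj β).carrier.obj (op V)) :
    b.lim V (Lim.ι F V α x) (Lim.ι G V β y) = Lim.ι H V γ (c.app V x y) := by
  rw [IndBilin.lim_ι, h, BilinGerm.lim_mk]

/-- A family of classes of morphisms whose induced maps into the inductive limit are compatible is
a morphism of ind-objects. -/
def IndHom.ofLim [IsFiltered B] {F : A ⥤ SuperPresheaf K U} {G : B ⥤ SuperPresheaf K U}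
    (hG : InjectiveSystem G) (app : ∀ α, HomGerm (F.obj α) G)
    (h : ∀ {α α' : A} (f : α ⟶ α') V s,
      (app α').lim V (SuperPresheaf.onOpen (F.map f) V s) = (app α).lim V s) : IndHom F G where
  app := app
  compat f := HomGerm.ext_lim hG fun V s => by
    rw [HomGerm.lim_precomp, LinearMap.comp_apply, h]

/-- The analogue of `IndHom.ofLim` for bilinear morphisms. -/
def IndBilin.ofLim [IsFiltered C] {F : A ⥤ SuperPresheaf K U} {G : B ⥤ SuperPresheaf K U}
    {H : C ⥤ SuperPresheaf K U} (hH : InjectiveSystem H)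
    (app : ∀ α β, BilinGerm (F.obj α) (G.obj β) H)
    (h : ∀ {α α' : A} {β β' : B} (f : α ⟶ α') (g : β ⟶ β') V s t,
      (app α' β').lim V (SuperPresheaf.onOpen (F.map f) V s)
        (SuperPresheaf.onOpen (G.map g) V t) = (app α β).lim V s t) : IndBilin F G H where
  app := app
  compat f g := BilinGerm.ext_lim hH fun V s t => by rw [BilinGerm.lim_precomp, h]

theorem IndHom.lim_id (F : A ⥤ SuperPresheaf K U) (V : Set.Iic U) (x : Lim F V) :
    (IndHom.id F).lim V x = x := by
  have : (IndHom.id F).lim V = LinearMap.id := Lim.hom_ext fun α s => by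
    rw [IndHom.lim_ι_of_eq (rfl : (IndHom.id F).app α = HomGerm.mk F α (𝟙 (F.obj α)))]
    rfl
  rw [this]; rfl

theorem HomGerm.lim_bind {P : SuperPresheaf K U} {G : B ⥤ SuperPresheaf K U}
    {H : C ⥤ SuperPresheaf K U} (x : HomGerm P G) (Φ : IndHom G H) (V : Set.Iic U)
    (s : P.carrier.obj (op V)) : (x.bind Φ).lim V s = Φ.lim V (x.lim V s) := by
  induction x using HomGerm.ind with | _ β f
  rw [HomGerm.lim_mk, IndHom.lim_ι]
  change ((Φ.app β).precomp f).lim V s = _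
  rw [HomGerm.lim_precomp]
  rfl

theorem IndHom.lim_comp {F : A ⥤ SuperPresheaf K U} {G : B ⥤ SuperPresheaf K U}
    {H : C ⥤ SuperPresheaf K U} (Ψ : IndHom G H) (Φ : IndHom F G) (V : Set.Iic U)
    (x : Lim F V) : (Ψ.comp Φ).lim V x = Ψ.lim V (Φ.lim V x) := by
  have : (Ψ.comp Φ).lim V = Ψ.lim V ∘ₗ Φ.lim V := Lim.hom_ext fun α s => by
    rw [LinearMap.comp_apply, IndHom.lim_ι, IndHom.lim_ι]
    exact HomGerm.lim_bind _ _ _ _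
  rw [this]; rfl

theorem BilinGerm.lim_bind {P Q : SuperPresheaf K U} {G : B ⥤ SuperPresheaf K U}
    {H : C ⥤ SuperPresheaf K U} (x : BilinGerm P Q G) (Φ : IndHom G H) (V : Set.Iic U)
    (s : P.carrier.obj (op V)) (t : Q.carrier.obj (op V)) :
    (x.bind Φ).lim V s t = Φ.lim V (x.lim V s t) := by
  induction x using BilinGerm.ind with | _ β b
  rw [BilinGerm.lim_mk, IndHom.lim_ι]
  change ((Φ.app β).compBilin b).lim V s t = _
  generalize Φ.app β = z
  induction z using HomGerm.ind with | _ γ f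
  rfl

theorem IndHom.lim_compBilin {A' : Type u} [SmallCategory A'] {F : A ⥤ SuperPresheaf K U}
    {F' : A' ⥤ SuperPresheaf K U} {G : B ⥤ SuperPresheaf K U} {H : C ⥤ SuperPresheaf K U}
    (Φ : IndHom G H) (b : IndBilin F F' G) (V : Set.Iic U) (x : Lim F V) (y : Lim F' V) :
    (Φ.compBilin b).lim V x y = Φ.lim V (b.lim V x y) := by
  have : (Φ.compBilin b).lim V = (b.lim V).compr₂ (Φ.lim V) :=
    Lim.hom_ext fun α s => Lim.hom_ext fun α' t => by
      rw [LinearMap.compr₂_apply, IndBilin.lim_ι, IndBilin.lim_ι]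
      exact BilinGerm.lim_bind _ _ _ _ _
  rw [this]; rfl

theorem IndBilin.lim_pull {A' : Type u} [SmallCategory A'] {P Q : SuperPresheaf K U}
    {G : A ⥤ SuperPresheaf K U} {G' : A' ⥤ SuperPresheaf K U} {H : C ⥤ SuperPresheaf K U}
    (b : IndBilin G G' H) (x : HomGerm P G) (x' : HomGerm Q G') (V : Set.Iic U)
    (s : P.carrier.obj (op V)) (t : Q.carrier.obj (op V)) :
    (b.pull x x').lim V s t = b.lim V (x.lim V s) (x'.lim V t) := by
  induction x using HomGerm.ind with | _ β f
  induction x' using HomGerm.ind with | _ β' f'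
  rw [HomGerm.lim_mk, HomGerm.lim_mk, IndBilin.lim_ι]
  exact BilinGerm.lim_precomp _ _ _ _ _ _

theorem IndBilin.lim_compProd {A' B' : Type u} [SmallCategory A'] [SmallCategory B']
    {F : A ⥤ SuperPresheaf K U} {F' : A' ⥤ SuperPresheaf K U} {G : B ⥤ SuperPresheaf K U}
    {G' : B' ⥤ SuperPresheaf K U} {H : C ⥤ SuperPresheaf K U}
    (b : IndBilin G G' H) (Φ : IndHom F G) (Ψ : IndHom F' G') (V : Set.Iic U)
    (x : Lim F V) (y : Lim F' V) :
    (b.compProd Φ Ψ).lim V x y = b.lim V (Φ.lim V x) (Ψ.lim V y) := by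
  have : (b.compProd Φ Ψ).lim V = (b.lim V).compl₁₂ (Φ.lim V) (Ψ.lim V) :=
    Lim.hom_ext fun α s => Lim.hom_ext fun α' t => by
      rw [LinearMap.compl₁₂_apply, IndBilin.lim_ι, IndHom.lim_ι, IndHom.lim_ι]
      exact IndBilin.lim_pull _ _ _ _ _ _
  rw [this]; rfl

theorem IndHom.lim_res {F : A ⥤ SuperPresheaf K U} {G : B ⥤ SuperPresheaf K U}
    (Φ : IndHom F G) {V W : Set.Iic U} (h : V ≤ W) (x : Lim F W) :
    Φ.lim V (Lim.res F h x) = Lim.res G h (Φ.lim W x) := by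
  have : Φ.lim V ∘ₗ Lim.res F h = Lim.res G h ∘ₗ Φ.lim W := Lim.hom_ext fun α s => by
    rw [LinearMap.comp_apply, LinearMap.comp_apply, Lim.res_ι, IndHom.lim_ι, IndHom.lim_ι]
    generalize Φ.app α = z
    induction z using HomGerm.ind with | _ β f
    rw [HomGerm.lim_mk, HomGerm.lim_mk, Lim.res_ι, SuperPresheaf.onOpen_res]
  exact LinearMap.congr_fun this x

theorem IndBilin.lim_res {F : A ⥤ SuperPresheaf K U} {G : B ⥤ SuperPresheaf K U}
    {H : C ⥤ SuperPresheaf K U} (b : IndBilin F G H) {V W : Set.Iic U} (h : V ≤ W)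
    (x : Lim F W) (y : Lim G W) :
    b.lim V (Lim.res F h x) (Lim.res G h y) = Lim.res H h (b.lim W x y) := by
  have : (b.lim V).compl₁₂ (Lim.res F h) (Lim.res G h) = (b.lim W).compr₂ (Lim.res H h) :=
    Lim.hom_ext fun α s => Lim.hom_ext fun β t => by
      rw [LinearMap.compl₁₂_apply, LinearMap.compr₂_apply, Lim.res_ι, Lim.res_ι, IndBilin.lim_ι,
        IndBilin.lim_ι]
      generalize b.app α β = z
      induction z using BilinGerm.ind with | _ γ c
      rw [BilinGerm.lim_mk, BilinGerm.lim_mk, Lim.res_ι, c.naturality]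
  exact LinearMap.congr_fun₂ this x y

end Basic

/-! ### Locality of vertex operators -/

section Shift

variable {K : Type*} [Field K] {G M : Type*} [AddCommGroup G] [AddCommGroup M] [Module K M]

/-- Translation of the argument by `v`.  A family `g : G → M` stands for a formal distribution in
several variables, written in modes: for `G = ℤ × ℤ` it is `∑ g (m, n) z^(-m-1) w^(-n-1)`, and the
translations by `(1, 0)` and `(0, 1)` are the multiplications by `z` and `w`. -/
def shift (K : Type*) [Field K] {G M : Type*} [AddCommGroup G] [AddCommGroup M] [Module K M]
    (v : G) : Module.End K (G → M) :=
  LinearMap.funLeft K M (· + v)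

theorem shift_apply (v : G) (g : G → M) (x : G) : shift K v g x = g (x + v) := rfl

theorem shift_mul (v w : G) :
    (shift K v * shift K w : Module.End K (G → M)) = shift K (v + w) := by
  ext g x
  simp only [Module.End.mul_apply, shift_apply, add_assoc]

theorem shift_commute (v w : G) : Commute (shift K v : Module.End K (G → M)) (shift K w) := by
  rw [commute_iff_eq, shift_mul, shift_mul, add_comm]

theorem shift_pow (v : G) (n : ℕ) :
    (shift K v : Module.End K (G → M)) ^ n = shift K (n • v) := by
  induction n with
  | zero => ext g x; simp [shift_apply]
  | succ n ih => rw [pow_succ, ih, shift_mul, succ_nsmul]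

theorem shift_sub_commute (v w v' w' : G) :
    Commute (shift K v - shift K w : Module.End K (G → M)) (shift K v' - shift K w') :=
  ((shift_commute v v').sub_right (shift_commute v w')).sub_left
    ((shift_commute w v').sub_right (shift_commute w w'))

theorem sub_pow_eq_sum {R : Type*} [Ring R] {x y : R} (h : Commute x y) (N : ℕ) :
    (x - y) ^ N =
      ∑ k ∈ Finset.range (N + 1), ((-1) ^ k * (N.choose k : ℤ)) • (x ^ (N - k) * y ^ k) := by
  rw [sub_eq_neg_add, h.symm.neg_left.add_pow]
  refine Finset.sum_congr rfl fun k _ => ?_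
  rw [neg_pow, zsmul_eq_mul, ((h.symm.pow_pow k (N - k)).eq).symm]
  push_cast
  rw [mul_assoc, mul_assoc, mul_assoc, ← (Nat.cast_commute (N.choose k) _).eq,
    ← mul_assoc (y ^ k), ← mul_assoc _ (y ^ k), (Nat.cast_commute (N.choose k) (y ^ k)).eq]

theorem shift_sub_pow_apply (v w : G) (N : ℕ) (g : G → M) (x : G) :
    ((shift K v - shift K w : Module.End K (G → M)) ^ N) g x =
      ∑ k ∈ Finset.range (N + 1),
        ((-1) ^ k * (N.choose k : ℤ)) • g (x + (((N : ℤ) - k) • v + (k : ℤ) • w)) := by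
  rw [sub_pow_eq_sum (shift_commute v w), LinearMap.sum_apply, Finset.sum_apply]
  refine Finset.sum_congr rfl fun k hk => ?_
  rw [shift_pow, shift_pow, shift_mul, LinearMap.smul_apply, Pi.smul_apply, shift_apply,
    ← natCast_zsmul v, ← natCast_zsmul w, Nat.cast_sub (Nat.lt_succ_iff.1 (Finset.mem_range.1 hk))]

/-- Multiplication by a difference of two variables is injective on the distributions with no
negative powers of one of them. -/
theorem eq_zero_of_shift_sub_pow (π : G →+ ℤ) {v w : G} (hv : π v = 1) (hw : π w = 0) (N : ℕ)
    {g : G → M} (hg : ∀ x, 0 ≤ π x → g x = 0)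
    (h : ((shift K v - shift K w : Module.End K (G → M)) ^ N) g = 0) : g = 0 := by
  induction N generalizing g with
  | zero => simpa using h
  | succ N ih =>
    rw [pow_succ, Module.End.mul_apply] at h
    have h0 := ih (g := (shift K v - shift K w : Module.End K (G → M)) g) (fun x hx => by
      rw [LinearMap.sub_apply, Pi.sub_apply, shift_apply, shift_apply, hg _ (by simp; omega),
        hg _ (by simp; omega), sub_zero]) h
    have h1 : ∀ x, g (x + v) = g (x + w) := fun x => sub_eq_zero.1 (congrFun h0 x)
    have h2 : ∀ (j : ℕ) x, -(j : ℤ) ≤ π x → g x = 0 := by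
      intro j
      induction j with
      | zero => simpa using hg
      | succ j ihj =>
        intro x hx
        have := h1 (x - w)
        rw [sub_add_cancel] at this
        rw [← this]
        apply ihj
        rw [map_add, map_sub, hv, hw]
        push_cast at hx
        omega
    funext x
    exact h2 (π x).natAbs x (by omega)

theorem shift_sub_pow_symm (v w : G) (N : ℕ) {g : G → M}
    (h : ((shift K v - shift K w : Module.End K (G → M)) ^ N) g = 0) :
    ((shift K w - shift K v : Module.End K (G → M)) ^ N) g = 0 := by
  rw [← neg_sub, ← neg_one_smul K, smul_pow, LinearMap.smul_apply, h, smul_zero]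

theorem shift_sub_pow_eq_zero_of_nonneg (π : G →+ ℤ) {v w : G} (hv : 0 ≤ π v) (hw : 0 ≤ π w)
    (N : ℕ) {g : G → M} (hg : ∀ x, 0 ≤ π x → g x = 0) (x : G) (hx : 0 ≤ π x) :
    ((shift K v - shift K w : Module.End K (G → M)) ^ N) g x = 0 := by
  rw [shift_sub_pow_apply]
  refine Finset.sum_eq_zero fun k hk => ?_
  have hk' := Nat.lt_succ_iff.1 (Finset.mem_range.1 hk)
  rw [hg, smul_zero]
  rw [map_add, map_add, map_zsmul, map_zsmul, smul_eq_mul, smul_eq_mul]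
  have h1 : 0 ≤ ((N : ℤ) - k) * π v := mul_nonneg (by omega) hv
  have h2 : 0 ≤ (k : ℤ) * π w := mul_nonneg (by omega) hw
  omega

/-- Fixing some of the variables. -/
theorem shift_sub_pow_comp {G' : Type*} [AddCommGroup G'] (φ : G' →+ G) (x₀ : G) (v w : G')
    (N : ℕ) (g : G → M) (y : G') :
    ((shift K (φ v) - shift K (φ w) : Module.End K (G → M)) ^ N) g (φ y + x₀) =
      ((shift K v - shift K w : Module.End K (G' → M)) ^ N) (fun y => g (φ y + x₀)) y := by
  rw [shift_sub_pow_apply, shift_sub_pow_apply]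
  refine Finset.sum_congr rfl fun k _ => ?_
  simp only [map_add, map_zsmul]
  congr 2
  abel

theorem shift_sub_pow_eq_zero_of_comp {G' : Type*} [AddCommGroup G'] (φ : G' →+ G) {v w : G'}
    {N : ℕ} {g : G → M} (h : ∀ x, ∃ y x₀, φ y + x₀ = x ∧
      ((shift K v - shift K w : Module.End K (G' → M)) ^ N) (fun y => g (φ y + x₀)) = 0) :
    ((shift K (φ v) - shift K (φ w) : Module.End K (G → M)) ^ N) g = 0 := by
  funext x
  obtain ⟨y, x₀, rfl, hx⟩ := h x
  rw [shift_sub_pow_comp, hx]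
  rfl

theorem shift_sub_pow_map {M' : Type*} [AddCommGroup M'] [Module K M'] (f : M →ₗ[K] M') (v w : G)
    (N : ℕ) (g : G → M) (x : G) :
    ((shift K v - shift K w : Module.End K (G → M')) ^ N) (fun x => f (g x)) x =
      f (((shift K v - shift K w : Module.End K (G → M)) ^ N) g x) := by
  simp only [shift_sub_pow_apply, map_sum, map_zsmul]

end Shift

section VSA

variable {K : Type} [Field K] {M : Type u} [AddCommGroup M] [Module K M]
  {par : ZMod 2 → Submodule K M} {vac : M} {T : M →ₗ[K] M} {Y : ℤ → M →ₗ[K] M →ₗ[K] M}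

/-- The sign in the super commutator of vectors of parities `p` and `q`. -/
def superSign (p q : ZMod 2) : ℤ := if p = 1 ∧ q = 1 then -1 else 1

/-- The super commutator `[Y(a, z), Y(b, w)] c` of vectors `a`, `b` of parities `p`, `q`, in
modes. -/
def superComm (Y : ℤ → M →ₗ[K] M →ₗ[K] M) (p q : ZMod 2) (a b : M) : M →ₗ[K] (ℤ × ℤ → M) :=
  LinearMap.pi fun x => Y x.1 a ∘ₗ Y x.2 b - superSign p q • Y x.2 b ∘ₗ Y x.1 a

theorem superComm_apply (p q : ZMod 2) (a b c : M) (x : ℤ × ℤ) :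
    superComm Y p q a b c x = Y x.1 a (Y x.2 b c) - superSign p q • Y x.2 b (Y x.1 a c) := rfl

theorem sum_superComm (p q : ZMod 2) (a b c : M) (N : ℕ) (m n : ℤ) :
    ((shift K (1, 0) - shift K (0, 1) : Module.End K (ℤ × ℤ → M)) ^ N) (superComm Y p q a b c)
        (m, n) =
      ∑ k ∈ Finset.range (N + 1), ((-1) ^ k * (N.choose k : ℤ)) •
        (Y (m + N - k) a (Y (n + k) b c) -
          (if p = 1 ∧ q = 1 then (-1 : ℤ) else 1) • Y (n + k) b (Y (m + N - k) a c)) := by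
  rw [shift_sub_pow_apply]
  refine Finset.sum_congr rfl fun k _ => ?_
  simp [superComm_apply, superSign, add_sub_assoc]

/-- Locality in the form `(z - w)^N [Y(a, z), Y(b, w)] c = 0`. -/
theorem IsVertexSuperalgebra.exists_shift_sub_pow
    (h : IsVertexSuperalgebra par vac T Y) {p q : ZMod 2} {a b : M} (ha : a ∈ par p)
    (hb : b ∈ par q) : ∃ N : ℕ, ∀ (c : M),
      ((shift K (1, 0) - shift K (0, 1) : Module.End K (ℤ × ℤ → M)) ^ N)
        (superComm Y p q a b c) = 0 := by
  obtain ⟨N, hN⟩ := h.locality p q a ha b hb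
  exact ⟨N, fun c => funext fun x => (sum_superComm p q a b c N x.1 x.2).trans (hN x.1 x.2 c)⟩

/-- `(z - w)^N Y(a, z) Y(b, w) 1` has no negative powers of `z` if `a_(n) b = 0` for `n ≥ N`: this
is clear for the coefficient of `w^0`, and `[T, Y(a, z)] = ∂_z Y(a, z)` gives the coefficient of
`w^(k+1)` from that of `w^k`. -/
theorem IsVertexSuperalgebra.shift_sub_pow_vac_eq_zero [CharZero K]
    (h : IsVertexSuperalgebra par vac T Y) {a b : M} {N : ℕ}
    (hab : ∀ n : ℤ, N ≤ n → Y n a b = 0) {x : ℤ × ℤ} (hx : 0 ≤ x.1) :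
    ((shift K (1, 0) - shift K (0, 1) : Module.End K (ℤ × ℤ → M)) ^ N)
        (fun x => Y x.1 a (Y x.2 b vac)) x = 0 := by
  have hT : ∀ a b n, T (Y n a b) = Y n a (T b) - n • Y (n - 1) a b := fun a b n => by
    rw [← sub_add_cancel (T (Y n a b)) (Y n a (T b)), h.translation, neg_smul]; abel
  -- `T (z - w)^N Y(a, z) Y(b, w) 1 = (∂_z + ∂_w) ((z - w)^N Y(a, z) Y(b, w) 1)`, in modes
  have hrec : ∀ N m n, T (((shift K (1, 0) - shift K (0, 1) : Module.End K (ℤ × ℤ → M)) ^ N)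
      (fun x => Y x.1 a (Y x.2 b vac)) (m, n)) =
      -(m • ((shift K (1, 0) - shift K (0, 1) : Module.End K (ℤ × ℤ → M)) ^ N)
        (fun x => Y x.1 a (Y x.2 b vac)) (m - 1, n)) -
      n • ((shift K (1, 0) - shift K (0, 1) : Module.End K (ℤ × ℤ → M)) ^ N)
        (fun x => Y x.1 a (Y x.2 b vac)) (m, n - 1) := by
    intro N
    induction N with
    | zero =>
      intro m n
      simp only [pow_zero, Module.End.one_apply, hT, h.T_vac, map_zero, zero_sub, map_neg,
        map_zsmul]
      abel
    | succ N ih =>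
      intro m n
      simp only [pow_succ', Module.End.mul_apply, LinearMap.sub_apply, Pi.sub_apply, shift_apply,
        Prod.mk_add_mk, add_zero, map_sub, ih, sub_add_cancel, add_smul,
        smul_sub, one_smul, add_sub_right_comm m, add_sub_right_comm n]
      abel
  have hzero : ∀ (k : ℕ) (m : ℤ), 0 ≤ m →
      ((shift K (1, 0) - shift K (0, 1) : Module.End K (ℤ × ℤ → M)) ^ N)
        (fun x => Y x.1 a (Y x.2 b vac)) (m, -1 - k) = 0 := by
    intro k
    induction k with
    | zero =>
      intro m hm
      rw [shift_sub_pow_apply]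
      refine Finset.sum_eq_zero fun k _ => ?_
      rcases Nat.eq_zero_or_pos k with rfl | hk
      · simp [h.vac_right, hab (m + N) (by omega)]
      · simp [h.vac_right_nonneg b (-1 + k) (by omega)]
    | succ k ih =>
      intro m hm
      have e := hrec N m (-1 - k)
      have e1 : m • ((shift K (1, 0) - shift K (0, 1) : Module.End K (ℤ × ℤ → M)) ^ N)
          (fun x => Y x.1 a (Y x.2 b vac)) (m - 1, -1 - k) = 0 := by
        rcases hm.eq_or_lt with rfl | hm
        · exact zero_smul _ _
        · rw [ih _ (by omega), smul_zero]
      rw [ih m hm, map_zero, e1, neg_zero, zero_sub, eq_comm, neg_eq_zero,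
        ← Int.cast_smul_eq_zsmul K, smul_eq_zero] at e
      rcases e with e | e
      · exact absurd (Int.cast_eq_zero.1 e) (by omega)
      · rw [← e]; push_cast; ring_nf
  obtain ⟨m, n⟩ := x
  rcases lt_or_ge n 0 with hn | hn
  · have := hzero (-1 - n).toNat m hx
    rwa [Int.toNat_of_nonneg (by omega), sub_sub_cancel] at this
  · rw [shift_sub_pow_apply]
    refine Finset.sum_eq_zero fun k _ => ?_
    simp [h.vac_right_nonneg b (n + k) (by omega)]

/-- `(z - w)^N [Y(a, z), Y(b, w)] 1` has no negative powers of `z` if `a_(n) b = 0` for `n ≥ N`;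
by locality a power of `z - w` kills it, so that it vanishes. -/
theorem IsVertexSuperalgebra.shift_sub_pow_superComm_vac [CharZero K]
    (h : IsVertexSuperalgebra par vac T Y) {p q : ZMod 2} {a b : M} (ha : a ∈ par p)
    (hb : b ∈ par q) {N : ℕ} (hab : ∀ n : ℤ, N ≤ n → Y n a b = 0) :
    ((shift K (1, 0) - shift K (0, 1) : Module.End K (ℤ × ℤ → M)) ^ N)
      (superComm Y p q a b vac) = 0 := by
  obtain ⟨L, hL⟩ := h.exists_shift_sub_pow ha hb
  refine eq_zero_of_shift_sub_pow (K := K) (AddMonoidHom.fst ℤ ℤ) (v := ((1, 0) : ℤ × ℤ))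
    (w := ((0, 1) : ℤ × ℤ)) rfl rfl L (fun x hx => ?_) ?_
  · have e : superComm Y p q a b vac = (fun x : ℤ × ℤ => Y x.1 a (Y x.2 b vac)) -
          fun x : ℤ × ℤ => superSign p q • Y x.2 b (Y x.1 a vac) := rfl
    rw [e, map_sub, Pi.sub_apply, h.shift_sub_pow_vac_eq_zero hab hx, zero_sub, neg_eq_zero]
    refine shift_sub_pow_eq_zero_of_nonneg (AddMonoidHom.fst ℤ ℤ) (by simp) (by simp) N
      (fun x hx => ?_) x hx
    rw [h.vac_right_nonneg a x.1 hx, map_zero, smul_zero]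
  · rw [← Module.End.mul_apply, ((shift_sub_commute _ _ _ _).pow_pow _ _).eq,
      Module.End.mul_apply, hL vac, map_zero]

/-- The exponent in the locality of `Y(a, z)` and `Y(b, w)` can be bounded by the pole order of
`Y(a, z) b`.  For a homogeneous `c`, locality moves `Y(c, x)` in
`(z - w)^N [Y(a, z), Y(b, w)] Y(c, x) 1` to the left, after multiplication by powers of `x - z` and
`x - w`, and `(z - w)^N [Y(a, z), Y(b, w)] 1` vanishes; as there are no negative powers of `x`, the
powers of `x - z` and `x - w` can be cancelled. -/
theorem IsVertexSuperalgebra.locality_of_forall_eq_zero [CharZero K]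
    (h : IsVertexSuperalgebra par vac T Y) {p q : ZMod 2} {a b : M} (ha : a ∈ par p)
    (hb : b ∈ par q) {N : ℕ} (hab : ∀ n : ℤ, N ≤ n → Y n a b = 0) (c : M) :
    ((shift K (1, 0) - shift K (0, 1) : Module.End K (ℤ × ℤ → M)) ^ N)
      (superComm Y p q a b c) = 0 := by
  suffices hle : ⨆ r, par r ≤ LinearMap.ker
      (((shift K (1, 0) - shift K (0, 1) : Module.End K (ℤ × ℤ → M)) ^ N) ∘ₗ
        superComm Y p q a b) from
    hle (h.par_isInternal.submodule_iSup_eq_top ▸ Submodule.mem_top)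
  refine iSup_le fun r d hd => ?_
  rw [LinearMap.mem_ker, LinearMap.comp_apply]
  obtain ⟨P, hP⟩ := h.exists_shift_sub_pow ha hd
  obtain ⟨Q, hQ⟩ := h.exists_shift_sub_pow hb hd
  -- the embeddings of the pairs of variables `(z, w)`, `(z, x)`, `(w, x)`
  let φzw : ℤ × ℤ →+ ℤ × ℤ × ℤ :=
    (AddMonoidHom.fst ℤ ℤ).prod ((AddMonoidHom.snd ℤ ℤ).prod 0)
  let φzx : ℤ × ℤ →+ ℤ × ℤ × ℤ :=
    (AddMonoidHom.fst ℤ ℤ).prod ((0 : ℤ × ℤ →+ ℤ).prod (AddMonoidHom.snd ℤ ℤ))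
  let φwx : ℤ × ℤ →+ ℤ × ℤ × ℤ :=
    (0 : ℤ × ℤ →+ ℤ).prod ((AddMonoidHom.fst ℤ ℤ).prod (AddMonoidHom.snd ℤ ℤ))
  let Z : Module.End K (ℤ × ℤ × ℤ → M) := shift K (1, 0, 0)
  let W : Module.End K (ℤ × ℤ × ℤ → M) := shift K (0, 1, 0)
  let S : Module.End K (ℤ × ℤ × ℤ → M) := shift K (0, 0, 1)
  let E : ℤ × ℤ × ℤ → M := fun x => superComm Y p q a b (Y x.2.2 d vac) (x.1, x.2.1)
  let R₁ : ℤ × ℤ × ℤ → M := fun x => Y x.1 a (superComm Y q r b d vac (x.2.1, x.2.2))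
  let R₂ : ℤ × ℤ × ℤ → M := fun x => superComm Y p r a d (Y x.2.1 b vac) (x.1, x.2.2)
  let R₃ : ℤ × ℤ × ℤ → M := fun x => Y x.2.1 b (superComm Y p r a d vac (x.1, x.2.2))
  let R₄ : ℤ × ℤ × ℤ → M := fun x => superComm Y q r b d (Y x.1 a vac) (x.2.1, x.2.2)
  let R₅ : ℤ × ℤ × ℤ → M := fun x => Y x.2.2 d (superComm Y p q a b vac (x.1, x.2.1))
  -- `[Y(a, z), Y(b, w)] Y(d, x) 1`, expanded by moving `Y(d, x)` to the left
  have hE : E = R₁ + superSign q r • R₂ - superSign p q • R₃ -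
      (superSign p q * superSign p r) • R₄ + (superSign p r * superSign q r) • R₅ := by
    funext x
    simp only [E, R₁, R₂, R₃, R₄, R₅, Pi.add_apply, Pi.sub_apply, Pi.smul_apply, superComm_apply,
      map_sub, map_zsmul, smul_sub, mul_smul]
    module
  have h₁ : ((S - W) ^ Q) R₁ = 0 := by
    refine shift_sub_pow_symm _ _ Q (shift_sub_pow_eq_zero_of_comp φwx (v := (1, 0)) (w := (0, 1))
      fun x => ⟨x.2, (x.1, 0), by simp [φwx], ?_⟩)
    funext y
    simp only [R₁, φwx, AddMonoidHom.prod_apply, AddMonoidHom.zero_apply, Prod.fst_add,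
      Prod.snd_add, add_zero, zero_add, AddMonoidHom.coe_fst, AddMonoidHom.coe_snd]
    rw [shift_sub_pow_map, hQ, Pi.zero_apply, map_zero]
  have h₂ : ((S - Z) ^ P) R₂ = 0 := by
    refine shift_sub_pow_symm _ _ P (shift_sub_pow_eq_zero_of_comp φzx (v := (1, 0)) (w := (0, 1))
      fun x => ⟨(x.1, x.2.2), (0, x.2.1, 0), by simp [φzx], ?_⟩)
    simp only [R₂, φzx, AddMonoidHom.prod_apply, AddMonoidHom.zero_apply, Prod.fst_add,
      Prod.snd_add, add_zero, zero_add, AddMonoidHom.coe_fst, AddMonoidHom.coe_snd]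
    exact hP _
  have h₃ : ((S - Z) ^ P) R₃ = 0 := by
    refine shift_sub_pow_symm _ _ P (shift_sub_pow_eq_zero_of_comp φzx (v := (1, 0)) (w := (0, 1))
      fun x => ⟨(x.1, x.2.2), (0, x.2.1, 0), by simp [φzx], ?_⟩)
    funext y
    simp only [R₃, φzx, AddMonoidHom.prod_apply, AddMonoidHom.zero_apply, Prod.fst_add,
      Prod.snd_add, add_zero, zero_add, AddMonoidHom.coe_fst, AddMonoidHom.coe_snd]
    rw [shift_sub_pow_map, hP, Pi.zero_apply, map_zero]
  have h₄ : ((S - W) ^ Q) R₄ = 0 := by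
    refine shift_sub_pow_symm _ _ Q (shift_sub_pow_eq_zero_of_comp φwx (v := (1, 0)) (w := (0, 1))
      fun x => ⟨x.2, (x.1, 0), by simp [φwx], ?_⟩)
    simp only [R₄, φwx, AddMonoidHom.prod_apply, AddMonoidHom.zero_apply, Prod.fst_add,
      Prod.snd_add, add_zero, zero_add, AddMonoidHom.coe_fst, AddMonoidHom.coe_snd]
    exact hQ _
  have h₅ : ((Z - W) ^ N) R₅ = 0 := by
    refine shift_sub_pow_eq_zero_of_comp φzw (v := (1, 0)) (w := (0, 1))
      fun x => ⟨(x.1, x.2.1), (0, 0, x.2.2), by simp [φzw], ?_⟩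
    funext y
    simp only [R₅, φzw, AddMonoidHom.prod_apply, AddMonoidHom.zero_apply, Prod.fst_add,
      Prod.snd_add, add_zero, zero_add, AddMonoidHom.coe_fst, AddMonoidHom.coe_snd]
    rw [shift_sub_pow_map, h.shift_sub_pow_superComm_vac ha hb hab, Pi.zero_apply, map_zero]
  -- each of the five terms is annihilated by one of the three commuting factors
  have hkill : ((S - Z) ^ P) (((S - W) ^ Q) (((Z - W) ^ N) E)) = 0 := by
    have hAB : Commute ((S - Z) ^ P) ((S - W) ^ Q) := (shift_sub_commute _ _ _ _).pow_pow _ _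
    have hBC : Commute ((S - W) ^ Q) ((Z - W) ^ N) := (shift_sub_commute _ _ _ _).pow_pow _ _
    have hAC : Commute ((S - Z) ^ P) ((Z - W) ^ N) := (shift_sub_commute _ _ _ _).pow_pow _ _
    have hA : ∀ g, ((S - Z) ^ P) g = 0 →
        ((S - Z) ^ P) (((S - W) ^ Q) (((Z - W) ^ N) g)) = 0 := fun g hg => by
      rw [← Module.End.mul_apply, hAB.eq, Module.End.mul_apply, ← Module.End.mul_apply _ _ g,
        hAC.eq, Module.End.mul_apply, hg, map_zero, map_zero]
    have hB : ∀ g, ((S - W) ^ Q) g = 0 →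
        ((S - Z) ^ P) (((S - W) ^ Q) (((Z - W) ^ N) g)) = 0 := fun g hg => by
      rw [← Module.End.mul_apply _ _ g, hBC.eq, Module.End.mul_apply, hg, map_zero, map_zero]
    have hC : ((S - Z) ^ P) (((S - W) ^ Q) (((Z - W) ^ N) R₅)) = 0 := by
      rw [h₅, map_zero, map_zero]
    simp only [hE, map_add, map_sub, map_zsmul, hA _ h₂, hA _ h₃, hB _ h₁, hB _ h₄, hC, smul_zero,
      add_zero, sub_zero]
  let π : ℤ × ℤ × ℤ →+ ℤ := (AddMonoidHom.snd ℤ ℤ).comp (AddMonoidHom.snd ℤ (ℤ × ℤ))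
  have hE₀ : ∀ x, 0 ≤ π x → E x = 0 := fun x hx => by
    change superComm Y p q a b (Y x.2.2 d vac) (x.1, x.2.1) = 0
    rw [h.vac_right_nonneg d x.2.2 hx, map_zero]
    rfl
  have hCE₀ := shift_sub_pow_eq_zero_of_nonneg (K := K) π (v := (1, 0, 0)) (w := (0, 1, 0)) le_rfl
    le_rfl N hE₀
  have hCE := eq_zero_of_shift_sub_pow (K := K) π (v := (0, 0, 1)) (w := (0, 1, 0)) rfl rfl Q hCE₀
    (eq_zero_of_shift_sub_pow (K := K) π (v := (0, 0, 1)) (w := (1, 0, 0)) rfl rfl P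
      (shift_sub_pow_eq_zero_of_nonneg π (by decide) (by decide) Q hCE₀) hkill)
  -- the coefficient of `x^0`, that is, the mode `-1`
  funext y
  have e := shift_sub_pow_comp (K := K) φzw (0, 0, -1) (1, 0) (0, 1) N E y
  have e' : (fun y => E (φzw y + (0, 0, -1))) = superComm Y p q a b d := by
    funext y
    simp only [E, φzw, AddMonoidHom.prod_apply, AddMonoidHom.zero_apply, Prod.fst_add,
      Prod.snd_add, add_zero, zero_add, AddMonoidHom.coe_fst, AddMonoidHom.coe_snd, h.vac_right]
  rw [e'] at e
  exact e.symm.trans (congrFun hCE _)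

/-- The axioms of a vertex superalgebra can be checked through a jointly injective family of
homomorphisms `r i` to vertex superalgebras, except that the poles have to be bounded uniformly
in `i`. -/
theorem IsVertexSuperalgebra.of_jointly_injective [CharZero K] {I : Type*} {N : I → Type u}
    [∀ i, AddCommGroup (N i)] [∀ i, Module K (N i)] {par' : ∀ i, ZMod 2 → Submodule K (N i)}
    {vac' : ∀ i, N i} {T' : ∀ i, N i →ₗ[K] N i} {Y' : ∀ i, ℤ → N i →ₗ[K] N i →ₗ[K] N i}
    (h : ∀ i, IsVertexSuperalgebra (par' i) (vac' i) (T' i) (Y' i))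
    (r : ∀ i, M →ₗ[K] N i) (hr : ∀ x, (∀ i, r i x = 0) → x = 0)
    (hpar : ∀ i p, ∀ x ∈ par p, r i x ∈ par' i p) (hvac : ∀ i, r i vac = vac' i)
    (hT : ∀ i x, r i (T x) = T' i (r i x))
    (hY : ∀ i n x y, r i (Y n x y) = Y' i n (r i x) (r i y))
    (par_isInternal : DirectSum.IsInternal par) (vac_even : vac ∈ par 0)
    (T_even : ∀ p, ∀ a ∈ par p, T a ∈ par p)
    (Y_even : ∀ n p q, ∀ a ∈ par p, ∀ b ∈ par q, Y n a b ∈ par (p + q))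
    (field : ∀ a b, ∃ N : ℤ, ∀ n, N ≤ n → Y n a b = 0) :
    IsVertexSuperalgebra par vac T Y := by
  have ext : ∀ {x y : M}, (∀ i, r i x = r i y) → x = y := fun {x y} hxy =>
    sub_eq_zero.1 (hr _ fun i => by rw [map_sub, hxy, sub_self])
  refine ⟨par_isInternal, vac_even, T_even, Y_even, field, fun a n => ext fun i => ?_,
    fun a n hn => ext fun i => ?_, fun a => ext fun i => ?_, ext fun i => ?_,
    fun a b n => ext fun i => ?_, fun p q a ha b hb => ?_⟩
  · rw [hY, hvac, (h i).vac_left, apply_ite (r i), map_zero]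
  · rw [hY, hvac, (h i).vac_right_nonneg _ n hn, map_zero]
  · rw [hY, hvac, (h i).vac_right]
  · rw [hT, hvac, (h i).T_vac, map_zero]
  · rw [map_sub, map_zsmul, hT, hY, hY, hY, hT, (h i).translation]
  · obtain ⟨N, hN⟩ := field a b
    refine ⟨N.toNat, fun m n c => ext fun i => ?_⟩
    have e := congrFun ((h i).locality_of_forall_eq_zero (hpar i p a ha) (hpar i q b hb)
      (N := N.toNat) (fun n hn => by rw [← hY, hN n (by omega), map_zero]) (r i c)) (m, n)
    rw [sum_superComm] at e
    simpa only [map_sum, map_sub, map_zsmul, hY, map_zero, Pi.zero_apply] using e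

end VSA

/-! ### Gluing sheaves of super vector spaces -/

section SheafGluing

variable {K : Type} [Field K] {X : Type u} [TopologicalSpace X]

/-- The sheaf condition for a covering given as a family. -/
theorem SuperPresheaf.IsSheaf.existsUnique_glue {U : Opens X} {P : SuperPresheaf K U}
    (hP : P.IsSheaf) {ι : Type*} {O : ι → Set.Iic U} {W : Set.Iic U} (hO : ∀ j, O j ≤ W)
    (hW : W.1 ≤ ⨆ j, (O j).1) (s : ∀ j, P.carrier.obj (op (O j)))
    (hs : ∀ j j', P.res (inf_le_left : O j ⊓ O j' ≤ O j) (s j) =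
      P.res (inf_le_right : O j ⊓ O j' ≤ O j') (s j')) :
    ∃! t : P.carrier.obj (op W), ∀ j, P.res (hO j) t = s j := by
  have hlub : IsLUB (Set.range O) W := by
    refine ⟨?_, fun Z hZ => ?_⟩
    · rintro _ ⟨j, rfl⟩
      exact hO j
    · exact hW.trans (iSup_le fun j => hZ ⟨j, rfl⟩)
  choose e he using fun V : Set.range O => V.2
  have hs' : ∀ j j' (V : Set.Iic U) (h : V ≤ O j) (h' : V ≤ O j'),
      P.res h (s j) = P.res h' (s j') := fun j j' V h h' => by
    have := congrArg (P.res (le_inf h h' : V ≤ O j ⊓ O j')) (hs j j')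
    rwa [P.res_res, P.res_res] at this
  obtain ⟨t, ht, htu⟩ := hP W (Set.range O) hlub (fun V => P.res (he V).ge (s (e V)))
    (fun V V' => by
      rw [P.res_res, P.res_res]
      exact hs' _ _ _ _ _)
  refine ⟨t, fun j => ?_, fun t' ht' => htu t' fun V => ?_⟩
  · refine (ht ⟨O j, j, rfl⟩).trans ?_
    rw [hs' _ j _ _ le_rfl, P.res_self]
  · rw [← ht', P.res_res]

theorem SuperPresheaf.IsSheaf.ext {U : Opens X} {P : SuperPresheaf K U}
    (hP : P.IsSheaf) {ι : Type*} {O : ι → Set.Iic U} {W : Set.Iic U} (hO : ∀ j, O j ≤ W)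
    (hW : W.1 ≤ ⨆ j, (O j).1) {t t' : P.carrier.obj (op W)}
    (h : ∀ j, P.res (hO j) t = P.res (hO j) t') : t = t' :=
  (hP.existsUnique_glue hO hW (fun j => P.res (hO j) t') fun j j' => by
    rw [P.res_res, P.res_res]).unique h fun _ => rfl

theorem le_iSup_inf_of_isLUB {U : Opens X} {W : Set.Iic U} {S : Set (Set.Iic U)} (hS : IsLUB S W)
    {O : Opens X} (hO : O ≤ W.1) : O ≤ ⨆ V : S, O ⊓ V.1.1 := by
  rw [← inf_iSup_eq]
  refine le_inf le_rfl (hO.trans ?_)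
  have h : W ≤ (⟨⨆ V : S, V.1.1, (iSup_le fun V => V.1.2 : ⨆ V : S, V.1.1 ≤ U)⟩ : Set.Iic U) :=
    hS.2 fun V hV => (le_iSup (fun V : S => V.1.1) ⟨V, hV⟩ : V.1 ≤ _)
  exact h

variable {Λ : Type u} {U : Λ → Opens X}

/-- Sheaves of super vector spaces on the members of a family of open subsets with even
isomorphisms on the overlaps which satisfy the cocycle condition. -/
structure SheafDatum (K : Type) [Field K] {X : Type u} [TopologicalSpace X] {Λ : Type u}
    (U : Λ → Opens X) : Type (u + 1) where
  P : ∀ i, SuperPresheaf K (U i)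
  isSheaf : ∀ i, (P i).IsSheaf
  φ : ∀ i k, (P k).restrict (inf_le_right : U i ⊓ U k ≤ U k) ⟶
    (P i).restrict (inf_le_left : U i ⊓ U k ≤ U i)
  φ_even : ∀ i k, SuperPresheaf.IsEven (φ i k)
  φ_self : ∀ i V x, SuperPresheaf.onOpen (φ i i) V x = x
  φ_comp : ∀ i k m (O : Opens X) (hi : O ≤ U i) (hk : O ≤ U k) (hm : O ≤ U m)
    (x : (P m).carrier.obj (op ⟨O, hm⟩)),
    SuperPresheaf.onOpen (φ i k) ⟨O, le_inf hi hk⟩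
      (SuperPresheaf.onOpen (φ k m) ⟨O, le_inf hk hm⟩ x) =
      SuperPresheaf.onOpen (φ i m) ⟨O, le_inf hi hm⟩ x

namespace SheafDatum

variable (D : SheafDatum K U)

/-- The isomorphism on the overlap, on the sections over `O ⊆ U i ∩ U k`. -/
def trans {O : Opens X} (i k : Λ) (hi : O ≤ U i) (hk : O ≤ U k) :
    (D.P k).carrier.obj (op ⟨O, hk⟩) →ₗ[K] (D.P i).carrier.obj (op ⟨O, hi⟩) :=
  SuperPresheaf.onOpen (D.φ i k) ⟨O, le_inf hi hk⟩

theorem trans_self {O : Opens X} (i : Λ) (hi hi' : O ≤ U i)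
    (x : (D.P i).carrier.obj (op ⟨O, hi⟩)) : D.trans i i hi' hi x = x :=
  D.φ_self i ⟨O, le_inf hi hi⟩ x

theorem trans_trans {O : Opens X} (i k m : Λ) (hi : O ≤ U i) (hk : O ≤ U k) (hm : O ≤ U m)
    (x : (D.P m).carrier.obj (op ⟨O, hm⟩)) :
    D.trans i k hi hk (D.trans k m hk hm x) = D.trans i m hi hm x :=
  D.φ_comp i k m O hi hk hm x

theorem trans_res {O O' : Opens X} (h : O' ≤ O) (i k : Λ) (hi : O ≤ U i) (hk : O ≤ U k)
    (x : (D.P k).carrier.obj (op ⟨O, hk⟩)) :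
    D.trans i k (h.trans hi) (h.trans hk) ((D.P k).res (V := ⟨O', h.trans hk⟩) h x) =
      (D.P i).res (V := ⟨O', h.trans hi⟩) h (D.trans i k hi hk x) :=
  SuperPresheaf.onOpen_res (D.φ i k) (V := ⟨O', le_inf (h.trans hi) (h.trans hk)⟩)
    (W := ⟨O, le_inf hi hk⟩) h x

theorem trans_mem {O : Opens X} (i k : Λ) (hi : O ≤ U i) (hk : O ≤ U k) {p : ZMod 2}
    {x : (D.P k).carrier.obj (op ⟨O, hk⟩)} (hx : x ∈ (D.P k).parity ⟨O, hk⟩ p) :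
    D.trans i k hi hk x ∈ (D.P i).parity ⟨O, hi⟩ p :=
  D.φ_even i k ⟨O, le_inf hi hk⟩ p x hx

/-- The sections over `V` of the glued sheaf: the families of sections of the `P i` over all open
subsets `O ⊆ V ∩ U i` which are compatible with the restriction maps and with the isomorphisms on
the overlaps. -/
def sections (V : Opens X) :
    Submodule K (∀ i, ∀ O : {O : Opens X // O ≤ V ∧ O ≤ U i},
      (D.P i).carrier.obj (op ⟨O.1, O.2.2⟩)) where
  carrier := {s |
    (∀ i (O O' : Opens X) (hV : O ≤ V) (hi : O ≤ U i) (h : O' ≤ O),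
      (D.P i).res (V := ⟨O', h.trans hi⟩) h (s i ⟨O, hV, hi⟩) =
        s i ⟨O', h.trans hV, h.trans hi⟩) ∧
    ∀ i k (O : Opens X) (hV : O ≤ V) (hi : O ≤ U i) (hk : O ≤ U k),
      D.trans i k hi hk (s k ⟨O, hV, hk⟩) = s i ⟨O, hV, hi⟩}
  add_mem' hs ht := ⟨fun i O O' hV hi h => by
      rw [Pi.add_apply, Pi.add_apply, Pi.add_apply, map_add, hs.1 i O O' hV hi h,
        ht.1 i O O' hV hi h],
    fun i k O hV hi hk => by
      rw [Pi.add_apply, Pi.add_apply, Pi.add_apply, Pi.add_apply, map_add,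
        hs.2 i k O hV hi hk, ht.2 i k O hV hi hk]⟩
  zero_mem' := ⟨fun _ _ _ _ _ _ => map_zero _, fun _ _ _ _ _ _ => map_zero _⟩
  smul_mem' c s hs := ⟨fun i O O' hV hi h => by
      rw [Pi.smul_apply, Pi.smul_apply, Pi.smul_apply, map_smul, hs.1 i O O' hV hi h],
    fun i k O hV hi hk => by
      rw [Pi.smul_apply, Pi.smul_apply, Pi.smul_apply, Pi.smul_apply, map_smul,
        hs.2 i k O hV hi hk]⟩

/-- The component in `P i` of a section of the glued sheaf, over `O ⊆ V ∩ U i`. -/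
def eval {V O : Opens X} (i : Λ) (hV : O ≤ V) (hi : O ≤ U i) :
    D.sections V →ₗ[K] (D.P i).carrier.obj (op ⟨O, hi⟩) :=
  LinearMap.proj (φ := fun O : {O : Opens X // O ≤ V ∧ O ≤ U i} =>
      (D.P i).carrier.obj (op ⟨O.1, O.2.2⟩)) ⟨O, hV, hi⟩ ∘ₗ
    LinearMap.proj i ∘ₗ (D.sections V).subtype

variable {D}

theorem sections_ext {V : Opens X} {s t : D.sections V}
    (h : ∀ i O (hV : O ≤ V) (hi : O ≤ U i), D.eval i hV hi s = D.eval i hV hi t) : s = t :=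
  Subtype.ext (funext fun i => funext fun O => h i O.1 O.2.1 O.2.2)

theorem res_eval {V O O' : Opens X} (s : D.sections V) (i : Λ) (hV : O ≤ V) (hi : O ≤ U i)
    (h : O' ≤ O) : (D.P i).res (V := ⟨O', h.trans hi⟩) (W := ⟨O, hi⟩) h (D.eval i hV hi s) =
      D.eval i (h.trans hV) (h.trans hi) s :=
  s.2.1 i O O' hV hi h

theorem trans_eval {V O : Opens X} (s : D.sections V) (i k : Λ) (hV : O ≤ V) (hi : O ≤ U i)
    (hk : O ≤ U k) : D.trans i k hi hk (D.eval k hV hk s) = D.eval i hV hi s :=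
  s.2.2 i k O hV hi hk

variable (D)

/-- A section of the glued sheaf from its components. -/
def mkSection {V : Opens X}
    (s : ∀ i (O : Opens X) (_ : O ≤ V) (hi : O ≤ U i), (D.P i).carrier.obj (op ⟨O, hi⟩))
    (hres : ∀ i (O O' : Opens X) (hV : O ≤ V) (hi : O ≤ U i) (h : O' ≤ O),
      (D.P i).res (V := ⟨O', h.trans hi⟩) (W := ⟨O, hi⟩) h (s i O hV hi) =
        s i O' (h.trans hV) (h.trans hi))
    (htrans : ∀ i k (O : Opens X) (hV : O ≤ V) (hi : O ≤ U i) (hk : O ≤ U k),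
      D.trans i k hi hk (s k O hV hk) = s i O hV hi) : D.sections V :=
  ⟨fun i O => s i O.1 O.2.1 O.2.2, hres, htrans⟩

theorem eval_mkSection {V : Opens X}
    (s : ∀ i (O : Opens X) (_ : O ≤ V) (hi : O ≤ U i), (D.P i).carrier.obj (op ⟨O, hi⟩))
    (hres) (htrans) {O : Opens X} (i : Λ) (hV : O ≤ V) (hi : O ≤ U i) :
    D.eval i hV hi (D.mkSection s hres htrans) = s i O hV hi := rfl

/-- A linear map into the sections of the glued sheaf from its components. -/
def liftSections {V : Opens X} {M : Type*} [AddCommGroup M] [Module K M]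
    (f : ∀ i (O : Opens X) (_ : O ≤ V) (hi : O ≤ U i), M →ₗ[K] (D.P i).carrier.obj (op ⟨O, hi⟩))
    (hres : ∀ i (O O' : Opens X) (hV : O ≤ V) (hi : O ≤ U i) (h : O' ≤ O) x,
      (D.P i).res (V := ⟨O', h.trans hi⟩) (W := ⟨O, hi⟩) h (f i O hV hi x) =
        f i O' (h.trans hV) (h.trans hi) x)
    (htrans : ∀ i k (O : Opens X) (hV : O ≤ V) (hi : O ≤ U i) (hk : O ≤ U k) x,
      D.trans i k hi hk (f k O hV hk x) = f i O hV hi x) : M →ₗ[K] D.sections V where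
  toFun x := D.mkSection (fun i O hV hi => f i O hV hi x)
    (fun i O O' hV hi h => hres i O O' hV hi h x) (fun i k O hV hi hk => htrans i k O hV hi hk x)
  map_add' x y := sections_ext fun i O hV hi => by
    rw [map_add, eval_mkSection, eval_mkSection, eval_mkSection, map_add]
  map_smul' c x := sections_ext fun i O hV hi => by
    rw [map_smul, eval_mkSection, eval_mkSection, map_smul, RingHom.id_apply]

/-- The restriction maps of the glued sheaf. -/
def sectionsRes {V W : Opens X} (h : V ≤ W) : D.sections W →ₗ[K] D.sections V :=
  D.liftSections (fun i _ hV hi => D.eval i (hV.trans h) hi)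
    (fun i _ _ _ _ _ s => res_eval s i _ _ _) (fun i k _ _ _ _ s => trans_eval s i k _ _ _)

/-- The sections of parity `p` of the glued sheaf. -/
def sectionsParity (V : Opens X) (p : ZMod 2) : Submodule K (D.sections V) :=
  ⨅ q : Σ i, {O : Opens X // O ≤ V ∧ O ≤ U i},
    ((D.P q.1).parity ⟨q.2.1, q.2.2.2⟩ p).comap (D.eval q.1 q.2.2.1 q.2.2.2)

theorem mem_sectionsParity {V : Opens X} {p : ZMod 2} {s : D.sections V} :
    s ∈ D.sectionsParity V p ↔ ∀ i O (hV : O ≤ V) (hi : O ≤ U i),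
      D.eval i hV hi s ∈ (D.P i).parity ⟨O, hi⟩ p := by
  rw [sectionsParity, Submodule.mem_iInf]
  exact ⟨fun h i O hV hi => h ⟨i, O, hV, hi⟩, fun h q => h q.1 q.2.1 q.2.2.1 q.2.2.2⟩

theorem sectionsParity_isInternal (V : Opens X) :
    DirectSum.IsInternal (D.sectionsParity V) := by
  refine isInternal_of_jointly_injective
    (I := Σ i, {O : Opens X // O ≤ V ∧ O ≤ U i})
    (r := fun q => D.eval q.1 q.2.2.1 q.2.2.2)
    (R := fun q p => (D.P q.1).parity ⟨q.2.1, q.2.2.2⟩ p)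
    (fun q => (D.P q.1).isInternal _)
    (fun s hs => sections_ext fun i O hV hi => by rw [hs ⟨i, O, hV, hi⟩, map_zero])
    (fun p s => by
      rw [mem_sectionsParity]
      exact ⟨fun h q => h q.1 q.2.1 q.2.2.1 q.2.2.2, fun h i O hV hi => h ⟨i, O, hV, hi⟩⟩)
    (fun p s => ?_) (fun s => ⟨Finset.univ, fun _ _ h => absurd (Finset.mem_univ _) h⟩)
  refine ⟨D.mkSection (fun i O hV hi =>
    internalProj ((D.P i).isInternal ⟨O, hi⟩) p (D.eval i hV hi s)) (fun i O O' hV hi h => ?_)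
    (fun i k O hV hi hk => ?_), fun q => rfl⟩
  · rw [← internalProj_map _ ((D.P i).isInternal ⟨O', h.trans hi⟩) _ (fun p x hx =>
      (D.P i).res_mem h hx), res_eval]
  · rw [← internalProj_map _ ((D.P i).isInternal ⟨O, hi⟩) _ (fun p x hx =>
      D.trans_mem i k hi hk hx), trans_eval]

/-- The glued sheaf. -/
def glued : SuperPresheaf K (⊤ : Opens X) where
  carrier :=
    { obj := fun V => ModuleCat.of K (D.sections V.unop.1)
      map := fun f => ModuleCat.ofHom (D.sectionsRes f.unop.le) }
  parity V := D.sectionsParity V.1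
  isInternal V := D.sectionsParity_isInternal V.1
  map_mem f p s hs := (D.mem_sectionsParity).2 fun i O hV hi =>
    (D.mem_sectionsParity).1 hs i O (hV.trans f.le) hi

/-- The components of the glued section are glued separately in each `P i`; over an open subset
of several `U i` they correspond to each other since this holds on a covering. -/
theorem glued_isSheaf : D.glued.IsSheaf := by
  intro W S hS s hs
  have hs' : ∀ (V V' : S) (i : Λ) (O : Opens X) (hV : O ≤ V.1.1) (hV' : O ≤ V'.1.1)
      (hi : O ≤ U i), D.eval i hV hi (s V) = D.eval i hV' hi (s V') :=
    fun V V' i O hV hV' hi => congrArg (D.eval i (le_inf hV hV' : O ≤ V.1.1 ⊓ V'.1.1) hi) (hs V V')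
  have hglue : ∀ i (O : Opens X) (hW : O ≤ W.1) (hi : O ≤ U i),
      ∃! t : (D.P i).carrier.obj (op ⟨O, hi⟩), ∀ V : S,
        (D.P i).res (V := ⟨O ⊓ V.1.1, inf_le_left.trans hi⟩)
          (inf_le_left : O ⊓ V.1.1 ≤ O) t =
          D.eval i inf_le_right (inf_le_left.trans hi) (s V) := fun i O hW hi =>
    (D.isSheaf i).existsUnique_glue
      (O := fun V : S => ⟨O ⊓ V.1.1, inf_le_left.trans hi⟩) (W := ⟨O, hi⟩)
      (fun V => (inf_le_left : O ⊓ V.1.1 ≤ O)) (le_iSup_inf_of_isLUB hS hW)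
      (fun V => D.eval i inf_le_right (inf_le_left.trans hi) (s V)) fun V V' =>
        (res_eval (s V) i _ _ _).trans
          ((hs' V V' i _ _ _ _).trans (res_eval (s V') i _ _ _).symm)
  have hext : ∀ {i : Λ} {O : Opens X} (hW : O ≤ W.1) (hi : O ≤ U i)
      {t t' : (D.P i).carrier.obj (op ⟨O, hi⟩)},
      (∀ V : S, (D.P i).res (V := ⟨O ⊓ V.1.1, inf_le_left.trans hi⟩)
          (inf_le_left : O ⊓ V.1.1 ≤ O) t =
        (D.P i).res (V := ⟨O ⊓ V.1.1, inf_le_left.trans hi⟩)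
          (inf_le_left : O ⊓ V.1.1 ≤ O) t') → t = t' :=
    fun {i O} hW hi {t t'} h => (D.isSheaf i).ext
      (O := fun V : S => ⟨O ⊓ V.1.1, inf_le_left.trans hi⟩) (W := ⟨O, hi⟩)
      (fun V => (inf_le_left : O ⊓ V.1.1 ≤ O)) (le_iSup_inf_of_isLUB hS hW) h
  choose t ht htu using fun i O hW hi => hglue i O hW hi
  have hmem : ∀ i O (hW : O ≤ W.1) (hi : O ≤ U i) (O' : Opens X) (h : O' ≤ O) (V : S)
      (hV : O' ≤ V.1.1), (D.P i).res (V := ⟨O', h.trans hi⟩) h (t i O hW hi) =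
        D.eval i hV (h.trans hi) (s V) := fun i O hW hi O' h V hV => by
    rw [← res_eval (s V) i inf_le_right (inf_le_left.trans hi) (le_inf h hV), ← ht i O hW hi V,
      (D.P i).res_res]
  refine ⟨D.mkSection t (fun i O O' hW hi h => hext (h.trans hW) (h.trans hi) fun V => ?_)
    (fun i k O hW hi hk => hext hW hi fun V => ?_), fun V => ?_, fun t' ht' => ?_⟩
  · rw [(D.P i).res_res, hmem i O hW hi _ _ V inf_le_right, ht]
  · rw [← D.trans_res inf_le_left, ht, ht]
    exact trans_eval (V := V.1.1) (s V) i k inf_le_right _ _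
  · refine sections_ext fun i O hV hi => ?_
    change t i O _ _ = _
    refine ((D.P i).res_self le_rfl _).symm.trans (hmem i O _ hi O le_rfl V hV)
  · refine sections_ext fun i O hW hi => ?_
    refine htu i O hW hi _ fun V => ?_
    refine (res_eval t' i _ _ _).trans ?_
    rw [← ht' V]
    rfl

/-- The projection of the restriction of the glued sheaf to `U i` onto `P i`. -/
def toLocal (i : Λ) : D.glued.restrict (le_top : U i ≤ ⊤) ⟶ D.P i :=
  SuperPresheaf.mkHom (fun V => D.eval i le_rfl V.2) fun {_ W} h s =>
    (res_eval (V := W.1) s i le_rfl W.2 h).symm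

/-- The inverse of the projection of the restriction of the glued sheaf to `U i` onto `P i`. -/
def ofLocal (i : Λ) : D.P i ⟶ D.glued.restrict (le_top : U i ≤ ⊤) :=
  SuperPresheaf.mkHom
    (fun V => D.liftSections (fun k O hV hk => D.trans k i hk (hV.trans V.2) ∘ₗ
        (D.P i).res (V := ⟨O, hV.trans V.2⟩) hV)
      (fun k O O' hV hk h x => (D.trans_res h k i hk (hV.trans V.2) _).symm.trans
        (congrArg (D.trans k i (h.trans hk) ((h.trans hV).trans V.2))
          ((D.P i).res_res (V := ⟨O', (h.trans hV).trans V.2⟩) (V' := ⟨O, hV.trans V.2⟩)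
            (W := V) h hV x)))
      (fun k m O hV hk hm x => by
        rw [LinearMap.comp_apply, LinearMap.comp_apply, trans_trans]))
    fun {V W} h x => sections_ext fun k O hV hk =>
      congrArg (D.trans k i hk (hV.trans V.2))
        ((D.P i).res_res (V := ⟨O, hV.trans V.2⟩) hV h x)

theorem toLocal_ofLocal (i : Λ) : D.ofLocal i ≫ D.toLocal i = 𝟙 _ :=
  SuperPresheaf.hom_ext fun V x =>
    (D.trans_self i V.2 V.2 _).trans ((D.P i).res_self (V := V) le_rfl x)

theorem ofLocal_toLocal (i : Λ) : D.toLocal i ≫ D.ofLocal i = 𝟙 _ :=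
  SuperPresheaf.hom_ext fun V s => sections_ext fun k O hV hk => by
    change D.trans k i hk _ ((D.P i).res _ (D.eval i le_rfl V.2 s)) = D.eval k hV hk s
    exact (congrArg _ (res_eval (V := V.1) s i le_rfl V.2 hV)).trans
      (trans_eval s k i hV hk _)

theorem toLocal_even (i : Λ) : SuperPresheaf.IsEven (D.toLocal i) :=
  fun V _ _ hs => (D.mem_sectionsParity).1 hs i V.1 le_rfl V.2

theorem ofLocal_even (i : Λ) : SuperPresheaf.IsEven (D.ofLocal i) :=
  fun V _ _ hx => (D.mem_sectionsParity).2 fun k _ hO hk =>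
    D.trans_mem k i hk (hO.trans V.2) ((D.P i).res_mem hO hx)

end SheafDatum

end SheafGluing

/-! ### Parity of representatives, and relations on inductive limits -/

section Parity

variable {K : Type} [Field K] {X : Type u} [TopologicalSpace X] {U : Opens X}
  {A : Type u} [SmallCategory A]

/-- All transition maps of the inductive system are even. -/
def EvenSystem (F : A ⥤ SuperPresheaf K U) : Prop :=
  ∀ ⦃α α' : A⦄ (f : α ⟶ α'), SuperPresheaf.IsEven (F.map f)

/-- The parity of a representative can be read off from any other representative. -/
theorem Lim.mem_parity_of_ι_eq [IsFiltered A] {F : A ⥤ SuperPresheaf K U}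
    (hF : InjectiveSystem F) (hF' : EvenSystem F) {V : Set.Iic U} {α β : A} {p : ZMod 2}
    {s : (F.obj α).carrier.obj (op V)} {t : (F.obj β).carrier.obj (op V)}
    (ht : t ∈ (F.obj β).parity V p) (h : Lim.ι F V α s = Lim.ι F V β t) :
    s ∈ (F.obj α).parity V p := by
  rw [← Lim.ι_map F V (IsFiltered.leftToMax α β), ← Lim.ι_map F V (IsFiltered.rightToMax α β)] at h
  refine mem_of_isInternal_of_injective ((F.obj α).isInternal V)
    ((F.obj (IsFiltered.max α β)).isInternal V) (hF (IsFiltered.leftToMax α β) V)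
    (hF' (IsFiltered.leftToMax α β) V) ?_
  rw [Lim.ι_injective hF V _ h]
  exact hF' _ V p t ht

/-- Every representative of an even class is even. -/
theorem SuperPresheaf.isEven_of_mk_eq [IsFiltered A] {P : SuperPresheaf K U}
    {F : A ⥤ SuperPresheaf K U} (hF : InjectiveSystem F) (hF' : EvenSystem F) {α β : A}
    {f : P ⟶ F.obj α} {g : P ⟶ F.obj β} (hg : IsEven g)
    (h : HomGerm.mk F α f = HomGerm.mk F β g) : IsEven f := fun V p x hx =>
  Lim.mem_parity_of_ι_eq hF hF' (hg V p x hx)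
    (LinearMap.congr_fun (congrArg (fun z => HomGerm.lim z V) h) x)

theorem Bilin.isEven_of_mk_eq [IsFiltered A] {P Q : SuperPresheaf K U}
    {F : A ⥤ SuperPresheaf K U} (hF : InjectiveSystem F) (hF' : EvenSystem F) {α β : A}
    {b : Bilin P Q (F.obj α)} {c : Bilin P Q (F.obj β)} (hc : c.IsEven)
    (h : BilinGerm.mk F α b = BilinGerm.mk F β c) : b.IsEven := fun V p q x y hx hy =>
  Lim.mem_parity_of_ι_eq hF hF' (hc V p q x y hx hy)
    (LinearMap.congr_fun₂ (congrArg (fun z => BilinGerm.lim z V) h) x y)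

theorem IndHom.IsEven.of_app_eq [IsFiltered A] {B : Type u} [SmallCategory B]
    {F : B ⥤ SuperPresheaf K U} {G : A ⥤ SuperPresheaf K U} (hG : InjectiveSystem G)
    (hG' : EvenSystem G) {Φ : IndHom F G} (hΦ : Φ.IsEven) {β : B} {α : A} {f : F.obj β ⟶ G.obj α}
    (h : Φ.app β = HomGerm.mk G α f) : SuperPresheaf.IsEven f := by
  obtain ⟨γ, g, hg, e⟩ := hΦ β
  exact SuperPresheaf.isEven_of_mk_eq hG hG' hg (h.symm.trans e)

theorem IndBilin.IsEven.of_app_eq [IsFiltered A] {B C : Type u} [SmallCategory B]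
    [SmallCategory C] {F : B ⥤ SuperPresheaf K U} {F' : C ⥤ SuperPresheaf K U}
    {G : A ⥤ SuperPresheaf K U} (hG : InjectiveSystem G)
    (hG' : EvenSystem G) {b : IndBilin F F' G} (hb : b.IsEven) {β : B} {γ : C} {α : A}
    {c : Bilin (F.obj β) (F'.obj γ) (G.obj α)}
    (h : b.app β γ = BilinGerm.mk G α c) : c.IsEven := by
  obtain ⟨δ, d, hd, e⟩ := hb β γ
  exact Bilin.isEven_of_mk_eq hG hG' hd (h.symm.trans e)

theorem VSAIndSheaf.injectiveSystem (𝒱 : VSAIndSheaf K A U) : InjectiveSystem 𝒱.sys :=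
  fun _ _ f V => 𝒱.map_injective f V

theorem VSAIndSheaf.evenSystem (𝒱 : VSAIndSheaf K A U) : EvenSystem 𝒱.sys :=
  fun _ _ f => 𝒱.map_even f

/-- The constant section `c` of the limit of `constSystem K U`. -/
noncomputable def constElt (c : K) (V : Set.Iic U) : Lim (constSystem K U) V :=
  Lim.ι (constSystem K U) V ⟨PUnit.unit⟩ (ULift.up c : ULift.{u} K)

theorem IndHom.lim_constElt_of_eq {F : A ⥤ SuperPresheaf K U} {Φ : IndHom (constSystem K U) F}
    {α : A} {v : constPresheaf K U ⟶ F.obj α} (h : Φ.app ⟨PUnit.unit⟩ = HomGerm.mk F α v) (c : K)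
    (V : Set.Iic U) : Φ.lim V (constElt c V) =
      Lim.ι F V α (SuperPresheaf.onOpen v V (ULift.up c : ULift.{u} K)) :=
  IndHom.lim_ι_of_eq h V _

theorem Lim.const_hom_ext {V : Set.Iic U} {M : Type u} [AddCommGroup M] [Module K M]
    {f g : Lim (constSystem K U) V →ₗ[K] M} (h : ∀ c, f (constElt c V) = g (constElt c V)) :
    f = g :=
  Lim.hom_ext fun _ x => h (ULift.down (α := K) x)

/-- The relation `H (a_(n) b) + (n + 1) a_(n) b = a_(n) (H b) + (H a)_(n) b` on the inductive
limits. -/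
theorem IsHamiltonian.lim_prod [IsFiltered A] {𝒱 : VSAIndSheaf K A U} {H : IndHom 𝒱.sys 𝒱.sys}
    {h : ∀ α, 𝒱.sys.obj α ⟶ 𝒱.sys.obj α} (hH : IsHamiltonian 𝒱 H h) (n : ℤ) (V : Set.Iic U)
    (x y : Lim 𝒱.sys V) :
    (𝒱.prod n).lim V x (H.lim V y) +
      (𝒱.prod n).lim V (H.lim V x) y =
    H.lim V ((𝒱.prod n).lim V x y) +
      (n + 1) • (𝒱.prod n).lim V x y := by
  obtain ⟨α, x, rfl⟩ := Lim.exists_rep _ _ x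
  obtain ⟨α', y, rfl⟩ := Lim.exists_rep _ _ y
  obtain ⟨γ, b, hb, e⟩ := hH.prod n α α'
  rw [IndHom.lim_ι_of_eq (hH.app_eq _), IndHom.lim_ι_of_eq (hH.app_eq _),
    IndBilin.lim_ι_of_eq hb, IndBilin.lim_ι_of_eq hb, IndBilin.lim_ι_of_eq hb,
    IndHom.lim_ι_of_eq (hH.app_eq _), ← map_zsmul, ← map_add, ← map_add]
  exact LinearMap.congr_fun₂ (congrArg (fun z => BilinGerm.lim z V) e) x y

theorem IsDegreeOperator.lim_prod [IsFiltered A] {𝒱 : VSAIndSheaf K A U} {J : IndHom 𝒱.sys 𝒱.sys}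
    {j : ∀ α, 𝒱.sys.obj α ⟶ 𝒱.sys.obj α} (hJ : IsDegreeOperator 𝒱 J j) (n : ℤ) (V : Set.Iic U)
    (x y : Lim 𝒱.sys V) :
    (𝒱.prod n).lim V x (J.lim V y) +
      (𝒱.prod n).lim V (J.lim V x) y =
    J.lim V ((𝒱.prod n).lim V x y) := by
  obtain ⟨α, x, rfl⟩ := Lim.exists_rep _ _ x
  obtain ⟨α', y, rfl⟩ := Lim.exists_rep _ _ y
  obtain ⟨γ, b, hb, e⟩ := hJ.prod n α α'
  rw [IndHom.lim_ι_of_eq (hJ.app_eq _), IndHom.lim_ι_of_eq (hJ.app_eq _),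
    IndBilin.lim_ι_of_eq hb, IndBilin.lim_ι_of_eq hb, IndBilin.lim_ι_of_eq hb,
    IndHom.lim_ι_of_eq (hJ.app_eq _), ← map_add]
  exact LinearMap.congr_fun₂ (congrArg (fun z => BilinGerm.lim z V) e) x y

end Parity

/-! ### The inductive system of glued sheaves -/

section Glue

variable {K : Type} [Field K] {X : Type u} [TopologicalSpace X] {Λ : Type u} {U : Λ → Opens X}

namespace SheafDatum

variable {D D' D'' : SheafDatum K U}

/-- The morphism of glued sheaves given by a compatible family of morphisms. -/
def mapGlued (f : ∀ i, D.P i ⟶ D'.P i)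
    (hf : ∀ i k (O : Opens X) (hi : O ≤ U i) (hk : O ≤ U k) x,
      D'.trans i k hi hk (SuperPresheaf.onOpen (f k) ⟨O, hk⟩ x) =
        SuperPresheaf.onOpen (f i) ⟨O, hi⟩ (D.trans i k hi hk x)) : D.glued ⟶ D'.glued :=
  SuperPresheaf.mkHom
    (fun V => D'.liftSections (fun i O hV hi =>
        SuperPresheaf.onOpen (f i) ⟨O, hi⟩ ∘ₗ D.eval i (V := V.1) hV hi)
      (fun i O O' hV hi h s => (SuperPresheaf.onOpen_res (f i) (V := ⟨O', h.trans hi⟩)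
        (W := ⟨O, hi⟩) h _).symm.trans (congrArg (SuperPresheaf.onOpen (f i) ⟨O', h.trans hi⟩)
          (res_eval (V := V.1) s i hV hi h)))
      (fun i k O hV hi hk s => (hf i k O hi hk _).trans
        (congrArg (SuperPresheaf.onOpen (f i) ⟨O, hi⟩) (trans_eval (V := V.1) s i k hV hi hk))))
    (fun _ _ => rfl)

theorem eval_mapGlued (f : ∀ i, D.P i ⟶ D'.P i) (hf) {V : Set.Iic (⊤ : Opens X)} {O : Opens X}
    (i : Λ) (hV : O ≤ V.1) (hi : O ≤ U i) (s : D.sections V.1) :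
    D'.eval i hV hi (SuperPresheaf.onOpen (mapGlued f hf) V s) =
      SuperPresheaf.onOpen (f i) ⟨O, hi⟩ (D.eval i hV hi s) := rfl

theorem mapGlued_even {f : ∀ i, D.P i ⟶ D'.P i} (hf) (h : ∀ i, SuperPresheaf.IsEven (f i)) :
    SuperPresheaf.IsEven (mapGlued f hf) := fun _ p _ hs =>
  (D'.mem_sectionsParity).2 fun i _ hV hi => h i _ p _ ((D.mem_sectionsParity).1 hs i _ hV hi)

/-- The bilinear map on the sections of glued sheaves given by a compatible family of bilinear
morphisms. -/
def bilinSections (b : ∀ i, Bilin (D.P i) (D'.P i) (D''.P i))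
    (hb : ∀ i k (O : Opens X) (hi : O ≤ U i) (hk : O ≤ U k) x y,
      D''.trans i k hi hk ((b k).app ⟨O, hk⟩ x y) =
        (b i).app ⟨O, hi⟩ (D.trans i k hi hk x) (D'.trans i k hi hk y)) (V : Opens X) :
    D.sections V →ₗ[K] D'.sections V →ₗ[K] D''.sections V :=
  LinearMap.mk₂ K (fun s t =>
      D''.mkSection (fun i O hV hi => (b i).app ⟨O, hi⟩ (D.eval i hV hi s) (D'.eval i hV hi t))
        (fun i O O' hV hi h =>
          ((b i).naturality (V := ⟨O', h.trans hi⟩) (W := ⟨O, hi⟩) h _ _).symm.trans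
            (congrArg₂ (fun x y => (b i).app ⟨O', h.trans hi⟩ x y) (res_eval s i hV hi h)
              (res_eval t i hV hi h)))
        (fun i k O hV hi hk => (hb i k O hi hk _ _).trans
          (congrArg₂ (fun x y => (b i).app ⟨O, hi⟩ x y) (trans_eval s i k hV hi hk)
            (trans_eval t i k hV hi hk))))
    (fun s s' t => sections_ext fun i O hV hi => by
      simp only [map_add, eval_mkSection, LinearMap.add_apply])
    (fun c s t => sections_ext fun i O hV hi => by
      simp only [map_smul, eval_mkSection, LinearMap.smul_apply])
    (fun s t t' => sections_ext fun i O hV hi => by simp only [map_add, eval_mkSection])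
    (fun c s t => sections_ext fun i O hV hi => by simp only [map_smul, eval_mkSection])

/-- The bilinear morphism of glued sheaves given by a compatible family of bilinear morphisms. -/
def bilinGlued (b : ∀ i, Bilin (D.P i) (D'.P i) (D''.P i))
    (hb : ∀ i k (O : Opens X) (hi : O ≤ U i) (hk : O ≤ U k) x y,
      D''.trans i k hi hk ((b k).app ⟨O, hk⟩ x y) =
        (b i).app ⟨O, hi⟩ (D.trans i k hi hk x) (D'.trans i k hi hk y)) :
    Bilin D.glued D'.glued D''.glued where
  app V := bilinSections b hb V.1
  naturality _ _ _ := rfl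

theorem bilinGlued_even {b : ∀ i, Bilin (D.P i) (D'.P i) (D''.P i)} (hb)
    (h : ∀ i, (b i).IsEven) : (bilinGlued b hb).IsEven := fun _ p q _ _ hs ht =>
  (D''.mem_sectionsParity).2 fun i _ hV hi => h i _ p q _ _
    ((D.mem_sectionsParity).1 hs i _ hV hi) ((D'.mem_sectionsParity).1 ht i _ hV hi)

end SheafDatum

variable {A : Type u} [SmallCategory A]

namespace GluingDatum

variable (D : GluingDatum K A U)

/-- The maps induced by the isomorphisms `θ` on the inductive limits. -/
noncomputable def limTrans {O : Opens X} (i k : Λ) (hi : O ≤ U i) (hk : O ≤ U k) :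
    Lim (D.𝒱 k).sys ⟨O, hk⟩ →ₗ[K] Lim (D.𝒱 i).sys ⟨O, hi⟩ :=
  (D.θ i k).hom.lim ⟨O, le_inf hi hk⟩

theorem limTrans_self {O : Opens X} (i : Λ) (hi hi' : O ≤ U i) (x : Lim (D.𝒱 i).sys ⟨O, hi⟩) :
    D.limTrans i i hi' hi x = x := by
  change (D.θ i i).hom.lim ⟨O, le_inf hi hi⟩ x = x
  rw [D.θ_self]
  exact IndHom.lim_id _ _ _

theorem limTrans_limTrans {O : Opens X} (i k m : Λ) (hi : O ≤ U i) (hk : O ≤ U k) (hm : O ≤ U m)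
    (x : Lim (D.𝒱 m).sys ⟨O, hm⟩) :
    D.limTrans i k hi hk (D.limTrans k m hk hm x) = D.limTrans i m hi hm x := by
  have e := LinearMap.congr_fun
    (congrArg (fun Φ => IndHom.lim Φ ⟨O, le_inf (le_inf hi hk) hm⟩) (D.θ_comp i k m)) x
  have h1 := IndHom.lim_comp
    ((D.θ i k).hom.restrictTo (F := (D.𝒱 k).sys) (G := (D.𝒱 i).sys)
        (inf_le_left : U i ⊓ U k ⊓ U m ≤ U i ⊓ U k))
    ((D.θ k m).hom.restrictTo (F := (D.𝒱 m).sys) (G := (D.𝒱 k).sys)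
        (le_inf (inf_le_left.trans inf_le_right) inf_le_right : U i ⊓ U k ⊓ U m ≤ U k ⊓ U m))
    ⟨O, le_inf (le_inf hi hk) hm⟩ x
  have r1 := fun y => LinearMap.congr_fun (IndHom.lim_restrict (D.θ i k).hom
    (inf_le_left : U i ⊓ U k ⊓ U m ≤ U i ⊓ U k) ⟨O, le_inf (le_inf hi hk) hm⟩) y
  have r2 := LinearMap.congr_fun (IndHom.lim_restrict (D.θ k m).hom
    (le_inf (inf_le_left.trans inf_le_right) inf_le_right : U i ⊓ U k ⊓ U m ≤ U k ⊓ U m)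
    ⟨O, le_inf (le_inf hi hk) hm⟩) x
  have r3 := LinearMap.congr_fun (IndHom.lim_restrict (D.θ i m).hom
    (le_inf (inf_le_left.trans inf_le_left) inf_le_right : U i ⊓ U k ⊓ U m ≤ U i ⊓ U m)
    ⟨O, le_inf (le_inf hi hk) hm⟩) x
  exact (congrArg (D.limTrans i k hi hk) r2.symm).trans ((r1 _).symm.trans
    ((h1.symm.trans e).trans r3))

/-- Morphisms compatible with the isomorphisms `θ` of two gluing data commute with the maps which
these induce on inductive limits. -/
theorem limTrans_comm {D D' : GluingDatum K A U} {Φ : ∀ i, IndHom (D.𝒱 i).sys (D'.𝒱 i).sys}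
    (hΦ : ∀ i k, (D'.θ i k).hom.comp ((Φ k).restrict inf_le_right) =
      ((Φ i).restrict inf_le_left).comp (D.θ i k).hom) {O : Opens X} (i k : Λ) (hi : O ≤ U i)
    (hk : O ≤ U k) (x : Lim (D.𝒱 k).sys ⟨O, hk⟩) :
    D'.limTrans i k hi hk ((Φ k).lim ⟨O, hk⟩ x) = (Φ i).lim ⟨O, hi⟩ (D.limTrans i k hi hk x) := by
  have h := LinearMap.congr_fun (congrArg (fun Φ => IndHom.lim Φ ⟨O, le_inf hi hk⟩) (hΦ i k)) x
  have h' := ((IndHom.lim_comp _ _ _ _).symm.trans h).trans (IndHom.lim_comp _ _ _ _)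
  have r1 := LinearMap.congr_fun (IndHom.lim_restrict (Φ k)
    (inf_le_right : U i ⊓ U k ≤ U k) ⟨O, le_inf hi hk⟩) x
  have r2 := fun y => LinearMap.congr_fun (IndHom.lim_restrict (Φ i)
    (inf_le_left : U i ⊓ U k ≤ U i) ⟨O, le_inf hi hk⟩) y
  exact (congrArg (D'.limTrans i k hi hk) r1.symm).trans (h'.trans (r2 _))

theorem limTrans_T (i k : Λ) (O : Opens X) (hi : O ≤ U i) (hk : O ≤ U k)
    (x : Lim (D.𝒱 k).sys ⟨O, hk⟩) : D.limTrans i k hi hk ((D.𝒱 k).T.lim ⟨O, hk⟩ x) =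
      (D.𝒱 i).T.lim ⟨O, hi⟩ (D.limTrans i k hi hk x) :=
  limTrans_comm (fun i k => (D.θ i k).hom_isStrictMorphism.isVSAMorphism.T) i k hi hk x

theorem limTrans_H (i k : Λ) (O : Opens X) (hi : O ≤ U i) (hk : O ≤ U k)
    (x : Lim (D.𝒱 k).sys ⟨O, hk⟩) : D.limTrans i k hi hk ((D.𝒱 k).H.lim ⟨O, hk⟩ x) =
      (D.𝒱 i).H.lim ⟨O, hi⟩ (D.limTrans i k hi hk x) :=
  limTrans_comm (fun i k => (D.θ i k).hom_isStrictMorphism.preservesGrading.comm_H) i k hi hk x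

theorem limTrans_J (i k : Λ) (O : Opens X) (hi : O ≤ U i) (hk : O ≤ U k)
    (x : Lim (D.𝒱 k).sys ⟨O, hk⟩) : D.limTrans i k hi hk ((D.𝒱 k).J.lim ⟨O, hk⟩ x) =
      (D.𝒱 i).J.lim ⟨O, hi⟩ (D.limTrans i k hi hk x) :=
  limTrans_comm (fun i k => (D.θ i k).hom_isStrictMorphism.preservesGrading.comm_J) i k hi hk x

theorem limTrans_vac {O : Opens X} (i k : Λ) (hi : O ≤ U i) (hk : O ≤ U k) (c : K) :
    D.limTrans i k hi hk ((D.𝒱 k).vac.lim ⟨O, hk⟩ (constElt c ⟨O, hk⟩)) =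
      (D.𝒱 i).vac.lim ⟨O, hi⟩ (constElt c ⟨O, hi⟩) := by
  have h := LinearMap.congr_fun (congrArg (fun Φ => IndHom.lim Φ ⟨O, le_inf hi hk⟩)
    (D.θ i k).hom_isStrictMorphism.isVSAMorphism.vac) (constElt c ⟨O, le_inf hi hk⟩)
  have h' := (IndHom.lim_comp _ _ _ _).symm.trans h
  have r1 := LinearMap.congr_fun (IndHom.lim_restrict (D.𝒱 k).vac
    (inf_le_right : U i ⊓ U k ≤ U k) ⟨O, le_inf hi hk⟩) (constElt c ⟨O, le_inf hi hk⟩)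
  have r2 := LinearMap.congr_fun (IndHom.lim_restrict (D.𝒱 i).vac
    (inf_le_left : U i ⊓ U k ≤ U i) ⟨O, le_inf hi hk⟩) (constElt c ⟨O, le_inf hi hk⟩)
  exact (congrArg (D.limTrans i k hi hk) r1.symm).trans (h'.trans r2)

theorem limTrans_prod (n : ℤ) {O : Opens X} (i k : Λ) (hi : O ≤ U i)
    (hk : O ≤ U k) (x y : Lim (D.𝒱 k).sys ⟨O, hk⟩) :
    D.limTrans i k hi hk (((D.𝒱 k).prod n).lim ⟨O, hk⟩ x y) =
      ((D.𝒱 i).prod n).lim ⟨O, hi⟩ (D.limTrans i k hi hk x) (D.limTrans i k hi hk y) := by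
  have h := LinearMap.congr_fun₂ (congrArg (fun Φ => IndBilin.lim Φ ⟨O, le_inf hi hk⟩)
    ((D.θ i k).hom_isStrictMorphism.isVSAMorphism.prod n)) x y
  have h' := ((IndHom.lim_compBilin _ _ _ _ _).symm.trans h).trans
    (IndBilin.lim_compProd _ _ _ _ _ _)
  have r1 := LinearMap.congr_fun₂ (IndBilin.lim_restrict ((D.𝒱 k).prod n)
    (inf_le_right : U i ⊓ U k ≤ U k) ⟨O, le_inf hi hk⟩) x y
  have r2 := fun x y => LinearMap.congr_fun₂ (IndBilin.lim_restrict ((D.𝒱 i).prod n)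
    (inf_le_left : U i ⊓ U k ≤ U i) ⟨O, le_inf hi hk⟩) x y
  exact (congrArg (D.limTrans i k hi hk) r1.symm).trans (h'.trans (r2 _ _))

/-- The representatives of the components of the isomorphisms `θ`. -/
noncomputable def θrep (i k : Λ) (α : A) :
    ((D.𝒱 k).sys.obj α).restrict (inf_le_right : U i ⊓ U k ≤ U k) ⟶
      ((D.𝒱 i).sys.obj α).restrict (inf_le_left : U i ⊓ U k ≤ U i) :=
  (D.θ i k).hom_isStrictMorphism.isStrict.choose α

theorem θ_app (i k : Λ) (α : A) :
    (D.θ i k).hom.app α = HomGerm.mk (resSys (D.𝒱 i).sys inf_le_left) α (D.θrep i k α) :=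
  (D.θ i k).hom_isStrictMorphism.isStrict.choose_spec α

theorem ι_onOpen_θrep {O : Opens X} (i k : Λ) (hi : O ≤ U i) (hk : O ≤ U k) (α : A)
    (x : ((D.𝒱 k).sys.obj α).carrier.obj (op ⟨O, hk⟩)) :
    Lim.ι (D.𝒱 i).sys ⟨O, hi⟩ α (SuperPresheaf.onOpen (D.θrep i k α) ⟨O, le_inf hi hk⟩ x) =
      D.limTrans i k hi hk (Lim.ι (D.𝒱 k).sys ⟨O, hk⟩ α x) :=
  (IndHom.lim_ι_of_eq (D.θ_app i k α) ⟨O, le_inf hi hk⟩ x).symm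

variable [IsFiltered A]

/-- The sheaves with index `α` and the representatives of the isomorphisms between them. -/
noncomputable abbrev sheafDatum (α : A) : SheafDatum K U where
  P i := (D.𝒱 i).sys.obj α
  isSheaf i := (D.𝒱 i).isSheaf α
  φ i k := D.θrep i k α
  φ_even i k := (D.θ i k).hom_isStrictMorphism.isVSAMorphism.even.of_app_eq
    ((D.𝒱 i).injectiveSystem.restrict _)
    (((D.𝒱 i).restrict inf_le_left).toVSAIndSheaf.evenSystem) (D.θ_app i k α)
  φ_self i V x :=
    have hV : V.1 ≤ U i := le_trans V.2 inf_le_left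
    Lim.ι_injective (D.𝒱 i).injectiveSystem ⟨V.1, hV⟩ α
      ((D.ι_onOpen_θrep i i hV hV α x).trans (D.limTrans_self i hV hV _))
  φ_comp i k m O hi hk hm x := Lim.ι_injective (D.𝒱 i).injectiveSystem ⟨O, hi⟩ α <| by
    rw [D.ι_onOpen_θrep i m hi hm, ← D.limTrans_limTrans i k m hi hk hm,
      ← D.ι_onOpen_θrep k m hk hm]
    exact D.ι_onOpen_θrep i k hi hk α _

theorem ι_trans {O : Opens X} (i k : Λ) (hi : O ≤ U i) (hk : O ≤ U k) (α : A)
    (x : ((D.𝒱 k).sys.obj α).carrier.obj (op ⟨O, hk⟩)) :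
    Lim.ι (D.𝒱 i).sys ⟨O, hi⟩ α ((D.sheafDatum α).trans i k hi hk x) =
      D.limTrans i k hi hk (Lim.ι (D.𝒱 k).sys ⟨O, hk⟩ α x) :=
  D.ι_onOpen_θrep i k hi hk α x

/-- Representatives of morphisms compatible with the isomorphisms on the overlaps are compatible
with them. -/
theorem trans_onOpen {Φ : ∀ i, IndHom (D.𝒱 i).sys (D.𝒱 i).sys}
    (hΦ : ∀ i k (O : Opens X) (hi : O ≤ U i) (hk : O ≤ U k) x,
      D.limTrans i k hi hk ((Φ k).lim ⟨O, hk⟩ x) = (Φ i).lim ⟨O, hi⟩ (D.limTrans i k hi hk x))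
    {α β : A} {f : ∀ i, (D.𝒱 i).sys.obj α ⟶ (D.𝒱 i).sys.obj β}
    (hf : ∀ i, (Φ i).app α = HomGerm.mk (D.𝒱 i).sys β (f i))
    (i k : Λ) (O : Opens X) (hi : O ≤ U i) (hk : O ≤ U k)
    (x : ((D.𝒱 k).sys.obj α).carrier.obj (op ⟨O, hk⟩)) :
    (D.sheafDatum β).trans i k hi hk (SuperPresheaf.onOpen (f k) ⟨O, hk⟩ x) =
      SuperPresheaf.onOpen (f i) ⟨O, hi⟩ ((D.sheafDatum α).trans i k hi hk x) :=
  Lim.ι_injective (D.𝒱 i).injectiveSystem ⟨O, hi⟩ β <| by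
    rw [ι_trans, ← IndHom.lim_ι_of_eq (hf k), ← IndHom.lim_ι_of_eq (hf i), ι_trans, hΦ]

theorem trans_map {α β : A} (f : α ⟶ β) (i k : Λ) (O : Opens X) (hi : O ≤ U i) (hk : O ≤ U k)
    (x : ((D.𝒱 k).sys.obj α).carrier.obj (op ⟨O, hk⟩)) :
    (D.sheafDatum β).trans i k hi hk (SuperPresheaf.onOpen ((D.𝒱 k).sys.map f) ⟨O, hk⟩ x) =
      SuperPresheaf.onOpen ((D.𝒱 i).sys.map f) ⟨O, hi⟩ ((D.sheafDatum α).trans i k hi hk x) :=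
  Lim.ι_injective (D.𝒱 i).injectiveSystem ⟨O, hi⟩ β <| by
    rw [ι_trans, Lim.ι_map, Lim.ι_map, ι_trans]

/-- The inductive system of the glued sheaves. -/
noncomputable def gluedSys : A ⥤ SuperPresheaf K (⊤ : Opens X) where
  obj α := (D.sheafDatum α).glued
  map f := SheafDatum.mapGlued (D := D.sheafDatum _) (D' := D.sheafDatum _)
    (fun i => (D.𝒱 i).sys.map f) (D.trans_map f)
  map_id α := SuperPresheaf.hom_ext fun V s => SheafDatum.sections_ext fun i O hV hi => by
    refine (SheafDatum.eval_mapGlued _ (D.trans_map (𝟙 α)) i hV hi s).trans ?_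
    rw [(D.𝒱 i).sys.map_id]
    rfl
  map_comp f g := SuperPresheaf.hom_ext fun V s => SheafDatum.sections_ext fun i O hV hi => by
    refine (SheafDatum.eval_mapGlued _ (D.trans_map (f ≫ g)) i hV hi s).trans ?_
    rw [(D.𝒱 i).sys.map_comp]
    rfl

theorem gluedSys_injective : InjectiveSystem D.gluedSys := fun _ β f V _ _ hst =>
  SheafDatum.sections_ext fun i O hV hi => (D.𝒱 i).map_injective f ⟨O, hi⟩
    (congrArg ((D.sheafDatum β).eval (V := V.1) i hV hi) hst)

theorem gluedSys_even : EvenSystem D.gluedSys := fun _ _ f =>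
  SheafDatum.mapGlued_even (D.trans_map f) fun i => (D.𝒱 i).map_even f

/-- The component in `𝒱 i` of an element of the inductive limit of the glued system. -/
noncomputable def evalLim {V : Set.Iic (⊤ : Opens X)} {O : Opens X} (i : Λ) (hV : O ≤ V.1)
    (hi : O ≤ U i) : Lim D.gluedSys V →ₗ[K] Lim (D.𝒱 i).sys ⟨O, hi⟩ :=
  Lim.desc D.gluedSys V
    (fun α => Lim.ι (D.𝒱 i).sys ⟨O, hi⟩ α ∘ₗ (D.sheafDatum α).eval (V := V.1) i hV hi)
    (fun _ _ f _ => Lim.ι_map (D.𝒱 i).sys ⟨O, hi⟩ f _)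

theorem evalLim_ι {V : Set.Iic (⊤ : Opens X)} {O : Opens X} (i : Λ) (hV : O ≤ V.1)
    (hi : O ≤ U i) (α : A) (s : (D.gluedSys.obj α).carrier.obj (op V)) :
    D.evalLim i hV hi (Lim.ι D.gluedSys V α s) =
      Lim.ι (D.𝒱 i).sys ⟨O, hi⟩ α ((D.sheafDatum α).eval i hV hi s) :=
  Lim.desc_ι D.gluedSys V _ _ α s

/-- The maps `evalLim` are jointly injective, so that identities between elements of the inductive
limit of the glued system can be checked on the local sheaves. -/
theorem evalLim_eq_zero {V : Set.Iic (⊤ : Opens X)} {x : Lim D.gluedSys V}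
    (h : ∀ i (O : Opens X) (hV : O ≤ V.1) (hi : O ≤ U i), D.evalLim i hV hi x = 0) : x = 0 := by
  obtain ⟨α, s, rfl⟩ := Lim.exists_rep _ _ x
  have hs : s = 0 := SheafDatum.sections_ext (V := V.1) fun i O hV hi =>
    Lim.ι_injective (D.𝒱 i).injectiveSystem ⟨O, hi⟩ α
      ((D.evalLim_ι i hV hi α s).symm.trans ((h i O hV hi).trans
        (map_zero (Lim.ι (D.𝒱 i).sys ⟨O, hi⟩ α ∘ₗ (D.sheafDatum α).eval i hV hi)).symm))
  rw [hs, map_zero]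

theorem evalLim_ext {V : Set.Iic (⊤ : Opens X)} {x y : Lim D.gluedSys V}
    (h : ∀ i (O : Opens X) (hV : O ≤ V.1) (hi : O ≤ U i),
      D.evalLim i hV hi x = D.evalLim i hV hi y) : x = y :=
  sub_eq_zero.1 (D.evalLim_eq_zero fun i O hV hi => by rw [map_sub, h, sub_self])

theorem evalLim_mem {V : Set.Iic (⊤ : Opens X)} {O : Opens X} (i : Λ) (hV : O ≤ V.1)
    (hi : O ≤ U i) {p : ZMod 2} {x : Lim D.gluedSys V} (hx : x ∈ Lim.parity D.gluedSys V p) :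
    D.evalLim i hV hi x ∈ Lim.parity (D.𝒱 i).sys ⟨O, hi⟩ p := by
  have : Lim.parity D.gluedSys V p ≤
      (Lim.parity (D.𝒱 i).sys ⟨O, hi⟩ p).comap (D.evalLim i hV hi) := by
    refine iSup_le fun α => ?_
    rintro _ ⟨s, hs, rfl⟩
    rw [Submodule.mem_comap, evalLim_ι]
    exact Lim.ι_mem_parity _ _ ((D.sheafDatum α).mem_sectionsParity.1 hs i O hV hi)
  exact this hx

/-- The morphism of ind-objects given by a family of uniformly indexed morphisms which is
compatible with the isomorphisms on the overlaps. -/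
noncomputable def gluedHom (Φ : ∀ i, IndHom (D.𝒱 i).sys (D.𝒱 i).sys)
    (hΦ : ∀ i k (O : Opens X) (hi : O ≤ U i) (hk : O ≤ U k) x,
      D.limTrans i k hi hk ((Φ k).lim ⟨O, hk⟩ x) = (Φ i).lim ⟨O, hi⟩ (D.limTrans i k hi hk x))
    (j : A → A) (f : ∀ i α, (D.𝒱 i).sys.obj α ⟶ (D.𝒱 i).sys.obj (j α))
    (hf : ∀ i α, (Φ i).app α = HomGerm.mk (D.𝒱 i).sys (j α) (f i α)) :
    IndHom D.gluedSys D.gluedSys :=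
  IndHom.ofLim D.gluedSys_injective
    (fun α => HomGerm.mk D.gluedSys (j α) (SheafDatum.mapGlued (D := D.sheafDatum α)
      (D' := D.sheafDatum (j α)) (fun i => f i α) (D.trans_onOpen hΦ fun i => hf i α)))
    (fun {α α'} k V s => D.evalLim_ext fun i O hV hi => by
      have e : ∀ α (s : (D.gluedSys.obj α).carrier.obj (op V)), D.evalLim i hV hi
          (Lim.ι D.gluedSys V (j α) (SuperPresheaf.onOpen (SheafDatum.mapGlued
            (D := D.sheafDatum α) (D' := D.sheafDatum (j α)) (fun i => f i α)
            (D.trans_onOpen hΦ fun i => hf i α)) V s)) =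
          (Φ i).lim ⟨O, hi⟩ (D.evalLim i hV hi (Lim.ι D.gluedSys V α s)) := fun α s => by
        refine (D.evalLim_ι i hV hi (j α) _).trans ?_
        rw [evalLim_ι, IndHom.lim_ι_of_eq (hf i α)]
        rfl
      refine (e α' _).trans (Eq.trans ?_ (e α s).symm)
      rw [← Lim.ι_map D.gluedSys V k])

theorem evalLim_gluedHom (Φ : ∀ i, IndHom (D.𝒱 i).sys (D.𝒱 i).sys) (hΦ) (j : A → A)
    (f : ∀ i α, (D.𝒱 i).sys.obj α ⟶ (D.𝒱 i).sys.obj (j α)) (hf)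
    {V : Set.Iic (⊤ : Opens X)} {O : Opens X} (i : Λ) (hV : O ≤ V.1) (hi : O ≤ U i)
    (x : Lim D.gluedSys V) :
    D.evalLim i hV hi ((D.gluedHom Φ hΦ j f hf).lim V x) =
      (Φ i).lim ⟨O, hi⟩ (D.evalLim i hV hi x) := by
  obtain ⟨α, s, rfl⟩ := Lim.exists_rep _ _ x
  rw [IndHom.lim_ι]
  refine (D.evalLim_ι i hV hi (j α) _).trans ?_
  refine Eq.trans ?_ (congrArg ((Φ i).lim ⟨O, hi⟩) (D.evalLim_ι i hV hi α s).symm)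
  rw [IndHom.lim_ι_of_eq (hf i α)]
  rfl

end GluingDatum

end Glue

/-! ### Weights and pole orders -/

section Lemmas

variable {K : Type} [Field K] {X : Type u} [TopologicalSpace X] {U : Opens X}
  {A B C : Type u} [SmallCategory A] [SmallCategory B] [SmallCategory C]

theorem IndHom.IsEven.lim_mem {F : A ⥤ SuperPresheaf K U} {G : B ⥤ SuperPresheaf K U}
    {Φ : IndHom F G} (hΦ : Φ.IsEven) {V : Set.Iic U} {p : ZMod 2} {x : Lim F V}
    (hx : x ∈ Lim.parity F V p) : Φ.lim V x ∈ Lim.parity G V p := by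
  have : Lim.parity F V p ≤ (Lim.parity G V p).comap (Φ.lim V) := by
    refine iSup_le fun α => ?_
    rintro _ ⟨s, hs, rfl⟩
    obtain ⟨β, f, hf, e⟩ := hΦ α
    rw [Submodule.mem_comap, IndHom.lim_ι_of_eq e]
    exact Lim.ι_mem_parity _ _ (hf V p s hs)
  exact this hx

theorem IndBilin.IsEven.lim_mem {F : A ⥤ SuperPresheaf K U} {G : B ⥤ SuperPresheaf K U}
    {H : C ⥤ SuperPresheaf K U} {b : IndBilin F G H} (hb : b.IsEven) {V : Set.Iic U}
    {p q : ZMod 2} {x : Lim F V} {y : Lim G V} (hx : x ∈ Lim.parity F V p)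
    (hy : y ∈ Lim.parity G V q) : b.lim V x y ∈ Lim.parity H V (p + q) := by
  have h : ∀ α, ∀ s ∈ (F.obj α).parity V p, Lim.parity G V q ≤
      (Lim.parity H V (p + q)).comap (b.lim V (Lim.ι F V α s)) := fun α s hs => by
    refine iSup_le fun β => ?_
    rintro _ ⟨t, ht, rfl⟩
    obtain ⟨γ, c, hc, e⟩ := hb α β
    rw [Submodule.mem_comap, IndBilin.lim_ι_of_eq e]
    exact Lim.ι_mem_parity _ _ (hc V p q s t hs ht)
  have : Lim.parity F V p ≤ (Lim.parity H V (p + q)).comap ((b.lim V).flip y) := by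
    refine iSup_le fun α => ?_
    rintro _ ⟨s, hs, rfl⟩
    exact h α s hs hy
  exact this hx

theorem constOne_mem (V : Set.Iic U) : constOne K V ∈ Lim.parity (constSystem K U) V 0 :=
  Lim.ι_mem_parity (constSystem K U) V (α := ⟨PUnit.unit⟩) (p := 0)
    (s := (ULift.up (1 : K) : ULift.{u} K))
    (show (ULift.up (1 : K) : ULift.{u} K) ∈ (if (0 : ZMod 2) = 0 then ⊤ else ⊥ :
      Submodule K (ULift.{u} K)) from by simp)

theorem Lim.iSup_parity [IsFiltered A] (F : A ⥤ SuperPresheaf K U) (V : Set.Iic U) :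
    ⨆ p, Lim.parity F V p = ⊤ := by
  refine (Submodule.eq_top_iff').2 fun x => ?_
  obtain ⟨α, s, rfl⟩ := Lim.exists_rep F V x
  have hs : s ∈ ⨆ p, (F.obj α).parity V p :=
    ((F.obj α).isInternal V).submodule_iSup_eq_top ▸ Submodule.mem_top
  have h : ⨆ p, (F.obj α).parity V p ≤ (⨆ p, Lim.parity F V p).comap (Lim.ι F V α) :=
    iSup_le fun p t ht => Submodule.mem_iSup_of_mem p (Lim.ι_mem_parity F V ht)
  exact h hs

theorem mem_bigraded {P : SuperPresheaf K U} {h j : P ⟶ P} {V : Set.Iic U} {n l : ℤ}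
    {x : P.carrier.obj (op V)} : x ∈ bigraded h j V n l ↔
      SuperPresheaf.onOpen h V x = (n : K) • x ∧ SuperPresheaf.onOpen j V x = (l : K) • x := by
  rw [bigraded, Submodule.mem_inf, Module.End.mem_eigenspace_iff, Module.End.mem_eigenspace_iff]

/-- The pole orders are bounded in terms of the bounds for the weights, because `a_(n) b` has
weight `p + q - n - 1` if `a` and `b` have weights `p` and `q`. -/
theorem DegWtVSAIndSheaf.prod_lim_eq_zero [IsFiltered A] (𝒱 : DegWtVSAIndSheaf K A U)
    {N : ℤ} {Nw L : A → ℕ} {V : Set.Iic U}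
    (hb : ∀ α, DirectSum.IsInternal
      (fun p : {p : ℤ × ℤ // N ≤ p.1 ∧ p.1 ≤ Nw α ∧ |p.2| ≤ L α} =>
        bigraded (𝒱.h α) (𝒱.j α) V p.1.1 p.1.2)) {n : ℤ} {α β : A}
    (hn : (Nw α : ℤ) + Nw β - N ≤ n) (x : (𝒱.sys.obj α).carrier.obj (op V))
    (y : (𝒱.sys.obj β).carrier.obj (op V)) :
    (𝒱.prod n).lim V (Lim.ι 𝒱.sys V α x) (Lim.ι 𝒱.sys V β y) = 0 := by
  obtain ⟨γ, b, e⟩ : ∃ γ b, (𝒱.prod n).app α β = BilinGerm.mk 𝒱.sys γ b := by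
    induction (𝒱.prod n).app α β using BilinGerm.ind with | _ γ b
    exact ⟨γ, b, rfl⟩
  rw [IndBilin.lim_ι_of_eq e]
  suffices hz : b.app V x y = 0 by rw [hz, map_zero]
  -- a product of homogeneous sections is homogeneous of a weight below the lower bound `N`, which
  -- also holds for the index `γ`
  have hhom : ∀ p : {p : ℤ × ℤ // N ≤ p.1 ∧ p.1 ≤ Nw α ∧ |p.2| ≤ L α},
      ∀ q : {p : ℤ × ℤ // N ≤ p.1 ∧ p.1 ≤ Nw β ∧ |p.2| ≤ L β},
      ∀ x ∈ bigraded (𝒱.h α) (𝒱.j α) V p.1.1 p.1.2,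
      ∀ y ∈ bigraded (𝒱.h β) (𝒱.j β) V q.1.1 q.1.2, b.app V x y = 0 := by
    intro p q x hx y hy
    rw [mem_bigraded] at hx hy
    have hH := 𝒱.isHamiltonian.lim_prod n V (Lim.ι _ _ _ x) (Lim.ι _ _ _ y)
    have hJ := 𝒱.isDegreeOperator.lim_prod n V (Lim.ι _ _ _ x) (Lim.ι _ _ _ y)
    rw [IndHom.lim_ι_of_eq (𝒱.isHamiltonian.app_eq _),
      IndHom.lim_ι_of_eq (𝒱.isHamiltonian.app_eq _), hx.1, hy.1,
      IndBilin.lim_ι_of_eq e, IndBilin.lim_ι_of_eq e, IndBilin.lim_ι_of_eq e,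
      IndHom.lim_ι_of_eq (𝒱.isHamiltonian.app_eq _), ← map_zsmul, ← map_add, ← map_add] at hH
    rw [IndHom.lim_ι_of_eq (𝒱.isDegreeOperator.app_eq _),
      IndHom.lim_ι_of_eq (𝒱.isDegreeOperator.app_eq _), hx.2, hy.2,
      IndBilin.lim_ι_of_eq e, IndBilin.lim_ι_of_eq e, IndBilin.lim_ι_of_eq e,
      IndHom.lim_ι_of_eq (𝒱.isDegreeOperator.app_eq _), ← map_add] at hJ
    have hH' := Lim.ι_injective 𝒱.injectiveSystem V γ hH
    have hJ' := Lim.ι_injective 𝒱.injectiveSystem V γ hJ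
    simp only [map_smul, LinearMap.smul_apply] at hH' hJ'
    have hmem : b.app V x y ∈ bigraded (𝒱.h γ) (𝒱.j γ) V (p.1.1 + q.1.1 - (n + 1))
        (p.1.2 + q.1.2) := by
      rw [mem_bigraded]
      constructor
      · rw [← sub_eq_iff_eq_add] at hH'
        rw [← hH', ← Int.cast_smul_eq_zsmul K]
        push_cast
        module
      · rw [← hJ']
        push_cast
        module
    rw [← internalProj_of_mem (𝒱.isInternal γ V) (p := (p.1.1 + q.1.1 - (n + 1), p.1.2 + q.1.2))
      hmem]
    refine internalProj_eq_zero_of_not (𝒱.isInternal γ V) (hb γ).submodule_iSup_eq_top ?_ _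
    have h1 := p.2.2.1
    have h2 := q.2.2.1
    rintro ⟨h3, -⟩
    simp only at h3
    omega
  have hx : x ∈ LinearMap.ker (b.app V) := by
    have hle : ⨆ p : {p : ℤ × ℤ // N ≤ p.1 ∧ p.1 ≤ Nw α ∧ |p.2| ≤ L α},
        bigraded (𝒱.h α) (𝒱.j α) V p.1.1 p.1.2 ≤ LinearMap.ker (b.app V) := by
      refine iSup_le fun p x hx => LinearMap.mem_ker.2 (LinearMap.ext fun y => ?_)
      have hle' : ⨆ q : {p : ℤ × ℤ // N ≤ p.1 ∧ p.1 ≤ Nw β ∧ |p.2| ≤ L β},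
          bigraded (𝒱.h β) (𝒱.j β) V q.1.1 q.1.2 ≤ LinearMap.ker (b.app V x) :=
        iSup_le fun q y hy => hhom p q x hx y hy
      exact hle' ((hb β).submodule_iSup_eq_top ▸ Submodule.mem_top)
    exact hle ((hb α).submodule_iSup_eq_top ▸ Submodule.mem_top)
  rw [LinearMap.mem_ker.1 hx, LinearMap.zero_apply]

end Lemmas

/-! ### The glued VSA-inductive sheaf -/

section Glue

variable {K : Type} [Field K] {X : Type u} [TopologicalSpace X] {Λ : Type u} {U : Λ → Opens X}
  {A : Type u} [SmallCategory A]

namespace GluingDatum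

variable (D : GluingDatum K A U) [IsFiltered A]

/-- Representatives of the products are compatible with the isomorphisms on the overlaps. -/
theorem trans_app {n : ℤ} {α α' γ : A}
    {b : ∀ i, Bilin ((D.𝒱 i).sys.obj α) ((D.𝒱 i).sys.obj α') ((D.𝒱 i).sys.obj γ)}
    (hb : ∀ i, ((D.𝒱 i).prod n).app α α' = BilinGerm.mk (D.𝒱 i).sys γ (b i))
    (i k : Λ) (O : Opens X) (hi : O ≤ U i) (hk : O ≤ U k)
    (x : ((D.𝒱 k).sys.obj α).carrier.obj (op ⟨O, hk⟩))
    (y : ((D.𝒱 k).sys.obj α').carrier.obj (op ⟨O, hk⟩)) :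
    (D.sheafDatum γ).trans i k hi hk ((b k).app ⟨O, hk⟩ x y) =
      (b i).app ⟨O, hi⟩ ((D.sheafDatum α).trans i k hi hk x)
        ((D.sheafDatum α').trans i k hi hk y) :=
  Lim.ι_injective (D.𝒱 i).injectiveSystem ⟨O, hi⟩ γ <| by
    rw [ι_trans, ← IndBilin.lim_ι_of_eq (hb k), ← IndBilin.lim_ι_of_eq (hb i), ι_trans, ι_trans,
      limTrans_prod]

/-- The `n`-th product of the glued ind-object. -/
noncomputable def gluedProd (n : ℤ) (j : A → A → A)
    (b : ∀ i α α', Bilin ((D.𝒱 i).sys.obj α) ((D.𝒱 i).sys.obj α') ((D.𝒱 i).sys.obj (j α α')))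
    (hb : ∀ i α α', ((D.𝒱 i).prod n).app α α' = BilinGerm.mk (D.𝒱 i).sys (j α α') (b i α α')) :
    IndBilin D.gluedSys D.gluedSys D.gluedSys :=
  IndBilin.ofLim D.gluedSys_injective
    (fun α α' => BilinGerm.mk D.gluedSys (j α α') (SheafDatum.bilinGlued (D := D.sheafDatum α)
      (D' := D.sheafDatum α') (D'' := D.sheafDatum (j α α')) (fun i => b i α α')
      (D.trans_app fun i => hb i α α')))
    (fun {α β α' β'} k k' V s t => D.evalLim_ext fun i O hV hi => by
      have e : ∀ α α' (s : (D.gluedSys.obj α).carrier.obj (op V))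
          (t : (D.gluedSys.obj α').carrier.obj (op V)), D.evalLim i hV hi
          (Lim.ι D.gluedSys V (j α α') ((SheafDatum.bilinGlued
            (D := D.sheafDatum α) (D' := D.sheafDatum α') (D'' := D.sheafDatum (j α α'))
            (fun i => b i α α') (D.trans_app fun i => hb i α α')).app V s t)) =
          ((D.𝒱 i).prod n).lim ⟨O, hi⟩ (D.evalLim i hV hi (Lim.ι D.gluedSys V α s))
            (D.evalLim i hV hi (Lim.ι D.gluedSys V α' t)) := fun α α' s t => by
        refine (D.evalLim_ι i hV hi (j α α') _).trans ?_
        rw [evalLim_ι, evalLim_ι, IndBilin.lim_ι_of_eq (hb i α α')]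
        rfl
      refine (e _ _ _ _).trans (Eq.trans ?_ (e _ _ s t).symm)
      rw [← Lim.ι_map D.gluedSys V k, ← Lim.ι_map D.gluedSys V k'])

theorem evalLim_gluedProd {n : ℤ} {j : A → A → A}
    {b : ∀ i α α', Bilin ((D.𝒱 i).sys.obj α) ((D.𝒱 i).sys.obj α') ((D.𝒱 i).sys.obj (j α α'))}
    (hb) {V : Set.Iic (⊤ : Opens X)} {O : Opens X} (i : Λ) (hV : O ≤ V.1) (hi : O ≤ U i)
    (x y : Lim D.gluedSys V) :
    D.evalLim i hV hi ((D.gluedProd n j b hb).lim V x y) =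
      ((D.𝒱 i).prod n).lim ⟨O, hi⟩ (D.evalLim i hV hi x) (D.evalLim i hV hi y) := by
  obtain ⟨α, s, rfl⟩ := Lim.exists_rep _ _ x
  obtain ⟨α', t, rfl⟩ := Lim.exists_rep _ _ y
  rw [IndBilin.lim_ι]
  refine (D.evalLim_ι i hV hi (j α α') _).trans ?_
  rw [evalLim_ι, evalLim_ι, IndBilin.lim_ι_of_eq (hb i α α')]
  rfl

/-- The morphism from the constant presheaf to the glued ind-object. -/
noncomputable def gluedVac (α₀ : A) (v : ∀ i, constPresheaf K (U i) ⟶ (D.𝒱 i).sys.obj α₀)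
    (hv : ∀ i, (D.𝒱 i).vac.app ⟨PUnit.unit⟩ = HomGerm.mk (D.𝒱 i).sys α₀ (v i)) :
    IndHom (constSystem K (⊤ : Opens X)) D.gluedSys where
  app _ := HomGerm.mk D.gluedSys α₀ <| SuperPresheaf.mkHom (P := constPresheaf K ⊤)
      (Q := (D.sheafDatum α₀).glued)
    (fun V => (D.sheafDatum α₀).liftSections (M := ULift.{u} K)
      (fun i O hV hi => SuperPresheaf.onOpen (v i) ⟨O, hi⟩)
      (fun i O O' hV hi h x => (SuperPresheaf.onOpen_res (v i) (V := ⟨O', h.trans hi⟩)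
        (W := ⟨O, hi⟩) h x).symm)
      (fun i k O hV hi hk x => Lim.ι_injective (D.𝒱 i).injectiveSystem ⟨O, hi⟩ α₀ <|
        (D.ι_trans i k hi hk α₀ _).trans <| by
          have h := D.limTrans_vac i k hi hk x.down
          rw [IndHom.lim_constElt_of_eq (hv k), IndHom.lim_constElt_of_eq (hv i)] at h
          exact h))
    (fun _ _ => rfl)
  compat _ := rfl

theorem evalLim_gluedVac {α₀ : A} {v : ∀ i, constPresheaf K (U i) ⟶ (D.𝒱 i).sys.obj α₀}
    (hv) {V : Set.Iic (⊤ : Opens X)} {O : Opens X} (i : Λ) (hV : O ≤ V.1) (hi : O ≤ U i) (c : K) :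
    D.evalLim i hV hi ((D.gluedVac α₀ v hv).lim V (constElt c V)) =
      (D.𝒱 i).vac.lim ⟨O, hi⟩ (constElt c ⟨O, hi⟩) := by
  rw [IndHom.lim_constElt_of_eq (hv i)]
  refine (congrArg (D.evalLim i hV hi)
    (IndHom.lim_constElt_of_eq (Φ := D.gluedVac α₀ v hv) rfl c V)).trans ?_
  exact D.evalLim_ι i hV hi α₀ _

/-- The even and the odd part of the inductive limit are independent because they are so for the
local sheaves. -/
theorem lim_parity_isInternal (V : Set.Iic (⊤ : Opens X)) :
    DirectSum.IsInternal (Lim.parity D.gluedSys V) :=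
  DirectSum.isInternal_submodule_of_iSupIndep_of_iSup_eq_top
    (iSupIndep_of_jointly_injective (I := Σ i, {O : Opens X // O ≤ V.1 ∧ O ≤ U i})
      (R := fun q => Lim.parity (D.𝒱 q.1).sys ⟨q.2.1, q.2.2.2⟩)
      (r := fun q => D.evalLim q.1 q.2.2.1 q.2.2.2)
      (fun q => ((D.𝒱 q.1).isVSA _).par_isInternal)
      (fun _ hx => D.evalLim_eq_zero fun i O hV hi => hx ⟨i, O, hV, hi⟩)
      (fun q _ _ hx => D.evalLim_mem q.1 q.2.2.1 q.2.2.2 hx))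
    (Lim.iSup_parity _ _)

theorem gluedVac_even {α₀ : A} {v : ∀ i, constPresheaf K (U i) ⟶ (D.𝒱 i).sys.obj α₀}
    (hv : ∀ i, (D.𝒱 i).vac.app ⟨PUnit.unit⟩ = HomGerm.mk (D.𝒱 i).sys α₀ (v i)) :
    (D.gluedVac α₀ v hv).IsEven := fun _ =>
  ⟨_, _, fun _ p x hx => (SheafDatum.mem_sectionsParity _).2 fun i O _ hi =>
    (D.𝒱 i).vac_even.of_app_eq (D.𝒱 i).injectiveSystem (D.𝒱 i).evenSystem
      (hv i) ⟨O, hi⟩ p x hx, rfl⟩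

theorem gluedHom_even {Φ : ∀ i, IndHom (D.𝒱 i).sys (D.𝒱 i).sys} (hΦ) {j : A → A}
    {f : ∀ i α, (D.𝒱 i).sys.obj α ⟶ (D.𝒱 i).sys.obj (j α)}
    (hf : ∀ i α, (Φ i).app α = HomGerm.mk (D.𝒱 i).sys (j α) (f i α))
    (h : ∀ i, (Φ i).IsEven) : (D.gluedHom Φ hΦ j f hf).IsEven := fun α =>
  ⟨_, _, SheafDatum.mapGlued_even _ fun i => (h i).of_app_eq
    (D.𝒱 i).injectiveSystem (D.𝒱 i).evenSystem (hf i α), rfl⟩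

theorem gluedProd_even {n : ℤ} {j : A → A → A}
    {b : ∀ i α α', Bilin ((D.𝒱 i).sys.obj α) ((D.𝒱 i).sys.obj α') ((D.𝒱 i).sys.obj (j α α'))}
    (hb : ∀ i α α', ((D.𝒱 i).prod n).app α α' = BilinGerm.mk (D.𝒱 i).sys (j α α') (b i α α')) :
    (D.gluedProd n j b hb).IsEven := fun α α' =>
  ⟨_, _, SheafDatum.bilinGlued_even _ fun i =>
    ((D.𝒱 i).prod_even n).of_app_eq (D.𝒱 i).injectiveSystem (D.𝒱 i).evenSystem
      (hb i α α'), rfl⟩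

variable {D}

/-- The glued VSA-inductive sheaf of a uniform gluing datum. -/
noncomputable def IsUniform.gluedVSA [CharZero K] (hD : D.IsUniform) :
    VSAIndSheaf K A (⊤ : Opens X) where
  sys := D.gluedSys
  isSheaf α := (D.sheafDatum α).glued_isSheaf
  map_even f := D.gluedSys_even f
  map_injective f V := D.gluedSys_injective f V
  vac := D.gluedVac hD.vac.choose hD.vac.choose_spec.choose hD.vac.choose_spec.choose_spec
  vac_even := D.gluedVac_even _
  T := D.gluedHom (fun i => (D.𝒱 i).T)
    D.limTrans_T
    hD.T.choose hD.T.choose_spec.choose hD.T.choose_spec.choose_spec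
  T_even := D.gluedHom_even _ _ fun i => (D.𝒱 i).T_even
  prod n := D.gluedProd n (hD.prod n).choose (hD.prod n).choose_spec.choose
    (hD.prod n).choose_spec.choose_spec
  prod_even n := D.gluedProd_even _
  isVSA V := by
    refine IsVertexSuperalgebra.of_jointly_injective
      (I := Σ i, {O : Opens X // O ≤ V.1 ∧ O ≤ U i})
      (fun q => (D.𝒱 q.1).isVSA ⟨q.2.1, q.2.2.2⟩)
      (fun q => D.evalLim q.1 q.2.2.1 q.2.2.2)
      (fun x hx => D.evalLim_eq_zero fun i O hV hi => hx ⟨i, O, hV, hi⟩)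
      (fun q p x hx => D.evalLim_mem q.1 q.2.2.1 q.2.2.2 hx)
      (fun q => D.evalLim_gluedVac _ q.1 q.2.2.1 q.2.2.2 1)
      (fun q x => D.evalLim_gluedHom _ _ _ _ _ q.1 q.2.2.1 q.2.2.2 x)
      (fun q n x y => D.evalLim_gluedProd _ q.1 q.2.2.1 q.2.2.2 x y)
      (D.lim_parity_isInternal V) ?_ ?_ ?_ ?_
    · exact (D.gluedVac_even _).lim_mem (constOne_mem V)
    · exact fun p a ha => (D.gluedHom_even _ _ fun i => (D.𝒱 i).T_even).lim_mem ha
    · exact fun n p q a ha b hb => (D.gluedProd_even _).lim_mem ha hb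
    · intro a b
      obtain ⟨α, s, rfl⟩ := Lim.exists_rep D.gluedSys V a
      obtain ⟨β, t, rfl⟩ := Lim.exists_rep D.gluedSys V b
      obtain ⟨N, Nw, L, hb⟩ := hD.bounded
      -- the bound does not depend on the chart, so it serves for all components at once
      refine ⟨Nw α + Nw β - N, fun n hn => D.evalLim_eq_zero fun i O hV hi => ?_⟩
      refine (D.evalLim_gluedProd _ i hV hi _ _).trans ?_
      rw [evalLim_ι, evalLim_ι]
      exact (D.𝒱 i).prod_lim_eq_zero (fun α => hb i α _) hn _ _

end GluingDatum

end Glue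

/-! ### The grading of the glued sheaf -/

section Lemmas

variable {K : Type} [Field K] {X : Type u} [TopologicalSpace X] {U : Opens X}
  {A : Type u} [SmallCategory A]

/-- A commutation relation between an operator and the products which holds on inductive limits
holds for representatives, since the sections of a member of the system embed into the limits. -/
theorem exists_bilin_of_lim_prod [IsFiltered A] (𝒱 : VSAIndSheaf K A U)
    {H : IndHom 𝒱.sys 𝒱.sys} {h : ∀ α, 𝒱.sys.obj α ⟶ 𝒱.sys.obj α}
    (hH : ∀ α, H.app α = HomGerm.mk 𝒱.sys α (h α)) (n c : ℤ) (α α' : A)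
    (hl : ∀ (V : Set.Iic U) (x y : Lim 𝒱.sys V),
      (𝒱.prod n).lim V x (H.lim V y) + (𝒱.prod n).lim V (H.lim V x) y =
      H.lim V ((𝒱.prod n).lim V x y) + c • (𝒱.prod n).lim V x y) :
    ∃ (γ : A) (b : Bilin (𝒱.sys.obj α) (𝒱.sys.obj α') (𝒱.sys.obj γ)),
      (𝒱.prod n).app α α' = BilinGerm.mk 𝒱.sys γ b ∧
      b.precomp (𝟙 _) (h α') + b.precomp (h α) (𝟙 _) = b.postcomp (h γ) + c • b := by
  obtain ⟨γ, b, e⟩ : ∃ γ b, (𝒱.prod n).app α α' = BilinGerm.mk 𝒱.sys γ b := by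
    induction (𝒱.prod n).app α α' using BilinGerm.ind with | _ γ b
    exact ⟨γ, b, rfl⟩
  refine ⟨γ, b, e, Bilin.ext (funext fun V => LinearMap.ext₂ fun x y =>
    Lim.ι_injective 𝒱.injectiveSystem V γ ?_)⟩
  have h1 := hl V (Lim.ι 𝒱.sys V α x) (Lim.ι 𝒱.sys V α' y)
  rw [IndHom.lim_ι_of_eq (hH _), IndHom.lim_ι_of_eq (hH _),
    IndBilin.lim_ι_of_eq e, IndBilin.lim_ι_of_eq e, IndBilin.lim_ι_of_eq e,
    IndHom.lim_ι_of_eq (hH _), ← map_zsmul, ← map_add, ← map_add] at h1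
  exact h1

theorem iSup_eigenspace_left {P : SuperPresheaf K U} {h j : P ⟶ P} {V : Set.Iic U}
    (hi : DirectSum.IsInternal (fun p : ℤ × ℤ => bigraded h j V p.1 p.2)) :
    ⨆ c : K, Module.End.eigenspace (SuperPresheaf.onOpen h V) c = ⊤ :=
  top_le_iff.1 <| hi.submodule_iSup_eq_top.ge.trans <| iSup_le fun p =>
    inf_le_left.trans (le_iSup (Module.End.eigenspace (SuperPresheaf.onOpen h V)) (p.1 : K))

theorem iSup_eigenspace_right {P : SuperPresheaf K U} {h j : P ⟶ P} {V : Set.Iic U}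
    (hi : DirectSum.IsInternal (fun p : ℤ × ℤ => bigraded h j V p.1 p.2)) :
    ⨆ c : K, Module.End.eigenspace (SuperPresheaf.onOpen j V) c = ⊤ :=
  top_le_iff.1 <| hi.submodule_iSup_eq_top.ge.trans <| iSup_le fun p =>
    inf_le_right.trans (le_iSup (Module.End.eigenspace (SuperPresheaf.onOpen j V)) (p.2 : K))

end Lemmas

section Glue

variable {K : Type} [Field K] {X : Type u} [TopologicalSpace X] {Λ : Type u} {U : Λ → Opens X}
  {A : Type u} [SmallCategory A]

/-- If the gradings of the local sheaves have uniformly bounded support, the glued sheaf is the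
direct sum of its bihomogeneous parts: the components of a section glue, and only finitely many are
not zero. -/
theorem SheafDatum.bigraded_isInternal {D : SheafDatum K U} {h j : ∀ i, D.P i ⟶ D.P i} (hh) (hj)
    (hi : ∀ i V, DirectSum.IsInternal (fun p : ℤ × ℤ => bigraded (h i) (j i) V p.1 p.2))
    {N M L : ℤ} (hb : ∀ i V, ⨆ p : {p : ℤ × ℤ // N ≤ p.1 ∧ p.1 ≤ M ∧ |p.2| ≤ L},
      bigraded (h i) (j i) V p.1.1 p.1.2 = ⊤) (V : Set.Iic (⊤ : Opens X)) :
    DirectSum.IsInternal (fun p : ℤ × ℤ =>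
      bigraded (mapGlued (D' := D) h hh) (mapGlued (D' := D) j hj) V p.1 p.2) := by
  refine isInternal_of_jointly_injective
    (I := Σ i, {O : Opens X // O ≤ V.1 ∧ O ≤ U i})
    (r := fun q => D.eval (V := V.1) q.1 q.2.2.1 q.2.2.2)
    (R := fun q p => bigraded (h q.1) (j q.1) ⟨q.2.1, q.2.2.2⟩ p.1 p.2)
    (fun q => hi q.1 _)
    (fun s hs => sections_ext (V := V.1) fun i O hV hi =>
      (hs ⟨i, O, hV, hi⟩).trans (map_zero (D.eval (V := V.1) i hV hi)).symm)
    (fun p s => ?_)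
    (fun p s => ?_) (fun s => ⟨Finset.Icc N M ×ˢ Finset.Icc (-L) L, fun q p hp => ?_⟩)
  · rw [mem_bigraded]
    constructor
    · rintro ⟨h1, h2⟩ q
      rw [mem_bigraded]
      exact ⟨(congrArg (D.eval (V := V.1) q.1 q.2.2.1 q.2.2.2) h1).trans (map_smul _ _ _),
        (congrArg (D.eval (V := V.1) q.1 q.2.2.1 q.2.2.2) h2).trans (map_smul _ _ _)⟩
    · intro hq
      exact ⟨sections_ext (V := V.1) fun i O hV hi =>
        (mem_bigraded.1 (hq ⟨i, O, hV, hi⟩)).1.trans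
          (map_smul (D.eval (V := V.1) i hV hi) _ _).symm,
        sections_ext (V := V.1) fun i O hV hi =>
        (mem_bigraded.1 (hq ⟨i, O, hV, hi⟩)).2.trans
          (map_smul (D.eval (V := V.1) i hV hi) _ _).symm⟩
  · refine ⟨D.mkSection (V := V.1) (fun i O hV hO =>
      internalProj (hi i ⟨O, hO⟩) p (D.eval (V := V.1) i hV hO s)) (fun i O O' hV hO hle => ?_)
      (fun i k O hV hO hk => ?_), fun q => rfl⟩
    · rw [← internalProj_map _ (hi i ⟨O', hle.trans hO⟩) _ (fun p x hx => ?_)]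
      · exact congrArg _ (res_eval (V := V.1) s i hV hO hle)
      · rw [mem_bigraded] at hx ⊢
        rw [SuperPresheaf.onOpen_res, SuperPresheaf.onOpen_res, hx.1, hx.2, map_smul, map_smul]
        exact ⟨rfl, rfl⟩
    · rw [← internalProj_map _ (hi i ⟨O, hO⟩) _ (fun p x hx => ?_)]
      · exact congrArg _ (trans_eval (V := V.1) s i k hV hO hk)
      · rw [mem_bigraded] at hx ⊢
        rw [← hh, ← hj, hx.1, hx.2, map_smul, map_smul]
        exact ⟨rfl, rfl⟩
  · refine internalProj_eq_zero_of_not (hi q.1 _) (c := fun p => N ≤ p.1 ∧ p.1 ≤ M ∧ |p.2| ≤ L)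
      (hb q.1 _) (fun hc => hp ?_) _
    rw [abs_le] at hc
    simp only [Finset.mem_product, Finset.mem_Icc]
    exact ⟨⟨hc.1, hc.2.1⟩, hc.2.2⟩

namespace GluingDatum

variable [IsFiltered A] {D : GluingDatum K A U}

variable (D) in
/-- The Hamiltonian of the glued ind-object. -/
noncomputable def gluedH : IndHom D.gluedSys D.gluedSys :=
  D.gluedHom (fun i => (D.𝒱 i).H) D.limTrans_H
    (fun α => α) (fun i => (D.𝒱 i).h) (fun i => (D.𝒱 i).isHamiltonian.app_eq)

variable (D) in
/-- The degree-grading operator of the glued ind-object. -/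
noncomputable def gluedJ : IndHom D.gluedSys D.gluedSys :=
  D.gluedHom (fun i => (D.𝒱 i).J) D.limTrans_J
    (fun α => α) (fun i => (D.𝒱 i).j) (fun i => (D.𝒱 i).isDegreeOperator.app_eq)

variable (D) in
theorem trans_gluedh (α : A) (i k : Λ) (O : Opens X) (hi : O ≤ U i) (hk : O ≤ U k)
    (x : ((D.𝒱 k).sys.obj α).carrier.obj (op ⟨O, hk⟩)) :
    (D.sheafDatum α).trans i k hi hk (SuperPresheaf.onOpen ((D.𝒱 k).h α) ⟨O, hk⟩ x) =
      SuperPresheaf.onOpen ((D.𝒱 i).h α) ⟨O, hi⟩ ((D.sheafDatum α).trans i k hi hk x) :=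
  D.trans_onOpen D.limTrans_H
    (fun i => (D.𝒱 i).isHamiltonian.app_eq α) i k O hi hk x

variable (D) in
/-- The components of the Hamiltonian of the glued ind-object. -/
noncomputable def gluedh (α : A) : D.gluedSys.obj α ⟶ D.gluedSys.obj α :=
  SheafDatum.mapGlued (D := D.sheafDatum α) (D' := D.sheafDatum α) (fun i => (D.𝒱 i).h α)
    (D.trans_gluedh α)

variable (D) in
theorem trans_gluedj (α : A) (i k : Λ) (O : Opens X) (hi : O ≤ U i) (hk : O ≤ U k)
    (x : ((D.𝒱 k).sys.obj α).carrier.obj (op ⟨O, hk⟩)) :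
    (D.sheafDatum α).trans i k hi hk (SuperPresheaf.onOpen ((D.𝒱 k).j α) ⟨O, hk⟩ x) =
      SuperPresheaf.onOpen ((D.𝒱 i).j α) ⟨O, hi⟩ ((D.sheafDatum α).trans i k hi hk x) :=
  D.trans_onOpen D.limTrans_J
    (fun i => (D.𝒱 i).isDegreeOperator.app_eq α) i k O hi hk x

variable (D) in
/-- The components of the degree-grading operator of the glued ind-object. -/
noncomputable def gluedj (α : A) : D.gluedSys.obj α ⟶ D.gluedSys.obj α :=
  SheafDatum.mapGlued (D := D.sheafDatum α) (D' := D.sheafDatum α) (fun i => (D.𝒱 i).j α)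
    (D.trans_gluedj α)

/-- Uniformity bounds the grading of the sheaves with index `α` independently of the chart. -/
theorem IsUniform.bigraded_glued_isInternal (hD : D.IsUniform) (α : A)
    (V : Set.Iic (⊤ : Opens X)) : DirectSum.IsInternal (fun p : ℤ × ℤ =>
      bigraded (D.gluedh α) (D.gluedj α) V p.1 p.2) := by
  obtain ⟨N, Nw, L, hb⟩ := hD.bounded
  exact SheafDatum.bigraded_isInternal (D := D.sheafDatum α) (h := fun i => (D.𝒱 i).h α)
    (j := fun i => (D.𝒱 i).j α) (D.trans_gluedh α) (D.trans_gluedj α)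
    (fun i V => (D.𝒱 i).isInternal α V) (N := N) (M := Nw α) (L := L α)
    (fun i V => (hb i α V).submodule_iSup_eq_top) V

/-- A relation `Φ (a_(n) b) + c a_(n) b = a_(n) (Φ b) + (Φ a)_(n) b` for the local sheaves holds for
the glued sheaf. -/
theorem IsUniform.lim_prod_gluedHom [CharZero K] (hD : D.IsUniform) {n c : ℤ}
    {Φ : ∀ i, IndHom (D.𝒱 i).sys (D.𝒱 i).sys} {Ψ : IndHom hD.gluedVSA.sys hD.gluedVSA.sys}
    (hΨ : ∀ (V : Set.Iic (⊤ : Opens X)) (O : Opens X) (i : Λ) (hV : O ≤ V.1) (hi : O ≤ U i) x,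
      D.evalLim i hV hi (Ψ.lim V x) = (Φ i).lim ⟨O, hi⟩ (D.evalLim i hV hi x))
    (h : ∀ i (V : Set.Iic (U i)) (x y : Lim (D.𝒱 i).sys V),
      ((D.𝒱 i).prod n).lim V x ((Φ i).lim V y) + ((D.𝒱 i).prod n).lim V ((Φ i).lim V x) y =
      (Φ i).lim V (((D.𝒱 i).prod n).lim V x y) + c • ((D.𝒱 i).prod n).lim V x y)
    (V : Set.Iic (⊤ : Opens X)) (x y : Lim hD.gluedVSA.sys V) :
    (hD.gluedVSA.prod n).lim V x (Ψ.lim V y) + (hD.gluedVSA.prod n).lim V (Ψ.lim V x) y =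
    Ψ.lim V ((hD.gluedVSA.prod n).lim V x y) + c • (hD.gluedVSA.prod n).lim V x y := by
  refine D.evalLim_ext fun i O hV hi => ?_
  have hp : ∀ x y : Lim D.gluedSys V, D.evalLim i hV hi ((hD.gluedVSA.prod n).lim V x y) =
      ((D.𝒱 i).prod n).lim ⟨O, hi⟩ (D.evalLim i hV hi x) (D.evalLim i hV hi y) := fun x y =>
    D.evalLim_gluedProd (hD.prod n).choose_spec.choose_spec i hV hi x y
  have hx := hΨ V O i hV hi x
  have hy := hΨ V O i hV hi y
  have hxy := (hΨ V O i hV hi _).trans (congrArg ((Φ i).lim ⟨O, hi⟩) (hp x y))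
  refine (map_add (D.evalLim i hV hi) _ _).trans (Eq.trans ?_
    ((map_add (D.evalLim i hV hi) _ _).trans (congrArg₂ (· + ·) hxy
      ((map_zsmul (D.evalLim i hV hi) _ _).trans (congrArg (c • ·) (hp x y))))).symm)
  exact (congrArg₂ (· + ·)
    ((hp _ _).trans (congrArg (((D.𝒱 i).prod n).lim ⟨O, hi⟩ (D.evalLim i hV hi x)) hy))
    ((hp _ _).trans (congrArg (fun z => ((D.𝒱 i).prod n).lim ⟨O, hi⟩ z (D.evalLim i hV hi y))
      hx))).trans (h i ⟨O, hi⟩ _ _)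

/-- The glued degree-weight-graded VSA-inductive sheaf of a uniform gluing datum. -/
noncomputable def IsUniform.gluedDegWt [CharZero K] (hD : D.IsUniform) :
    DegWtVSAIndSheaf K A (⊤ : Opens X) where
  toVSAIndSheaf := hD.gluedVSA
  H := D.gluedH
  J := D.gluedJ
  h := D.gluedh
  j := D.gluedj
  isHamiltonian :=
    { app_eq := fun _ => rfl
      even := fun α => SheafDatum.mapGlued_even _ fun i => (D.𝒱 i).isHamiltonian.even α
      diagonalizable := fun α V => iSup_eigenspace_left (hD.bigraded_glued_isInternal α V)
      prod := fun n α α' => by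
        obtain ⟨γ, b, e, e'⟩ := exists_bilin_of_lim_prod hD.gluedVSA (H := D.gluedH)
          (h := D.gluedh) (fun _ => rfl) n (n + 1) α α'
          (fun V x y => hD.lim_prod_gluedHom
            (fun V O i hV hi x => D.evalLim_gluedHom _ _ _ _ _ i hV hi x)
            (fun i V x y => (D.𝒱 i).isHamiltonian.lim_prod n V x y) V x y)
        exact ⟨γ, b, e, congrArg _ e'⟩ }
  isDegreeOperator :=
    { app_eq := fun _ => rfl
      even := fun α => SheafDatum.mapGlued_even _ fun i => (D.𝒱 i).isDegreeOperator.even α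
      diagonalizable := fun α V => iSup_eigenspace_right (hD.bigraded_glued_isInternal α V)
      prod := fun n α α' => by
        obtain ⟨γ, b, e, e'⟩ := exists_bilin_of_lim_prod hD.gluedVSA (H := D.gluedJ)
          (h := D.gluedj) (fun _ => rfl) n 0 α α'
          (fun V x y => hD.lim_prod_gluedHom
            (fun V O i hV hi x => D.evalLim_gluedHom _ _ _ _ _ i hV hi x)
            (fun i V x y => ((D.𝒱 i).isDegreeOperator.lim_prod n V x y).trans
              (by rw [zero_smul, add_zero])) V x y)
        refine ⟨γ, b, e, congrArg _ (e'.trans (Bilin.ext (funext fun V =>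
          LinearMap.ext₂ fun x y => ?_)))⟩
        change _ + (0 : ℤ) • b.app V x y = _
        rw [zero_smul, add_zero] }
  isInternal := hD.bigraded_glued_isInternal

end GluingDatum

end Glue

/-! ### Morphisms of VSA-inductive sheaves on inductive limits -/

section Lemmas

variable {K : Type} [Field K] {X : Type u} [TopologicalSpace X] {U : Opens X}
  {W : Opens X} {A B B' C : Type u} [SmallCategory A] [SmallCategory B] [SmallCategory B']
  [SmallCategory C]

theorem IndHom.lim_restrict_apply {F : A ⥤ SuperPresheaf K U} {G : B ⥤ SuperPresheaf K U}
    (Φ : IndHom F G) (h : W ≤ U) {O : Opens X} (hO : O ≤ W) (x : Lim F ⟨O, hO.trans h⟩) :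
    (Φ.restrict h).lim ⟨O, hO⟩ x = Φ.lim ⟨O, hO.trans h⟩ x :=
  LinearMap.congr_fun (Φ.lim_restrict h ⟨O, hO⟩) x

theorem IndHom.lim_eq_of_comp_eq {F : A ⥤ SuperPresheaf K U} {G : B ⥤ SuperPresheaf K U}
    {G' : B' ⥤ SuperPresheaf K U} {H : C ⥤ SuperPresheaf K U} {Φ : IndHom F G} {Ψ : IndHom G H}
    {Φ' : IndHom F G'} {Ψ' : IndHom G' H} (e : Ψ.comp Φ = Ψ'.comp Φ') (V : Set.Iic U)
    (x : Lim F V) : Ψ.lim V (Φ.lim V x) = Ψ'.lim V (Φ'.lim V x) := by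
  rw [← IndHom.lim_comp, e, IndHom.lim_comp]

/-- Commutativity of a square of ind-objects can be checked on inductive limits. -/
theorem IndHom.comp_eq_of_lim [IsFiltered C] {F : A ⥤ SuperPresheaf K U}
    {G : B ⥤ SuperPresheaf K U} {G' : B' ⥤ SuperPresheaf K U} {H : C ⥤ SuperPresheaf K U}
    (hH : InjectiveSystem H) {Φ : IndHom F G} {Ψ : IndHom G H}
    {Φ' : IndHom F G'} {Ψ' : IndHom G' H}
    (h : ∀ V x, Ψ.lim V (Φ.lim V x) = Ψ'.lim V (Φ'.lim V x)) : Ψ.comp Φ = Ψ'.comp Φ' :=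
  IndHom.ext_lim hH fun V x => by rw [IndHom.lim_comp, IndHom.lim_comp, h]

theorem IndHom.comp_eq_id_of_lim [IsFiltered A] {F : A ⥤ SuperPresheaf K U}
    {G : B ⥤ SuperPresheaf K U} (hF : InjectiveSystem F) {Φ : IndHom F G} {Ψ : IndHom G F}
    (h : ∀ V x, Ψ.lim V (Φ.lim V x) = x) : Ψ.comp Φ = IndHom.id F :=
  IndHom.ext_lim hF fun V x => by rw [IndHom.lim_comp, IndHom.lim_id, h]

theorem IndHom.lim_lim_of_comp_eq_id {F : A ⥤ SuperPresheaf K U}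
    {G : B ⥤ SuperPresheaf K U} {Φ : IndHom F G} {Ψ : IndHom G F}
    (h : Ψ.comp Φ = IndHom.id F) (V : Set.Iic U) (x : Lim F V) : Ψ.lim V (Φ.lim V x) = x := by
  rw [← IndHom.lim_comp, h, IndHom.lim_id]

namespace PreservesVSA

variable {𝒱 𝒱' : VSAIndSheaf K A U} {Φ : IndHom 𝒱.sys 𝒱'.sys}

theorem lim_vac (h : PreservesVSA 𝒱 𝒱' Φ) (V : Set.Iic U) (x : Lim (constSystem K U) V) :
    Φ.lim V (𝒱.vac.lim V x) = 𝒱'.vac.lim V x := by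
  rw [← IndHom.lim_comp, h.vac]

theorem lim_T (h : PreservesVSA 𝒱 𝒱' Φ) (V : Set.Iic U) (x : Lim 𝒱.sys V) :
    Φ.lim V (𝒱.T.lim V x) = 𝒱'.T.lim V (Φ.lim V x) :=
  IndHom.lim_eq_of_comp_eq h.T V x

theorem lim_prod (h : PreservesVSA 𝒱 𝒱' Φ) (n : ℤ) (V : Set.Iic U) (x y : Lim 𝒱.sys V) :
    Φ.lim V ((𝒱.prod n).lim V x y) = (𝒱'.prod n).lim V (Φ.lim V x) (Φ.lim V y) := by
  rw [← IndHom.lim_compBilin, h.prod, IndBilin.lim_compProd]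

/-- Compatibility with the vertex superalgebra structure can be checked on inductive limits. -/
theorem of_lim [IsFiltered A]
    (vac : ∀ V x, Φ.lim V (𝒱.vac.lim V x) = 𝒱'.vac.lim V x)
    (T : ∀ V x, Φ.lim V (𝒱.T.lim V x) = 𝒱'.T.lim V (Φ.lim V x))
    (prod : ∀ n V x y,
      Φ.lim V ((𝒱.prod n).lim V x y) = (𝒱'.prod n).lim V (Φ.lim V x) (Φ.lim V y)) :
    PreservesVSA 𝒱 𝒱' Φ where
  vac := IndHom.ext_lim 𝒱'.injectiveSystem fun V x => by rw [IndHom.lim_comp, vac]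
  T := IndHom.comp_eq_of_lim 𝒱'.injectiveSystem T
  prod n := IndBilin.ext_lim 𝒱'.injectiveSystem fun V x y => by
    rw [IndHom.lim_compBilin, IndBilin.lim_compProd, prod]

end PreservesVSA

/-- The inverse of a strict morphism is a strict morphism if it is even and strict as a morphism of
ind-objects. -/
theorem IsStrictMorphism.of_inverse [IsFiltered A] {𝒱 𝒱' : DegWtVSAIndSheaf K A U}
    {Φ : IndHom 𝒱.sys 𝒱'.sys} {Ψ : IndHom 𝒱'.sys 𝒱.sys} (h : IsStrictMorphism 𝒱 𝒱' Φ)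
    (h1 : ∀ V x, Ψ.lim V (Φ.lim V x) = x) (h2 : ∀ V x, Φ.lim V (Ψ.lim V x) = x)
    (heven : Ψ.IsEven) (hstrict : Ψ.IsStrict) : IsStrictMorphism 𝒱' 𝒱 Ψ where
  isVSAMorphism :=
    { PreservesVSA.of_lim (𝒱 := 𝒱'.toVSAIndSheaf) (𝒱' := 𝒱.toVSAIndSheaf)
        (fun V x => by rw [← h.isVSAMorphism.lim_vac, h1])
        (fun V x => by
          rw [← h1 V (𝒱.T.lim V (Ψ.lim V x)), h.isVSAMorphism.lim_T, h2])
        (fun n V x y => by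
          rw [← h1 V ((𝒱.prod n).lim V (Ψ.lim V x) (Ψ.lim V y)), h.isVSAMorphism.lim_prod, h2,
            h2]) with
      even := heven }
  preservesGrading :=
    { comm_H := IndHom.comp_eq_of_lim 𝒱.injectiveSystem fun V x => by
        rw [← h1 V (𝒱.H.lim V (Ψ.lim V x)),
          IndHom.lim_eq_of_comp_eq h.preservesGrading.comm_H, h2]
      comm_J := IndHom.comp_eq_of_lim 𝒱.injectiveSystem fun V x => by
        rw [← h1 V (𝒱.J.lim V (Ψ.lim V x)),
          IndHom.lim_eq_of_comp_eq h.preservesGrading.comm_J, h2] }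
  isStrict := hstrict

end Lemmas

section Glue

variable {K : Type} [Field K] {X : Type u} [TopologicalSpace X] {Λ : Type u} {U : Λ → Opens X}
  {A : Type u} [SmallCategory A]

namespace GluingDatum

variable (D : GluingDatum K A U) [IsFiltered A]

/-! ### Restriction of the glued object to the local sheaves -/

/-- The projection of the restriction of the glued ind-object to `U i` onto the `i`-th local
ind-object. -/
noncomputable def toLocal (i : Λ) :
    IndHom (resSys D.gluedSys (le_top : U i ≤ ⊤)) (D.𝒱 i).sys where
  app α := HomGerm.mk (D.𝒱 i).sys α ((D.sheafDatum α).toLocal i)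
  compat {α _} f := HomGerm.mk_map (D.𝒱 i).sys f ((D.sheafDatum α).toLocal i)

/-- The inverse of `toLocal`. -/
noncomputable def ofLocal (i : Λ) :
    IndHom (D.𝒱 i).sys (resSys D.gluedSys (le_top : U i ≤ ⊤)) where
  app α := HomGerm.mk (resSys D.gluedSys (le_top : U i ≤ ⊤)) α ((D.sheafDatum α).ofLocal i)
  compat {α β} f := by
    have e : (D.𝒱 i).sys.map f ≫ (D.sheafDatum β).ofLocal i =
        (D.sheafDatum α).ofLocal i ≫ (resSys D.gluedSys (le_top : U i ≤ ⊤)).map f :=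
      SuperPresheaf.hom_ext fun V x => SheafDatum.sections_ext (D := D.sheafDatum β) (V := V.1)
        fun k O hV hk =>
          (congrArg ((D.sheafDatum β).trans k i hk (hV.trans V.2))
            (SuperPresheaf.onOpen_res ((D.𝒱 i).sys.map f) (V := ⟨O, hV.trans V.2⟩) (W := V)
              hV x).symm).trans (D.trans_map f k i O hk (hV.trans V.2) _)
    exact (congrArg (HomGerm.mk (resSys D.gluedSys (le_top : U i ≤ ⊤)) β) e).trans
      (HomGerm.mk_map (resSys D.gluedSys (le_top : U i ≤ ⊤)) f ((D.sheafDatum α).ofLocal i))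

theorem lim_toLocal (i : Λ) (V : Set.Iic (U i)) (x : Lim (resSys D.gluedSys (le_top : U i ≤ ⊤)) V) :
    (D.toLocal i).lim V x = D.evalLim (V := ⟨V.1, (le_top : V.1 ≤ ⊤)⟩) i le_rfl V.2 x := by
  obtain ⟨α, s, rfl⟩ := Lim.exists_rep _ _ x
  exact (IndHom.lim_ι_of_eq (rfl : (D.toLocal i).app α = HomGerm.mk _ α _) V s).trans
    (D.evalLim_ι (V := ⟨V.1, (le_top : V.1 ≤ ⊤)⟩) i le_rfl V.2 α s).symm

theorem evalLim_ofLocal (i k : Λ) (O : Opens X) (hi : O ≤ U i) (hk : O ≤ U k)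
    (x : Lim (D.𝒱 k).sys ⟨O, hk⟩) :
    D.evalLim (V := ⟨O, (le_top : O ≤ ⊤)⟩) i le_rfl hi ((D.ofLocal k).lim ⟨O, hk⟩ x) =
      D.limTrans i k hi hk x := by
  obtain ⟨α, s, rfl⟩ := Lim.exists_rep _ _ x
  rw [IndHom.lim_ι_of_eq (rfl : (D.ofLocal k).app α = HomGerm.mk _ α _)]
  refine (D.evalLim_ι (V := ⟨O, (le_top : O ≤ ⊤)⟩) i le_rfl hi α _).trans ?_
  rw [← ι_trans]
  exact congrArg (fun z => Lim.ι (D.𝒱 i).sys ⟨O, hi⟩ α ((D.sheafDatum α).trans i k hi hk z))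
    (SuperPresheaf.res_self _ (V := ⟨O, hk⟩) le_rfl s)

theorem lim_toLocal_ofLocal (i : Λ) (V : Set.Iic (U i)) (x : Lim (D.𝒱 i).sys V) :
    (D.toLocal i).lim V ((D.ofLocal i).lim V x) = x := by
  obtain ⟨α, s, rfl⟩ := Lim.exists_rep _ _ x
  rw [IndHom.lim_ι_of_eq (rfl : (D.ofLocal i).app α = HomGerm.mk _ α _),
    IndHom.lim_ι_of_eq (rfl : (D.toLocal i).app α = HomGerm.mk _ α _)]
  exact congrArg (fun f => Lim.ι (D.𝒱 i).sys V α (SuperPresheaf.onOpen f V s))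
    ((D.sheafDatum α).toLocal_ofLocal i)

theorem lim_ofLocal_toLocal (i : Λ) (V : Set.Iic (U i))
    (x : Lim (resSys D.gluedSys (le_top : U i ≤ ⊤)) V) :
    (D.ofLocal i).lim V ((D.toLocal i).lim V x) = x := by
  obtain ⟨α, s, rfl⟩ := Lim.exists_rep _ _ x
  rw [IndHom.lim_ι_of_eq (rfl : (D.toLocal i).app α = HomGerm.mk _ α _),
    IndHom.lim_ι_of_eq (rfl : (D.ofLocal i).app α = HomGerm.mk _ α _)]
  exact congrArg (fun f => Lim.ι (resSys D.gluedSys (le_top : U i ≤ ⊤)) V α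
    (SuperPresheaf.onOpen f V s)) ((D.sheafDatum α).ofLocal_toLocal i)

theorem lim_toLocal_gluedHom (i : Λ) {Φ : ∀ i, IndHom (D.𝒱 i).sys (D.𝒱 i).sys} (hΦ) {j : A → A}
    {f : ∀ i α, (D.𝒱 i).sys.obj α ⟶ (D.𝒱 i).sys.obj (j α)} (hf) (V : Set.Iic (U i))
    (x : Lim (resSys D.gluedSys (le_top : U i ≤ ⊤)) V) :
    (D.toLocal i).lim V (((D.gluedHom Φ hΦ j f hf).restrict (le_top : U i ≤ ⊤)).lim V x) =
      (Φ i).lim V ((D.toLocal i).lim V x) := by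
  rw [lim_toLocal, lim_toLocal, IndHom.lim_restrict]
  exact D.evalLim_gluedHom Φ hΦ j f hf (V := ⟨V.1, (le_top : V.1 ≤ ⊤)⟩) i le_rfl V.2 x

theorem lim_toLocal_gluedVac {α₀ : A} {v : ∀ i, constPresheaf K (U i) ⟶ (D.𝒱 i).sys.obj α₀} (hv)
    (i : Λ) (V : Set.Iic (U i)) (x : Lim (constSystem K (U i)) V) :
    (D.toLocal i).lim V (((D.gluedVac α₀ v hv).restrict (le_top : U i ≤ ⊤)).lim V x) =
      (D.𝒱 i).vac.lim V x := by
  have h : (D.toLocal i).lim V ∘ₗ ((D.gluedVac α₀ v hv).restrict (le_top : U i ≤ ⊤)).lim V =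
      (D.𝒱 i).vac.lim V := Lim.const_hom_ext fun c => by
    refine (D.lim_toLocal i V _).trans ?_
    rw [IndHom.lim_restrict]
    exact D.evalLim_gluedVac hv (V := ⟨V.1, (le_top : V.1 ≤ ⊤)⟩) i le_rfl V.2 c
  exact LinearMap.congr_fun h x

theorem lim_toLocal_gluedProd (i : Λ) {n : ℤ} {j : A → A → A}
    {b : ∀ i α α', Bilin ((D.𝒱 i).sys.obj α) ((D.𝒱 i).sys.obj α') ((D.𝒱 i).sys.obj (j α α'))}
    (hb) (V : Set.Iic (U i)) (x y : Lim (resSys D.gluedSys (le_top : U i ≤ ⊤)) V) :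
    (D.toLocal i).lim V (((D.gluedProd n j b hb).restrict (le_top : U i ≤ ⊤)).lim V x y) =
      ((D.𝒱 i).prod n).lim V ((D.toLocal i).lim V x) ((D.toLocal i).lim V y) := by
  rw [lim_toLocal, lim_toLocal, lim_toLocal, IndBilin.lim_restrict]
  exact D.evalLim_gluedProd hb (V := ⟨V.1, (le_top : V.1 ≤ ⊤)⟩) i le_rfl V.2 x y

variable {D}

theorem IsUniform.toLocal_isStrictMorphism [CharZero K] (hD : D.IsUniform) (i : Λ) :
    IsStrictMorphism (hD.gluedDegWt.restrict (le_top : U i ≤ ⊤)) (D.𝒱 i) (D.toLocal i) where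
  isVSAMorphism :=
    { PreservesVSA.of_lim (𝒱 := (hD.gluedDegWt.restrict (le_top : U i ≤ ⊤)).toVSAIndSheaf)
        (𝒱' := (D.𝒱 i).toVSAIndSheaf) (Φ := D.toLocal i)
        (fun V x => D.lim_toLocal_gluedVac hD.vac.choose_spec.choose_spec i V x)
        (fun V x => D.lim_toLocal_gluedHom i D.limTrans_T
          hD.T.choose_spec.choose_spec V x)
        (fun n V x y => D.lim_toLocal_gluedProd i (hD.prod n).choose_spec.choose_spec V x y) with
      even := fun α => ⟨α, _, (D.sheafDatum α).toLocal_even i, rfl⟩ }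
  preservesGrading :=
    { comm_H := IndHom.comp_eq_of_lim (D.𝒱 i).injectiveSystem fun V x =>
        D.lim_toLocal_gluedHom i D.limTrans_H
          (fun i => (D.𝒱 i).isHamiltonian.app_eq) V x
      comm_J := IndHom.comp_eq_of_lim (D.𝒱 i).injectiveSystem fun V x =>
        D.lim_toLocal_gluedHom i D.limTrans_J
          (fun i => (D.𝒱 i).isDegreeOperator.app_eq) V x }
  isStrict := ⟨_, fun _ => rfl⟩

/-- The isomorphism of the restriction of the glued sheaf with the `i`-th local sheaf. -/
noncomputable def IsUniform.localIso [CharZero K] (hD : D.IsUniform) (i : Λ) :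
    StrictIso (hD.gluedDegWt.restrict (le_top : U i ≤ ⊤)) (D.𝒱 i) where
  hom := D.toLocal i
  inv := D.ofLocal i
  hom_isStrictMorphism := hD.toLocal_isStrictMorphism i
  inv_isStrictMorphism := (hD.toLocal_isStrictMorphism i).of_inverse (D.lim_ofLocal_toLocal i)
    (D.lim_toLocal_ofLocal i) (fun α => ⟨α, _, (D.sheafDatum α).ofLocal_even i, rfl⟩)
    ⟨_, fun _ => rfl⟩
  inv_comp_hom := IndHom.comp_eq_id_of_lim
    (hD.gluedDegWt.restrict (le_top : U i ≤ ⊤)).injectiveSystem (D.lim_ofLocal_toLocal i)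
  hom_comp_inv := IndHom.comp_eq_id_of_lim (D.𝒱 i).injectiveSystem (D.lim_toLocal_ofLocal i)

/-- The glued object of a uniform gluing datum. -/
noncomputable def IsUniform.gluing [CharZero K] (hD : D.IsUniform) : Gluing D where
  𝒱 := hD.gluedDegWt
  Φ := hD.localIso
  Φ_comp i k := IndHom.ext_lim ((D.𝒱 i).injectiveSystem.restrict _) fun V x => by
    have hi : V.1 ≤ U i := le_trans V.2 inf_le_left
    have hk : V.1 ≤ U k := le_trans V.2 inf_le_right
    refine (IndHom.lim_comp _ _ V x).trans ?_
    refine (IndHom.lim_restrict_apply (D.toLocal i) (inf_le_left : U i ⊓ U k ≤ U i) V.2 _).trans ?_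
    refine (congrArg ((D.toLocal i).lim ⟨V.1, hi⟩)
      (IndHom.lim_restrict_apply (D.ofLocal k) (inf_le_right : U i ⊓ U k ≤ U k) V.2 x)).trans ?_
    exact (D.lim_toLocal i ⟨V.1, hi⟩ _).trans (D.evalLim_ofLocal i k V.1 hi hk x)

end GluingDatum

end Glue

/-! ### Gluing morphisms of sheaves -/

section SheafMorphisms

variable {K : Type} [Field K] {X : Type u} [TopologicalSpace X] {Λ : Type u} {U : Λ → Opens X}

theorem SuperPresheaf.IsSheaf.ext_of_cover {P : SuperPresheaf K (⊤ : Opens X)} (hP : P.IsSheaf)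
    (hU : ⨆ i, U i = ⊤) {V : Set.Iic (⊤ : Opens X)} {s t : P.carrier.obj (op V)}
    (h : ∀ i (O : Opens X) (hV : O ≤ V.1) (_ : O ≤ U i),
      P.res (V := ⟨O, (le_top : O ≤ ⊤)⟩) hV s = P.res (V := ⟨O, (le_top : O ≤ ⊤)⟩) hV t) : s = t :=
  hP.ext (O := fun i => ⟨V.1 ⊓ U i, (le_top : V.1 ⊓ U i ≤ ⊤)⟩)
    (fun i => (inf_le_left : V.1 ⊓ U i ≤ V.1)) (by rw [← inf_iSup_eq, hU, inf_top_eq])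
    fun i => h i _ inf_le_left inf_le_right

/-- Morphisms into a sheaf over the members of an open covering which agree on the overlaps come
from a morphism. -/
theorem SuperPresheaf.IsSheaf.exists_hom {P Q : SuperPresheaf K (⊤ : Opens X)} (hQ : Q.IsSheaf)
    (hU : ⨆ i, U i = ⊤)
    (f : ∀ i, P.restrict (le_top : U i ≤ ⊤) ⟶ Q.restrict (le_top : U i ≤ ⊤))
    (hf : ∀ i k (O : Opens X) (hi : O ≤ U i) (hk : O ≤ U k)
      (s : P.carrier.obj (op ⟨O, (le_top : O ≤ ⊤)⟩)),
      onOpen (f i) ⟨O, hi⟩ s = onOpen (f k) ⟨O, hk⟩ s) :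
    ∃ g : P ⟶ Q, ∀ i (O : Opens X) (hi : O ≤ U i)
      (s : P.carrier.obj (op ⟨O, (le_top : O ≤ ⊤)⟩)),
      onOpen g ⟨O, (le_top : O ≤ ⊤)⟩ s = onOpen (f i) ⟨O, hi⟩ s := by
  have hres : ∀ i (O O' : Opens X) (hi : O ≤ U i) (h : O' ≤ O)
      (s : P.carrier.obj (op ⟨O, (le_top : O ≤ ⊤)⟩)),
      Q.res (V := ⟨O', (le_top : O' ≤ ⊤)⟩) (W := ⟨O, (le_top : O ≤ ⊤)⟩) h
        (onOpen (f i) ⟨O, hi⟩ s) = onOpen (f i) ⟨O', h.trans hi⟩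
        (P.res (V := ⟨O', (le_top : O' ≤ ⊤)⟩) (W := ⟨O, (le_top : O ≤ ⊤)⟩) h s) :=
    fun i O O' hi h s => (onOpen_res (f i) (V := ⟨O', h.trans hi⟩) (W := ⟨O, hi⟩) h s).symm
  have hex : ∀ (V : Set.Iic (⊤ : Opens X)) (s : P.carrier.obj (op V)),
      ∃ t : Q.carrier.obj (op V), ∀ i (O : Opens X) (hV : O ≤ V.1) (hi : O ≤ U i),
        Q.res (V := ⟨O, (le_top : O ≤ ⊤)⟩) hV t =
          onOpen (f i) ⟨O, hi⟩ (P.res (V := ⟨O, (le_top : O ≤ ⊤)⟩) hV s) := by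
    intro V s
    have key : ∀ i k (O : Opens X) (h1 : O ≤ V.1 ⊓ U i) (h2 : O ≤ V.1 ⊓ U k),
        Q.res (V := ⟨O, (le_top : O ≤ ⊤)⟩) (W := ⟨V.1 ⊓ U i, (le_top : V.1 ⊓ U i ≤ ⊤)⟩) h1
          (onOpen (f i) ⟨V.1 ⊓ U i, (inf_le_right : V.1 ⊓ U i ≤ U i)⟩
            (P.res (V := ⟨V.1 ⊓ U i, (le_top : V.1 ⊓ U i ≤ ⊤)⟩)
              (inf_le_left : V.1 ⊓ U i ≤ V.1) s)) =
        Q.res (V := ⟨O, (le_top : O ≤ ⊤)⟩) (W := ⟨V.1 ⊓ U k, (le_top : V.1 ⊓ U k ≤ ⊤)⟩) h2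
          (onOpen (f k) ⟨V.1 ⊓ U k, (inf_le_right : V.1 ⊓ U k ≤ U k)⟩
            (P.res (V := ⟨V.1 ⊓ U k, (le_top : V.1 ⊓ U k ≤ ⊤)⟩)
              (inf_le_left : V.1 ⊓ U k ≤ V.1) s)) := fun i k O h1 h2 => by
      refine (hres i _ _ inf_le_right h1 _).trans (Eq.trans ?_ (hres k _ _ inf_le_right h2 _).symm)
      rw [P.res_res, P.res_res]
      exact hf i k O _ _ _
    obtain ⟨t, ht, -⟩ := hQ.existsUnique_glue
      (O := fun i => ⟨V.1 ⊓ U i, (le_top : V.1 ⊓ U i ≤ ⊤)⟩) (W := V)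
      (fun i => (inf_le_left : V.1 ⊓ U i ≤ V.1)) (by rw [← inf_iSup_eq, hU, inf_top_eq])
      (fun i => onOpen (f i) ⟨V.1 ⊓ U i, (inf_le_right : V.1 ⊓ U i ≤ U i)⟩
        (P.res (V := ⟨V.1 ⊓ U i, (le_top : V.1 ⊓ U i ≤ ⊤)⟩)
          (inf_le_left : V.1 ⊓ U i ≤ V.1) s)) fun i k =>
        key i k _ inf_le_left inf_le_right
    refine ⟨t, fun i O hV hi => ?_⟩
    have h1 := congrArg (Q.res (V := ⟨O, (le_top : O ≤ ⊤)⟩)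
      (W := ⟨V.1 ⊓ U i, (le_top : V.1 ⊓ U i ≤ ⊤)⟩) (le_inf hV hi)) (ht i)
    rw [Q.res_res] at h1
    refine h1.trans ((hres i _ _ inf_le_right (le_inf hV hi) _).trans ?_)
    rw [P.res_res]
  choose t ht using hex
  refine ⟨SuperPresheaf.mkHom (fun V =>
    { toFun := t V
      map_add' := fun s s' => hQ.ext_of_cover hU fun i O hV hi => ?_
      map_smul' := fun c s => hQ.ext_of_cover hU fun i O hV hi => ?_ })
    (fun {V W} h s => hQ.ext_of_cover hU fun i O hV hi => ?_), fun i O hi s => ?_⟩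
  · rw [ht _ _ i O hV hi, map_add, map_add, ht _ _ i O hV hi, ht _ _ i O hV hi]
    exact map_add (onOpen (f i) ⟨O, hi⟩) _ _
  · rw [ht _ _ i O hV hi, RingHom.id_apply, map_smul, map_smul, ht _ _ i O hV hi]
    exact map_smul (onOpen (f i) ⟨O, hi⟩) _ _
  · refine (ht V _ i O hV hi).trans ?_
    rw [P.res_res, Q.res_res]
    exact (ht W s i O (hV.trans h) hi).symm
  · have h := ht ⟨O, (le_top : O ≤ ⊤)⟩ s i O le_rfl hi
    rw [Q.res_self, P.res_self] at h
    exact h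

/-- The parity of a section of a sheaf can be checked locally. -/
theorem SuperPresheaf.IsSheaf.mem_parity_of_cover {P : SuperPresheaf K (⊤ : Opens X)}
    (hP : P.IsSheaf) (hU : ⨆ i, U i = ⊤) {V : Set.Iic (⊤ : Opens X)} {p : ZMod 2}
    {s : P.carrier.obj (op V)}
    (h : ∀ i (O : Opens X) (hV : O ≤ V.1) (_ : O ≤ U i),
      P.res (V := ⟨O, (le_top : O ≤ ⊤)⟩) hV s ∈ P.parity ⟨O, (le_top : O ≤ ⊤)⟩ p) :
    s ∈ P.parity V p :=
  mem_of_internalProj_eq_zero (P.isInternal V) fun q hq => hP.ext_of_cover hU fun i O hV hi => by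
    rw [← internalProj_map (P.isInternal V) (P.isInternal ⟨O, (le_top : O ≤ ⊤)⟩) _
      (fun p x hx => P.res_mem hV hx), internalProj_of_mem_ne _ hq.symm (h i O hV hi), map_zero]

end SheafMorphisms

/-! ### Sections of a glued object through its local sheaves -/

section Gluing

variable {K : Type} [Field K] {X : Type u} [TopologicalSpace X] {Λ : Type u} {U : Λ → Opens X}
  {A : Type u} [SmallCategory A] {D : GluingDatum K A U}

namespace Gluing

/-- The map on inductive limits induced by `Φ i`. -/
noncomputable def loc (E : Gluing D) (i : Λ) {O : Opens X} (hi : O ≤ U i) :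
    Lim E.𝒱.sys ⟨O, (le_top : O ≤ ⊤)⟩ →ₗ[K] Lim (D.𝒱 i).sys ⟨O, hi⟩ :=
  (E.Φ i).hom.lim ⟨O, hi⟩

/-- The map on inductive limits induced by the inverse of `Φ i`. -/
noncomputable def locInv (E : Gluing D) (i : Λ) {O : Opens X} (hi : O ≤ U i) :
    Lim (D.𝒱 i).sys ⟨O, hi⟩ →ₗ[K] Lim E.𝒱.sys ⟨O, (le_top : O ≤ ⊤)⟩ :=
  (E.Φ i).inv.lim ⟨O, hi⟩

variable (E : Gluing D)

theorem loc_locInv (i : Λ) {O : Opens X} (hi : O ≤ U i) (x : Lim (D.𝒱 i).sys ⟨O, hi⟩) :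
    E.loc i hi (E.locInv i hi x) = x :=
  IndHom.lim_lim_of_comp_eq_id (E.Φ i).hom_comp_inv ⟨O, hi⟩ x

theorem locInv_loc (i : Λ) {O : Opens X} (hi : O ≤ U i)
    (x : Lim E.𝒱.sys ⟨O, (le_top : O ≤ ⊤)⟩) : E.locInv i hi (E.loc i hi x) = x :=
  IndHom.lim_lim_of_comp_eq_id (E.Φ i).inv_comp_hom ⟨O, hi⟩ x

theorem loc_locInv_eq_limTrans (i k : Λ) {O : Opens X} (hi : O ≤ U i) (hk : O ≤ U k)
    (x : Lim (D.𝒱 k).sys ⟨O, hk⟩) : E.loc i hi (E.locInv k hk x) = D.limTrans i k hi hk x := by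
  have h := LinearMap.congr_fun
    (congrArg (fun Φ => IndHom.lim Φ ⟨O, le_inf hi hk⟩) (E.Φ_comp i k)) x
  have h1 := IndHom.lim_comp ((E.Φ i).hom.restrict (inf_le_left : U i ⊓ U k ≤ U i))
    ((E.Φ k).inv.restrict (inf_le_right : U i ⊓ U k ≤ U k)) ⟨O, le_inf hi hk⟩ x
  have r1 := fun y => IndHom.lim_restrict_apply (E.Φ i).hom
    (inf_le_left : U i ⊓ U k ≤ U i) (O := O) (le_inf hi hk) y
  have r2 := IndHom.lim_restrict_apply (E.Φ k).inv
    (inf_le_right : U i ⊓ U k ≤ U k) (O := O) (le_inf hi hk) x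
  exact (congrArg (E.loc i hi) r2.symm).trans ((r1 _).symm.trans (h1.symm.trans h))

theorem limTrans_loc (i k : Λ) {O : Opens X} (hi : O ≤ U i) (hk : O ≤ U k)
    (x : Lim E.𝒱.sys ⟨O, (le_top : O ≤ ⊤)⟩) :
    D.limTrans i k hi hk (E.loc k hk x) = E.loc i hi x := by
  rw [← E.loc_locInv_eq_limTrans i k hi hk, E.locInv_loc]

/-- The restriction to `O ⊆ V ∩ U i` of an element of the inductive limit over `V`, regarded as
an element of the inductive limit for the `i`-th local sheaf. -/
noncomputable def ev {V : Set.Iic (⊤ : Opens X)} {O : Opens X} (i : Λ) (hV : O ≤ V.1)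
    (hi : O ≤ U i) : Lim E.𝒱.sys V →ₗ[K] Lim (D.𝒱 i).sys ⟨O, hi⟩ :=
  E.loc i hi ∘ₗ Lim.res E.𝒱.sys (V := ⟨O, (le_top : O ≤ ⊤)⟩) (W := V) hV

theorem ev_apply {V : Set.Iic (⊤ : Opens X)} {O : Opens X} (i : Λ) (hV : O ≤ V.1)
    (hi : O ≤ U i) (x : Lim E.𝒱.sys V) : E.ev i hV hi x =
      E.loc i hi (Lim.res E.𝒱.sys (V := ⟨O, (le_top : O ≤ ⊤)⟩) (W := V) hV x) := rfl

variable [IsFiltered A]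

/-- The maps `ev` are jointly injective, so that identities between elements of the inductive limit
of a glued object can be checked on the local sheaves. -/
theorem ev_ext (hU : ⨆ i, U i = ⊤) {V : Set.Iic (⊤ : Opens X)} {x y : Lim E.𝒱.sys V}
    (h : ∀ i (O : Opens X) (hV : O ≤ V.1) (hi : O ≤ U i), E.ev i hV hi x = E.ev i hV hi y) :
    x = y := by
  rw [← sub_eq_zero]
  have h' : ∀ i (O : Opens X) (hV : O ≤ V.1) (hi : O ≤ U i), E.ev i hV hi (x - y) = 0 :=
    fun i O hV hi => by rw [map_sub, h, sub_self]
  generalize x - y = z at h'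
  obtain ⟨α, s, rfl⟩ := Lim.exists_rep _ _ z
  have hs : s = 0 := (E.𝒱.isSheaf α).ext_of_cover hU fun i O hV hi => by
    have h1 := congrArg (E.locInv i hi) (h' i O hV hi)
    rw [ev_apply, locInv_loc, map_zero, Lim.res_ι] at h1
    rw [map_zero]
    exact Lim.ι_injective E.𝒱.injectiveSystem _ α (h1.trans (map_zero _).symm)
  rw [hs, map_zero]

end Gluing

end Gluing

/-! ### Gluing morphisms of VSA-inductive sheaves -/

section Gluing

variable {K : Type} [Field K] {X : Type u} [TopologicalSpace X] {Λ : Type u} {U : Λ → Opens X}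
  {A : Type u} [SmallCategory A] {D D' : GluingDatum K A U}

namespace Gluing

variable (E : Gluing D) (E' : Gluing D')

variable {E E'} in
/-- A morphism which restricts to `G` over `U i` acts as `G` on the components in the `i`-th local
sheaf. -/
theorem ev_lim {F : IndHom E.𝒱.sys E'.𝒱.sys} {i : Λ} {G : IndHom (D.𝒱 i).sys (D'.𝒱 i).sys}
    (h : (E'.Φ i).hom.comp (F.restrict (le_top : U i ≤ ⊤)) = G.comp (E.Φ i).hom)
    {V : Set.Iic (⊤ : Opens X)} {O : Opens X} (hV : O ≤ V.1) (hi : O ≤ U i)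
    (x : Lim E.𝒱.sys V) : E'.ev i hV hi (F.lim V x) = G.lim ⟨O, hi⟩ (E.ev i hV hi x) := by
  have h1 := IndHom.lim_eq_of_comp_eq h ⟨O, hi⟩
    (Lim.res E.𝒱.sys (V := ⟨O, (le_top : O ≤ ⊤)⟩) (W := V) hV x)
  have r1 := IndHom.lim_restrict_apply F (le_top : U i ≤ ⊤) hi
    (Lim.res E.𝒱.sys (V := ⟨O, (le_top : O ≤ ⊤)⟩) (W := V) hV x)
  rw [ev_apply, ← IndHom.lim_res]
  exact (congrArg (E'.loc i hi) r1.symm).trans h1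

theorem ev_T {V : Set.Iic (⊤ : Opens X)} {O : Opens X} (i : Λ) (hV : O ≤ V.1) (hi : O ≤ U i)
    (x : Lim E.𝒱.sys V) :
    E.ev i hV hi (E.𝒱.T.lim V x) = (D.𝒱 i).T.lim ⟨O, hi⟩ (E.ev i hV hi x) :=
  ev_lim (E.Φ i).hom_isStrictMorphism.isVSAMorphism.T hV hi x

theorem ev_H {V : Set.Iic (⊤ : Opens X)} {O : Opens X} (i : Λ) (hV : O ≤ V.1) (hi : O ≤ U i)
    (x : Lim E.𝒱.sys V) :
    E.ev i hV hi (E.𝒱.H.lim V x) = (D.𝒱 i).H.lim ⟨O, hi⟩ (E.ev i hV hi x) :=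
  ev_lim (E.Φ i).hom_isStrictMorphism.preservesGrading.comm_H hV hi x

theorem ev_J {V : Set.Iic (⊤ : Opens X)} {O : Opens X} (i : Λ) (hV : O ≤ V.1) (hi : O ≤ U i)
    (x : Lim E.𝒱.sys V) :
    E.ev i hV hi (E.𝒱.J.lim V x) = (D.𝒱 i).J.lim ⟨O, hi⟩ (E.ev i hV hi x) :=
  ev_lim (E.Φ i).hom_isStrictMorphism.preservesGrading.comm_J hV hi x

theorem ev_prod (n : ℤ) {V : Set.Iic (⊤ : Opens X)} {O : Opens X} (i : Λ) (hV : O ≤ V.1)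
    (hi : O ≤ U i) (x y : Lim E.𝒱.sys V) : E.ev i hV hi ((E.𝒱.prod n).lim V x y) =
      ((D.𝒱 i).prod n).lim ⟨O, hi⟩ (E.ev i hV hi x) (E.ev i hV hi y) := by
  have h1 := (E.Φ i).hom_isStrictMorphism.isVSAMorphism.lim_prod n ⟨O, hi⟩
    (Lim.res E.𝒱.sys (V := ⟨O, (le_top : O ≤ ⊤)⟩) (W := V) hV x)
    (Lim.res E.𝒱.sys (V := ⟨O, (le_top : O ≤ ⊤)⟩) (W := V) hV y)
  have r1 := LinearMap.congr_fun₂ ((E.𝒱.prod n).lim_restrict (le_top : U i ≤ ⊤) ⟨O, hi⟩)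
    (Lim.res E.𝒱.sys (V := ⟨O, (le_top : O ≤ ⊤)⟩) (W := V) hV x)
    (Lim.res E.𝒱.sys (V := ⟨O, (le_top : O ≤ ⊤)⟩) (W := V) hV y)
  rw [ev_apply, ← IndBilin.lim_res]
  exact (congrArg (E.loc i hi) r1.symm).trans h1

theorem ev_vac {V : Set.Iic (⊤ : Opens X)} {O : Opens X} (i : Λ) (hV : O ≤ V.1) (hi : O ≤ U i)
    (c : K) : E.ev i hV hi (E.𝒱.vac.lim V (constElt c V)) =
      (D.𝒱 i).vac.lim ⟨O, hi⟩ (constElt c ⟨O, hi⟩) := by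
  have h1 := (E.Φ i).hom_isStrictMorphism.isVSAMorphism.lim_vac ⟨O, hi⟩ (constElt c ⟨O, hi⟩)
  have r1 := IndHom.lim_restrict_apply E.𝒱.vac (le_top : U i ≤ ⊤) hi
    (constElt c ⟨O, (le_top : O ≤ ⊤)⟩)
  have e : Lim.res (constSystem K (⊤ : Opens X)) (V := ⟨O, (le_top : O ≤ ⊤)⟩) (W := V) hV
      (constElt c V) = constElt c ⟨O, (le_top : O ≤ ⊤)⟩ := Lim.res_ι _ _ _ _
  rw [ev_apply, ← IndHom.lim_res, e]
  exact (congrArg (E.loc i hi) r1.symm).trans h1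

variable {E E'} {G : ∀ i, IndHom (D.𝒱 i).sys (D'.𝒱 i).sys} {F : IndHom E.𝒱.sys E'.𝒱.sys}

/-- The morphism `F` restricts to `G i` if it does so on the inductive limits over the open subsets
of `U i`. -/
theorem restricts_of_lim [IsFiltered A]
    (h : ∀ i (O : Opens X) (hi : O ≤ U i) (x : Lim E.𝒱.sys ⟨O, (le_top : O ≤ ⊤)⟩),
      E'.loc i hi (F.lim ⟨O, (le_top : O ≤ ⊤)⟩ x) = (G i).lim ⟨O, hi⟩ (E.loc i hi x)) :
    E.Restricts E' F G := fun i =>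
  IndHom.comp_eq_of_lim (D'.𝒱 i).injectiveSystem fun V x =>
    (congrArg (E'.loc i V.2)
      (IndHom.lim_restrict_apply F (le_top : U i ≤ ⊤) V.2 x)).trans (h i V.1 V.2 x)

variable [IsFiltered A]

/-- The uniqueness of the glued morphism. -/
theorem Restricts.unique (hU : ⨆ i, U i = ⊤) {F' : IndHom E.𝒱.sys E'.𝒱.sys}
    (h : E.Restricts E' F G) (h' : E.Restricts E' F' G) : F = F' :=
  IndHom.ext_lim E'.𝒱.injectiveSystem fun V x => E'.ev_ext hU fun i O hV hi => by
    rw [ev_lim (h i), ev_lim (h' i)]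

theorem Restricts.preservesVSA (hU : ⨆ i, U i = ⊤) (h : E.Restricts E' F G)
    (hG : ∀ i, PreservesVSA (D.𝒱 i).toVSAIndSheaf (D'.𝒱 i).toVSAIndSheaf (G i)) :
    PreservesVSA E.𝒱.toVSAIndSheaf E'.𝒱.toVSAIndSheaf F :=
  PreservesVSA.of_lim (𝒱 := E.𝒱.toVSAIndSheaf) (𝒱' := E'.𝒱.toVSAIndSheaf)
    (fun V x => by
      have e : F.lim V ∘ₗ E.𝒱.vac.lim V = E'.𝒱.vac.lim V := Lim.const_hom_ext fun c =>
        E'.ev_ext hU fun i O hV hi => by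
          rw [LinearMap.comp_apply, ev_lim (h i), ev_vac, ev_vac, (hG i).lim_vac]
      exact LinearMap.congr_fun e x)
    (fun V x => E'.ev_ext hU fun i O hV hi => by
      rw [ev_lim (h i), ev_T, ev_T, ev_lim (h i), (hG i).lim_T])
    (fun n V x y => E'.ev_ext hU fun i O hV hi => by
      rw [ev_lim (h i), ev_prod, ev_prod, ev_lim (h i), ev_lim (h i), (hG i).lim_prod])

theorem Restricts.preservesGrading (hU : ⨆ i, U i = ⊤) (h : E.Restricts E' F G)
    (hG : ∀ i, PreservesGrading (D.𝒱 i) (D'.𝒱 i) (G i)) : PreservesGrading E.𝒱 E'.𝒱 F where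
  comm_H := IndHom.comp_eq_of_lim E'.𝒱.injectiveSystem fun V x =>
    E'.ev_ext hU fun i O hV hi => by
      rw [ev_lim (h i), ev_H, ev_H, ev_lim (h i), IndHom.lim_eq_of_comp_eq (hG i).comm_H]
  comm_J := IndHom.comp_eq_of_lim E'.𝒱.injectiveSystem fun V x =>
    E'.ev_ext hU fun i O hV hi => by
      rw [ev_lim (h i), ev_J, ev_J, ev_lim (h i), IndHom.lim_eq_of_comp_eq (hG i).comm_J]

/-- The existence of the glued morphism, with components indexed as those of the local
morphisms. -/
theorem exists_restricts (hU : ⨆ i, U i = ⊤) (E : Gluing D) (E' : Gluing D')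
    (hG : D.Compatible D' G) {j : A → A} {g : ∀ i α, (D.𝒱 i).sys.obj α ⟶ (D'.𝒱 i).sys.obj (j α)}
    (hg : ∀ i α, (G i).app α = HomGerm.mk (D'.𝒱 i).sys (j α) (g i α)) :
    ∃ (F : IndHom E.𝒱.sys E'.𝒱.sys) (f : ∀ α, E.𝒱.sys.obj α ⟶ E'.𝒱.sys.obj (j α)),
      (∀ α, F.app α = HomGerm.mk E'.𝒱.sys (j α) (f α)) ∧ E.Restricts E' F G ∧
      ((∀ i, (G i).IsEven) → ∀ α, SuperPresheaf.IsEven (f α)) := by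
  choose φ hφ using fun i => (E.Φ i).hom_isStrictMorphism.isStrict
  choose ψ hψ using fun i => (E'.Φ i).inv_isStrictMorphism.isStrict
  -- the morphisms `(Φ' i)⁻¹ ∘ G i ∘ Φ i` of presheaves over the `U i`
  let f₀ : ∀ α i, (E.𝒱.sys.obj α).restrict (le_top : U i ≤ ⊤) ⟶
      (E'.𝒱.sys.obj (j α)).restrict (le_top : U i ≤ ⊤) := fun α i =>
    φ i α ≫ g i α ≫ ψ i (j α)
  have hf₀ : ∀ α i (O : Opens X) (hi : O ≤ U i)
      (s : (E.𝒱.sys.obj α).carrier.obj (op ⟨O, (le_top : O ≤ ⊤)⟩)),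
      Lim.ι E'.𝒱.sys ⟨O, (le_top : O ≤ ⊤)⟩ (j α) (SuperPresheaf.onOpen (f₀ α i) ⟨O, hi⟩ s) =
        E'.locInv i hi ((G i).lim ⟨O, hi⟩
          (E.loc i hi (Lim.ι E.𝒱.sys ⟨O, (le_top : O ≤ ⊤)⟩ α s))) := fun α i O hi s => by
    have h1 : E.loc i hi (Lim.ι E.𝒱.sys ⟨O, (le_top : O ≤ ⊤)⟩ α s) =
        Lim.ι (D.𝒱 i).sys ⟨O, hi⟩ α (SuperPresheaf.onOpen (φ i α) ⟨O, hi⟩ s) :=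
      IndHom.lim_ι_of_eq (hφ i α) ⟨O, hi⟩ s
    rw [h1, IndHom.lim_ι_of_eq (hg i α)]
    exact (IndHom.lim_ι_of_eq (hψ i (j α)) ⟨O, hi⟩ _).symm
  have hcomm : ∀ i k (O : Opens X) (hi : O ≤ U i) (hk : O ≤ U k)
      (x : Lim E.𝒱.sys ⟨O, (le_top : O ≤ ⊤)⟩),
      E'.locInv i hi ((G i).lim ⟨O, hi⟩ (E.loc i hi x)) =
        E'.locInv k hk ((G k).lim ⟨O, hk⟩ (E.loc k hk x)) := fun i k O hi hk x => by
    rw [← E.limTrans_loc i k hi hk, ← GluingDatum.limTrans_comm hG i k hi hk,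
      ← E'.loc_locInv_eq_limTrans i k hi hk, E'.locInv_loc]
  choose f hf using fun α => (E'.𝒱.isSheaf (j α)).exists_hom hU (f₀ α) fun i k O hi hk s =>
    Lim.ι_injective E'.𝒱.injectiveSystem _ (j α)
      ((hf₀ α i O hi s).trans ((hcomm i k O hi hk _).trans (hf₀ α k O hk s).symm))
  have hι : ∀ α i {V : Set.Iic (⊤ : Opens X)} (O : Opens X) (hV : O ≤ V.1) (hi : O ≤ U i)
      (s : (E.𝒱.sys.obj α).carrier.obj (op V)),
      E'.ev i hV hi (Lim.ι E'.𝒱.sys V (j α) (SuperPresheaf.onOpen (f α) V s)) =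
        (G i).lim ⟨O, hi⟩ (E.ev i hV hi (Lim.ι E.𝒱.sys V α s)) := fun α i V O hV hi s => by
    rw [ev_apply, ev_apply, Lim.res_ι, Lim.res_ι, ← SuperPresheaf.onOpen_res, hf α i O hi,
      hf₀ α i O hi, loc_locInv]
  refine ⟨IndHom.ofLim E'.𝒱.injectiveSystem (fun α => HomGerm.mk E'.𝒱.sys (j α) (f α))
    (fun {α β} k V s => E'.ev_ext hU fun i O hV hi => ?_), f, fun _ => rfl,
    restricts_of_lim fun i O hi x => ?_, fun hev α V p s hs => ?_⟩
  · rw [HomGerm.lim_mk, HomGerm.lim_mk, hι, hι, Lim.ι_map]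
  · obtain ⟨α, s, rfl⟩ := Lim.exists_rep _ _ x
    rw [IndHom.lim_ι]
    change E'.loc i hi (Lim.ι E'.𝒱.sys ⟨O, (le_top : O ≤ ⊤)⟩ (j α)
      (SuperPresheaf.onOpen (f α) ⟨O, (le_top : O ≤ ⊤)⟩ s)) = _
    rw [hf α i O hi, hf₀ α i O hi, loc_locInv]
  · refine (E'.𝒱.isSheaf (j α)).mem_parity_of_cover hU fun i O hV hi => ?_
    rw [← SuperPresheaf.onOpen_res, hf α i O hi]
    have e1 := (E.Φ i).hom_isStrictMorphism.isVSAMorphism.even.of_app_eq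
      (D.𝒱 i).injectiveSystem (D.𝒱 i).evenSystem (hφ i α)
    have e2 := (hev i).of_app_eq (D'.𝒱 i).injectiveSystem (D'.𝒱 i).evenSystem (hg i α)
    have e3 := (E'.Φ i).inv_isStrictMorphism.isVSAMorphism.even.of_app_eq
      (E'.𝒱.restrict (le_top : U i ≤ ⊤)).injectiveSystem
      (E'.𝒱.restrict (le_top : U i ≤ ⊤)).evenSystem (hψ i (j α))
    exact e3 ⟨O, hi⟩ p _ (e2 ⟨O, hi⟩ p _ (e1 ⟨O, hi⟩ p _
      ((E.𝒱.sys.obj α).res_mem (V := ⟨O, (le_top : O ≤ ⊤)⟩) hV hs)))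

end Gluing

end Gluing

/-! ### Properties of glued morphisms, and uniqueness of the glued object -/

section Identity

variable {K : Type} [Field K] {X : Type u} [TopologicalSpace X] {U : Opens X}
  {A : Type u} [SmallCategory A] [IsFiltered A]

theorem IsStrictMorphism.id (𝒱 : DegWtVSAIndSheaf K A U) :
    IsStrictMorphism 𝒱 𝒱 (IndHom.id 𝒱.sys) where
  isVSAMorphism :=
    { PreservesVSA.of_lim (𝒱 := 𝒱.toVSAIndSheaf) (𝒱' := 𝒱.toVSAIndSheaf)
        (fun V x => by rw [IndHom.lim_id])
        (fun V x => by rw [IndHom.lim_id, IndHom.lim_id])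
        (fun n V x y => by rw [IndHom.lim_id, IndHom.lim_id, IndHom.lim_id]) with
      even := fun α => ⟨α, 𝟙 _, fun _ _ _ hx => hx, rfl⟩ }
  preservesGrading :=
    { comm_H := IndHom.comp_eq_of_lim 𝒱.injectiveSystem fun V x => by
        rw [IndHom.lim_id, IndHom.lim_id]
      comm_J := IndHom.comp_eq_of_lim 𝒱.injectiveSystem fun V x => by
        rw [IndHom.lim_id, IndHom.lim_id] }
  isStrict := ⟨fun _ => 𝟙 _, fun _ => rfl⟩

end Identity

section Gluing

variable {K : Type} [Field K] {X : Type u} [TopologicalSpace X] {Λ : Type u} {U : Λ → Opens X}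
  {A : Type u} [SmallCategory A] [IsFiltered A] {D D' : GluingDatum K A U}

theorem GluingDatum.compatible_id (D : GluingDatum K A U) :
    D.Compatible D fun i => IndHom.id (D.𝒱 i).sys := fun i k =>
  IndHom.comp_eq_of_lim ((D.𝒱 i).injectiveSystem.restrict (inf_le_left : U i ⊓ U k ≤ U i))
    fun V x => (congrArg ((D.θ i k).hom.lim V) (IndHom.lim_id _ V x)).trans
      (IndHom.lim_id _ V ((D.θ i k).hom.lim V x)).symm

namespace Gluing

variable {E : Gluing D} {E' : Gluing D'} {G : ∀ i, IndHom (D.𝒱 i).sys (D'.𝒱 i).sys}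
  {F : IndHom E.𝒱.sys E'.𝒱.sys}

/-- By uniqueness, a morphism restricting to strict morphisms is the one glued with the identity as
index map. -/
theorem Restricts.isStrict (hU : ⨆ i, U i = ⊤) (h : E.Restricts E' F G)
    (hG : D.Compatible D' G) (hs : ∀ i, (G i).IsStrict) : F.IsStrict := by
  choose g hg using hs
  obtain ⟨F', f, hf, hF', -⟩ := exists_restricts hU E E' hG (j := fun α => α) hg
  rw [h.unique hU hF']
  exact ⟨f, hf⟩

theorem Restricts.isEven (hU : ⨆ i, U i = ⊤) (h : E.Restricts E' F G)
    (hG : D.Compatible D' G) {j : A → A} {g : ∀ i α, (D.𝒱 i).sys.obj α ⟶ (D'.𝒱 i).sys.obj (j α)}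
    (hg : ∀ i α, (G i).app α = HomGerm.mk (D'.𝒱 i).sys (j α) (g i α))
    (he : ∀ i, (G i).IsEven) : F.IsEven := by
  obtain ⟨F', f, hf, hF', hev⟩ := exists_restricts hU E E' hG hg
  rw [h.unique hU hF']
  exact fun α => ⟨j α, f α, hev he α, hf α⟩

theorem Restricts.isVSAMorphism (hU : ⨆ i, U i = ⊤) (h : E.Restricts E' F G)
    (hG : D.Compatible D' G) {j : A → A} {g : ∀ i α, (D.𝒱 i).sys.obj α ⟶ (D'.𝒱 i).sys.obj (j α)}
    (hg : ∀ i α, (G i).app α = HomGerm.mk (D'.𝒱 i).sys (j α) (g i α))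
    (hv : ∀ i, IsVSAMorphism (D.𝒱 i).toVSAIndSheaf (D'.𝒱 i).toVSAIndSheaf (G i)) :
    IsVSAMorphism E.𝒱.toVSAIndSheaf E'.𝒱.toVSAIndSheaf F where
  toPreservesVSA := h.preservesVSA hU fun i => (hv i).toPreservesVSA
  even := h.isEven hU hG hg fun i => (hv i).even

theorem Restricts.isStrictMorphism (hU : ⨆ i, U i = ⊤) (h : E.Restricts E' F G)
    (hG : D.Compatible D' G) (hs : ∀ i, IsStrictMorphism (D.𝒱 i) (D'.𝒱 i) (G i)) :
    IsStrictMorphism E.𝒱 E'.𝒱 F where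
  isVSAMorphism := by
    choose g hg using fun i => (hs i).isStrict
    exact h.isVSAMorphism hU hG (j := fun α => α) hg fun i => (hs i).isVSAMorphism
  preservesGrading := h.preservesGrading hU fun i => (hs i).preservesGrading
  isStrict := h.isStrict hU hG fun i => (hs i).isStrict

/-- Two glued objects of the same gluing datum are strictly isomorphic. -/
theorem exists_strictIso (hU : ⨆ i, U i = ⊤) (E E' : Gluing D) :
    ∃ F : StrictIso E.𝒱 E'.𝒱, E.Restricts E' F.hom fun i => IndHom.id (D.𝒱 i).sys := by
  have hex : ∀ E E' : Gluing D, ∃ F : IndHom E.𝒱.sys E'.𝒱.sys,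
      E.Restricts E' F fun i => IndHom.id (D.𝒱 i).sys := fun E E' => by
    obtain ⟨F, -, -, hF, -⟩ := exists_restricts hU E E' D.compatible_id (j := fun α => α)
      (g := fun _ _ => 𝟙 _) fun _ _ => rfl
    exact ⟨F, hF⟩
  have hinv : ∀ {E E' : Gluing D} {F : IndHom E.𝒱.sys E'.𝒱.sys} {F' : IndHom E'.𝒱.sys E.𝒱.sys},
      E.Restricts E' F (fun i => IndHom.id (D.𝒱 i).sys) →
      E'.Restricts E F' (fun i => IndHom.id (D.𝒱 i).sys) →
      F'.comp F = IndHom.id E.𝒱.sys := fun {E E' F F'} h h' =>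
    IndHom.comp_eq_id_of_lim E.𝒱.injectiveSystem fun V x => E.ev_ext hU fun i O hV hi => by
      rw [ev_lim (h' i), ev_lim (h i), IndHom.lim_id, IndHom.lim_id]
  obtain ⟨F, hF⟩ := hex E E'
  obtain ⟨F', hF'⟩ := hex E' E
  exact ⟨⟨F, F', hF.isStrictMorphism hU D.compatible_id fun i => .id _,
    hF'.isStrictMorphism hU D.compatible_id fun i => .id _, hinv hF hF', hinv hF' hF⟩, hF⟩

end Gluing

end Gluing

end VSAInd

theorem mainTheorem5 {K : Type} [RCLike K] {X : Type u} [TopologicalSpace X]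
    {A : Type u} [SmallCategory A] [IsFiltered A]
    (hA : ∀ α α' : A, Nonempty (α ⟶ α') ∨ Nonempty (α' ⟶ α))
    {Λ : Type u} (U : Λ → Opens X) (hU : ⨆ i, U i = ⊤) :
    (∀ D : VSAInd.GluingDatum K A U, D.IsUniform →
      Nonempty (VSAInd.Gluing D) ∧
      ∀ E E' : VSAInd.Gluing D, ∃ F : VSAInd.StrictIso E.𝒱 E'.𝒱,
        ∀ i, (E'.Φ i).hom.comp (F.hom.restrict (le_top : U i ≤ ⊤)) = (E.Φ i).hom) ∧
    (∀ D D' : VSAInd.GluingDatum K A U, D.IsUniform → D'.IsUniform →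
      ∀ (E : VSAInd.Gluing D) (E' : VSAInd.Gluing D')
        (G : ∀ i, VSAInd.IndHom (D.𝒱 i).sys (D'.𝒱 i).sys), D.Compatible D' G →
        ∀ (jG : A → A) (g : ∀ i α, (D.𝒱 i).sys.obj α ⟶ (D'.𝒱 i).sys.obj (jG α)),
          (∀ i α, (G i).app α = VSAInd.HomGerm.mk (D'.𝒱 i).sys (jG α) (g i α)) →
          (∃! F : VSAInd.IndHom E.𝒱.sys E'.𝒱.sys, E.Restricts E' F G) ∧
          ∀ F : VSAInd.IndHom E.𝒱.sys E'.𝒱.sys, E.Restricts E' F G →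
            (∃ f : ∀ α, E.𝒱.sys.obj α ⟶ E'.𝒱.sys.obj (jG α),
              ∀ α, F.app α = VSAInd.HomGerm.mk E'.𝒱.sys (jG α) (f α)) ∧
            ((∀ i, (G i).IsStrict) → F.IsStrict) ∧
            ((∀ i, (G i).IsEven) → F.IsEven) ∧
            ((∀ i, VSAInd.PreservesVSA (D.𝒱 i).toVSAIndSheaf (D'.𝒱 i).toVSAIndSheaf (G i)) →
              VSAInd.PreservesVSA E.𝒱.toVSAIndSheaf E'.𝒱.toVSAIndSheaf F) ∧
            ((∀ i, VSAInd.IsVSAMorphism (D.𝒱 i).toVSAIndSheaf (D'.𝒱 i).toVSAIndSheaf (G i)) →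
              VSAInd.IsVSAMorphism E.𝒱.toVSAIndSheaf E'.𝒱.toVSAIndSheaf F) ∧
            ((∀ i, VSAInd.IsStrictMorphism (D.𝒱 i) (D'.𝒱 i) (G i)) →
              VSAInd.IsStrictMorphism E.𝒱 E'.𝒱 F)) := by
  refine ⟨fun D hD => ⟨⟨hD.gluing⟩, fun E E' => ?_⟩, fun D D' _ _ E E' G hG jG g hg => ?_⟩
  · obtain ⟨F, hF⟩ := VSAInd.Gluing.exists_strictIso hU E E'
    refine ⟨F, fun i => (hF i).trans (VSAInd.IndHom.ext_lim (D.𝒱 i).injectiveSystem fun V x => ?_)⟩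
    rw [VSAInd.IndHom.lim_comp, VSAInd.IndHom.lim_id]
  · obtain ⟨F₀, f, hf, hF₀, -⟩ := VSAInd.Gluing.exists_restricts hU E E' hG hg
    refine ⟨⟨F₀, hF₀, fun F hF => VSAInd.Gluing.Restricts.unique hU hF hF₀⟩, fun F hF =>
      ⟨⟨f, fun α => ?_⟩, VSAInd.Gluing.Restricts.isStrict hU hF hG,
        VSAInd.Gluing.Restricts.isEven hU hF hG hg, VSAInd.Gluing.Restricts.preservesVSA hU hF,
        VSAInd.Gluing.Restricts.isVSAMorphism hU hF hG hg,
        VSAInd.Gluing.Restricts.isStrictMorphism hU hF hG⟩⟩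
    rw [VSAInd.Gluing.Restricts.unique hU hF hF₀]
    exact hf α
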